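/- **Setting.** $\lambda$ is the security parameter. Adversaries are probabilistic polynomial-time in the non-uniform sense (families of probabilistic programs of cost polynomial in $\lambda$); they may evaluate all public algorithms below, including the public map $H$. A function of $\lambda$ is negligible if it decays faster than the inverse of every polynomial. *TPF.* $\mathbb G_\lambda$ is a finite cyclic group of order $q$ whose elements have encodings of polynomial length, and $H:\{0,1\}^*\to\mathbb G_\lambda$ is a public map determined by public parameters sampled at setup. Keys are uniform in $\mathbb Z_q^{*}$ (units modulo $q$); $\mathsf{TPF.Rnd}(k,m)=H(m)^k$, $\mathsf{TPF.ReEnc}(s,\rho)=s^{\rho}$, and the re-encryption key from $k_1$ to $k_2$ is $k_2/k_1$. *F.* $F:\{0,1\}^\lambda\times\{0,1\}^*\to\{0,1\}^\lambda$ is a keyed function, written $F_\kappa(x)$ with key $\kappa$. *TUR.* This is Paillier encryption with $N=pq$, where $(p,q)$ is a uniform pair of distinct $\lambda$-bit primes with $\gcd(pq,(p-1)(q-1))=1$: $\mathsf{TUR.Enc}(m)=(1+N)^m\rho^N \bmod N^2$ with $\rho$ uniform in $\mathbb Z_N^*$, and $\mathsf{TUR.ReEnc}(C)=C\cdot\mathsf{TUR.Enc}(0)\bmod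 N^2$. Some two-step decryption procedure is fixed that derives from $(p,q)$ two partial decryption keys $pdk_1,pdk_2$ of polynomial length such that partial decryption with one key followed by decryption with the other returns the plaintext. *Indexes.* A plaintext prefix index and a plaintext keyword index of polynomial size are given; all prefixes and keywords are pairwise distinct strings, and each word $x$ has one bitmap share $B^s_x$ for each cloud server $CS_s$, $s\in\{1,2\}$. With secret keys $k_M$ (for TPF) and $k_T$ (for $F$), the initial entry of $x$ stored at $CS_s$ is $(\mathsf{TPF.Rnd}(k_M,x),\ \mathsf{TUR.Enc}(B^s_x),\ F_{k_T}(s,x))$. Server $CS_s$ has a secret shuffle parameter $r_s=(\rho_s,\kappa_s)$ consisting of an independent uniform exponent $\rho_s\in\mathbb Z_q^*$ and tag key $\kappa_s\in\{0,1\}^\lambda$, the same in all rounds. To *refresh* an entry $(x,ID,tag)$, $CS_s$ replaces it by $(\mathsf{TPF.ReEnc}(x,\rho_s),\ \mathsf{TUR.ReEnc}(ID),\ F_{\kappa_s}(tag))$. In a shuffle round, for each $s$ and each of the two indexes, the list stored at $CS_s$ is sent to the other server, which refreshes all entries and applies a uniformly random permutation; $CS_s$ then does the same with the resulting list. *Shuffle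 experiment.* Fix a corrupted server $CS_c$, a share $o\in\{1,2\}$, one of the two indexes, two of its entries $e_0,e_1$, and a polynomially bounded number of previous shuffle rounds. After these rounds one more round is carried out. A uniform bit $b$ is chosen, and $e^\star$ is the entry of the final list at $CS_o$ that originates from $e_b$. The adversary receives the view of $CS_c$ in this round: $N$, $pdk_c$, $r_c$, the authorization key $k_M/k_u$ of a client with uniform key $k_u$, the coins of $CS_c$ in this round and, for both shares and both indexes, the list before the round (in the order of the plaintext index), the intermediate list and the final permuted list; in addition it receives $e_0$, $e_1$, $e^\star$ and the position of $e^\star$. It outputs a bit $b'$. **Theorem.** Suppose that 1. $\mathsf{TPF.Rnd}$ is a secure pseudorandom function: no adversary with oracle access distinguishes $\mathsf{TPF.Rnd}(k,\cdot)$, for uniform $k$, from a uniformly random function to $\mathbb G_\lambda$ with non-negligible advantage; 2. $F$ is a secure pseudorandom function in the same sense; 3. $\mathsf{TUR.ReEnc}$ is computationally unlinkable for each server: for $c\in\{1,2\}$ and all plaintext families $m_0,m_1$ of polynomial length, every adversary that is given $N$, $pdk_c$, $C_0=\mathsf{TUR.Enc}(m_0)$, $C_1=\mathsf{TUR.Enc}(m_1)$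 and $\mathsf{TUR.ReEnc}(C_b)$ for a uniform bit $b$ guesses $b$ with probability at most $\tfrac12+\mathsf{negl}(\lambda)$. Then shuffle indistinguishability holds: for every family of indexes, every choice of $c$, $o$, index, $e_0,e_1$ and number of previous rounds as above, and every adversary, in the shuffle experiment $$\Pr[b'=b]\le \tfrac12+\mathsf{negl}(\lambda).$$ -/

import Mathlib

/-! ## Asymptotics -/

namespace Brasp

/-- A function of the security parameter is negligible. -/
def Negligible (f : ℕ → ℝ) : Prop :=
  Asymptotics.SuperpolynomialDecay Filter.atTop (fun n : ℕ => (n : ℝ)) f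

/-- A quantity is bounded by a polynomial in the security parameter. -/
def PolyBounded (f : ℕ → ℕ) : Prop :=
  ∃ P : Polynomial ℕ, ∀ n, f n ≤ P.eval n

/-- The uniform distribution on a nonempty finite type. -/
noncomputable def unif (α : Type) [Finite α] [Nonempty α] : PMF α :=
  letI := Fintype.ofFinite α
  PMF.uniformOfFintype α

/-- The probability of the outcome `true`. -/
noncomputable def prob (d : PMF Bool) : ℝ := (d true).toReal

/-! ## Adversaries

A probabilistic polynomial-time adversary is a family, indexed by the security parameter, of
probabilistic straight-line programs of polynomial cost (the non-uniform model).
Bit strings are identified with natural numbers.  A program works on a list of registers: it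
starts with its input, and every instruction appends one register.
An instruction of width `w` returns its result modulo `2 ^ w` and costs `1 + w`; all the
arithmetic and sampling instructions are feasible in time polynomial in the length of their
operands.  The public algorithms of the scheme (group operations, the public map into the group,
the function `F`) may be called as instructions, and in an oracle experiment so may the
challenge oracle. -/

/-- The basic arithmetic instructions (subtraction is truncated). -/
inductive Arith
  | add | sub | mul | div | mod

def Arith.eval : Arith → ℕ → ℕ → ℕ
  | .add, x, y => x + y
  | .sub, x, y => x - y
  | .mul, x, y => x * y
  | .div, x, y => x / y
  | .mod, x, y => x % y

/-- The procedures that a program can call: the description of the public parameters, the public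
map into the group, multiplication and exponentiation in the group, the function `F` with an
explicitly given key, and the challenge oracle of the experiment. -/
inductive Proc
  | param | hash | gmul | gpow | prf | chal

inductive Instr
  /-- the constant `c` -/
  | const (c : ℕ)
  /-- an arithmetic operation on registers `i` and `j` -/
  | arith (op : Arith) (w i j : ℕ)
  /-- modular exponentiation, register `i` to the power register `j` modulo register `k` -/
  | powMod (w i j k : ℕ)
  /-- a uniform number below the content of register `i` -/
  | sample (w i : ℕ)
  /-- a uniform invertible residue modulo the content of register `i` -/
  | sampleUnit (w i : ℕ)
  /-- a procedure call with arguments in registers `i` and `j` -/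
  | call (p : Proc) (w i j : ℕ)

def Instr.cost : Instr → ℕ
  | .const c => 1 + c.size
  | .arith _ w _ _ => 1 + w
  | .powMod w _ _ _ => 1 + w
  | .sample w _ => 1 + w
  | .sampleUnit w _ => 1 + w
  | .call _ w _ _ => 1 + w

/-- What each procedure returns on a pair of arguments. -/
abbrev Env := Proc → ℕ → ℕ → ℕ

/-- The content of a register (unwritten registers contain `0`). -/
def reg (regs : List ℕ) (i : ℕ) : ℕ := regs.getD i 0

noncomputable def Instr.eval (env : Env) (regs : List ℕ) : Instr → PMF ℕ
  | .const c => PMF.pure c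
  | .arith op w i j => PMF.pure (op.eval (reg regs i) (reg regs j) % 2 ^ w)
  | .powMod w i j k => PMF.pure (reg regs i ^ reg regs j % reg regs k % 2 ^ w)
  | .sample w i => (unif (Fin (reg regs i - 1 + 1))).map fun x => x.val % 2 ^ w
  | .sampleUnit w i => (unif (ZMod (reg regs i))ˣ).map fun x => x.val.val % 2 ^ w
  | .call p w i j => PMF.pure (env p (reg regs i) (reg regs j) % 2 ^ w)

abbrev Program := List Instr

/-- The cost of a program. -/
def Program.cost (A : Program) : ℕ := (A.map Instr.cost).sum

/-- The final registers of a run. -/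
noncomputable def Program.run (env : Env) : Program → List ℕ → PMF (List ℕ)
  | [], regs => PMF.pure regs
  | i :: A, regs => (i.eval env regs).bind fun v => Program.run env A (regs ++ [v])

/-- The output bit: whether the last register contains `1`. -/
noncomputable def Program.out (A : Program) (env : Env) (input : List ℕ) : PMF Bool :=
  (A.run env input).map fun regs => decide (regs.getLast? = some 1)

/-- An adversary: a program of polynomial cost for every security parameter. -/
structure Adversary where
  prog : ℕ → Program
  poly : PolyBounded fun n => (prog n).cost

/-! ## The tailored proxy pseudorandom function -/

/-- The data of the tailored proxy pseudorandom function: for every security parameter a finite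
cyclic group whose elements are written as strings of polynomial length, and a public map from
strings to the group, which is determined by public parameters sampled at setup (`descr` is the
part of the public parameters that is published as a string). -/
structure TPF where
  G : ℕ → Type
  [group : ∀ n, CommGroup (G n)]
  [fintype : ∀ n, Fintype (G n)]
  [cyclic : ∀ n, IsCyclic (G n)]
  enc : ∀ n, G n → ℕ
  enc_injective : ∀ n, Function.Injective (enc n)
  len : ℕ → ℕ
  len_poly : PolyBounded len
  enc_size : ∀ n g, (enc n g).size ≤ len n
  Param : ℕ → Type
  setup : ∀ n, PMF (Param n)
  descr : ∀ n, Param n → ℕ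
  hash : ∀ n, Param n → ℕ → G n

attribute [instance] TPF.group TPF.fintype TPF.cyclic

namespace TPF

variable (T : TPF)

/-- Keys are the exponents that are invertible modulo the order of the group. -/
abbrev Key (n : ℕ) : Type := (ZMod (Fintype.card (T.G n)))ˣ

noncomputable def keyGen (n : ℕ) : PMF (T.Key n) := unif (T.Key n)

def reEnc {n : ℕ} (s : T.G n) (rk : T.Key n) : T.G n := s ^ rk.val.val

def rnd {n : ℕ} (pp : T.Param n) (k : T.Key n) (m : ℕ) : T.G n := (T.hash n pp m) ^ k.val.val

/-- The re-encryption key from `k₁` to `k₂`. -/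
def recKeyGen {n : ℕ} (k₁ k₂ : T.Key n) : T.Key n := k₂ / k₁

/-- Re-encryption turns a value under `k₁` into the value under `k₂`. -/
theorem reEnc_rnd {n : ℕ} (pp : T.Param n) (k₁ k₂ : T.Key n) (m : ℕ) :
    T.reEnc (T.rnd pp k₁ m) (T.recKeyGen k₁ k₂) = T.rnd pp k₂ m := by
  unfold reEnc rnd recKeyGen
  rw [← pow_mul, ← pow_mod_card, ← ZMod.val_mul, ← Units.val_mul]
  congr 3
  simp

open Classical in
/-- Exponentiation on encoded elements (`0` if the argument encodes no group element). -/
noncomputable def encPow (n : ℕ) (x e : ℕ) : ℕ :=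
  if h : ∃ g, T.enc n g = x then T.enc n (h.choose ^ e) else 0

open Classical in
/-- Multiplication on encoded elements (`0` if an argument encodes no group element). -/
noncomputable def encMul (n : ℕ) (x y : ℕ) : ℕ :=
  if h : (∃ g, T.enc n g = x) ∧ ∃ g, T.enc n g = y then
    T.enc n (h.1.choose * h.2.choose) else 0

end TPF

/-! ## The pseudorandom function `F`, and pseudorandomness -/

/-- A keyed function `{0,1}ⁿ × {0,1}* → {0,1}ⁿ`; the key comes first. -/
abbrev KeyedFun := ∀ n : ℕ, Fin (2 ^ n) → ℕ → Fin (2 ^ n)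

/-- The procedures available to a program, for given public parameters and challenge oracle. -/
noncomputable def env (T : TPF) (F : KeyedFun) (n : ℕ) (pp : T.Param n) (chal : ℕ → ℕ) : Env
  | .param, _, _ => T.descr n pp
  | .hash, x, _ => T.enc n (T.hash n pp x)
  | .gmul, x, y => T.encMul n x y
  | .gpow, x, e => T.encPow n x e
  | .prf, k, x => if h : k < 2 ^ n then (F n ⟨k, h⟩ x).val else 0
  | .chal, x, _ => chal x

/-- The experiment in which a program queries `f k` for a uniform key `k`. -/
noncomputable def prfReal (T : TPF) (F : KeyedFun) (n : ℕ) {K R : Type} [Finite K] [Nonempty K]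
    (encR : R → ℕ) (f : T.Param n → K → ℕ → R) (A : Program) : PMF Bool := do
  let pp ← T.setup n
  let k ← unif K
  A.out (env T F n pp fun x => encR (f pp k x)) []

/-- The experiment in which a program queries a uniformly random function.  As a program of cost
`c` can only form queries below `2 ^ c`, the random function is sampled on these. -/
noncomputable def prfIdeal (T : TPF) (F : KeyedFun) (n : ℕ) {R : Type} [Finite R] [Nonempty R]
    (encR : R → ℕ) (A : Program) : PMF Bool := do
  let pp ← T.setup n
  let g ← unif (Fin (2 ^ A.cost) → R)
  A.out (env T F n pp fun x => if h : x < 2 ^ A.cost then encR (g ⟨x, h⟩) else 0) []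

/-- `TPF.Rnd` is a secure pseudorandom function. -/
def TPFSecure (T : TPF) (F : KeyedFun) : Prop :=
  ∀ A : Adversary, Negligible fun n =>
    |prob (prfReal T F n (T.enc n) (fun pp (k : T.Key n) => T.rnd pp k) (A.prog n)) -
      prob (prfIdeal T F n (T.enc n) (A.prog n))|

/-- `F` is a secure pseudorandom function. -/
def FSecure (T : TPF) (F : KeyedFun) : Prop :=
  ∀ A : Adversary, Negligible fun n =>
    |prob (prfReal T F n Fin.val (fun _ k => F n k) (A.prog n)) -
      prob (prfIdeal T F n (Fin.val : Fin (2 ^ n) → ℕ) (A.prog n))|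

/-! ## Tailored universal re-encryption from Paillier -/

/-- The two cloud servers. -/
inductive Server
  | cs1 | cs2
  deriving DecidableEq

instance : Fintype Server := ⟨{.cs1, .cs2}, fun s => by cases s <;> simp⟩

namespace Server

def other : Server → Server
  | cs1 => cs2
  | cs2 => cs1

def num : Server → ℕ
  | cs1 => 1
  | cs2 => 2

end Server

/-- Prime pairs admissible for Paillier. -/
def PaillierPrimes (p q : ℕ) : Prop :=
  p.Prime ∧ q.Prime ∧ p ≠ q ∧ Nat.Coprime (p * q) ((p - 1) * (q - 1))

open Classical in
/-- Pairs of admissible primes of exactly `n` bits. -/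
noncomputable def primePairs (n : ℕ) : Finset (ℕ × ℕ) :=
  (Finset.range (2 ^ n) ×ˢ Finset.range (2 ^ n)).filter fun x =>
    x.1.size = n ∧ x.2.size = n ∧ PaillierPrimes x.1 x.2

open Classical in
/-- Key generation: a uniform pair of admissible `n`-bit primes (the master secret key); the
public key is the product.  The default is only used for the few small `n` without such a pair. -/
noncomputable def turSetup (n : ℕ) : PMF (ℕ × ℕ) :=
  if h : (primePairs n).Nonempty then PMF.uniformOfFinset (primePairs n) h else PMF.pure (5, 7)

/-- Paillier encryption of `m` under the public key `N` with randomizer `r`. -/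
def turEnc (N m : ℕ) (r : (ZMod N)ˣ) : ℕ := (1 + N) ^ m * r.val.val ^ N % N ^ 2

/-- Re-encryption: multiplication by an encryption of `0`. -/
def turReEnc (N C : ℕ) (r : (ZMod N)ˣ) : ℕ := C * turEnc N 0 r % N ^ 2

/-- A two-step decryption procedure for Paillier: a randomized derivation of two partial
decryption keys of polynomial length from the master secret key, partial decryption, and final
decryption with the complementary key. -/
structure KeySplit where
  keyGen : ∀ _n _p _q : ℕ, PMF (Server → ℕ)
  pDec : ∀ _N _C _pdk : ℕ, ℕ
  dec : ∀ _N _C _pdk : ℕ, ℕ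
  len : ℕ → ℕ
  len_poly : PolyBounded len
  pdk_size : ∀ n, ∀ x ∈ (turSetup n).support, ∀ d ∈ (keyGen n x.1 x.2).support,
    ∀ s, (d s).size ≤ len n
  correct : ∀ n, ∀ x ∈ (turSetup n).support, ∀ d ∈ (keyGen n x.1 x.2).support,
    ∀ s : Server, ∀ m < x.1 * x.2, ∀ r : (ZMod (x.1 * x.2))ˣ,
      dec (x.1 * x.2) (pDec (x.1 * x.2) (turEnc (x.1 * x.2) m r) (d s)) (d s.other) = m

/-- The linking experiment against the server `c`, who holds the public key and its own partial
decryption key: given encryptions of `m₀` and `m₁` and a re-encryption of one of them, guess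
which one. The outcome is whether the guess is right. -/
noncomputable def linkExp (T : TPF) (F : KeyedFun) (S : KeySplit) (n : ℕ) (c : Server)
    (m₀ m₁ : ℕ) (A : Program) : PMF Bool := do
  let pp ← T.setup n
  let pq ← turSetup n
  let pdk ← S.keyGen n pq.1 pq.2
  let N := pq.1 * pq.2
  let r₀ ← unif (ZMod N)ˣ
  let r₁ ← unif (ZMod N)ˣ
  let r ← unif (ZMod N)ˣ
  let b ← unif Bool
  let C₀ := turEnc N m₀ r₀
  let C₁ := turEnc N m₁ r₁
  let C := turReEnc N (if b then C₁ else C₀) r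
  let b' ← A.out (env T F n pp fun _ => 0) [N, pdk c, C₀, C₁, C]
  return b' == b

/-- Re-encrypted ciphertexts are computationally unlinkable to their original form. -/
def TURUnlinkable (T : TPF) (F : KeyedFun) (S : KeySplit) : Prop :=
  ∀ (c : Server) (m₀ m₁ : ℕ → ℕ), PolyBounded (fun n => (m₀ n).size) →
    PolyBounded (fun n => (m₁ n).size) → ∀ A : Adversary,
      ∃ ε : ℕ → ℝ, Negligible ε ∧
        ∀ n, prob (linkExp T F S n c (m₀ n) (m₁ n) (A.prog n)) ≤ 1 / 2 + ε n

/-! ## Indexes and the shuffle -/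

/-- The two inverted indexes. -/
inductive Kind
  | pref | keyword
  deriving DecidableEq

instance : Fintype Kind := ⟨{.pref, .keyword}, fun k => by cases k <;> simp⟩

/-- The plaintext prefix and keyword indexes, with the bitmaps split into one share per server.
All prefixes and keywords are written as distinct strings. -/
structure PlainIndex where
  objects : ℕ
  size : Kind → ℕ
  word : ∀ k, Fin (size k) → ℕ
  word_injective : Function.Injective fun x : (Σ k, Fin (size k)) => word x.1 x.2
  bitmap : Server → ∀ k, Fin (size k) → Fin objects → Bool

/-- A family of indexes of polynomial size. -/
structure IndexFamily where
  index : ℕ → PlainIndex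
  objects_poly : PolyBounded fun n => (index n).objects
  size_poly : ∀ k, PolyBounded fun n => (index n).size k
  wordLen : ℕ → ℕ
  wordLen_poly : PolyBounded wordLen
  word_size : ∀ n k i, ((index n).word k i).size ≤ wordLen n

/-- An encrypted index entry: label, encrypted bitmap share, tag. -/
structure Entry (T : TPF) (n : ℕ) where
  label : T.G n
  id : ℕ
  tag : Fin (2 ^ n)

def Entry.toList {T : TPF} {n : ℕ} (e : Entry T n) : List ℕ := [T.enc n e.label, e.id, e.tag.val]

/-- The secret shuffle parameter of a server: an exponent for the labels and a key for the
tags. -/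
abbrev ShuffleParam (T : TPF) (n : ℕ) : Type := T.Key n × Fin (2 ^ n)

/-- A server with shuffle parameter `r` refreshes one entry, with randomizer `ρ`. -/
def refresh {T : TPF} (F : KeyedFun) {n : ℕ} (N : ℕ) (r : ShuffleParam T n) (e : Entry T n)
    (ρ : (ZMod N)ˣ) : Entry T n where
  label := T.reEnc e.label r.1
  id := turReEnc N e.id ρ
  tag := F n r.2 e.tag.val

/-- The entry of the freshly built index for the word `x` at server `s`. -/
def buildEntry {T : TPF} (F : KeyedFun) {n : ℕ} (pp : T.Param n) (N : ℕ) (kM : T.Key n)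
    (kT : Fin (2 ^ n)) (s : Server) (x m : ℕ) (ρ : (ZMod N)ˣ) : Entry T n where
  label := T.rnd pp kM x
  id := turEnc N m ρ
  tag := F n kT (Nat.pair s.num x)

/-- The randomness of one entry up to the round under consideration: the encryption, and the
randomizers of both servers in each of the `u` previous shuffle rounds. -/
abbrev History (N u : ℕ) : Type := (ZMod N)ˣ × (Fin u → Server → (ZMod N)ˣ)

/-- The entry stored at `o` after the previous rounds: in each of them, the other server
refreshes it first and `o` second. -/
def currentEntry {T : TPF} (F : KeyedFun) {n : ℕ} (pp : T.Param n) (N : ℕ) (kM : T.Key n)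
    (kT : Fin (2 ^ n)) (r : Server → ShuffleParam T n) (o : Server) (x m : ℕ) {u : ℕ}
    (h : History N u) : Entry T n :=
  (List.ofFn h.2).foldl
    (fun e ρ => refresh F N (r o) (refresh F N (r o.other) e (ρ o.other)) (ρ o))
    (buildEntry F pp N kM kT o x m h.1)

/-- The coins of a server for processing a list: one randomizer per entry and a permutation. -/
abbrev Coins (N l : ℕ) : Type := (Fin l → (ZMod N)ˣ) × Equiv.Perm (Fin l)

/-- A server refreshes all entries of a list and permutes them; position `j` of the result comes
from position `π j`. -/
def pass {T : TPF} (F : KeyedFun) {n : ℕ} (N : ℕ) (r : ShuffleParam T n) {l : ℕ}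
    (w : Coins N l) (L : Fin l → Entry T n) : Fin l → Entry T n :=
  fun j => refresh F N r (L (w.2 j)) (w.1 (w.2 j))

def listEntries {T : TPF} {n l : ℕ} (L : Fin l → Entry T n) : List ℕ :=
  (List.ofFn fun j => (L j).toList).flatten

def listCoins {N l : ℕ} (w : Coins N l) : List ℕ :=
  List.ofFn (fun j => (w.1 j).val.val) ++ List.ofFn fun j => (w.2 j).val

/-- The shuffle experiment against the server `c` on an index that went through `u` shuffle
rounds before.  In the challenge round both servers shuffle the two indexes of both shares.  The
server `c` is given all its keys and coins, and for each share and index the entries before the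
round, the intermediate list, and the final list; the entries before the round are listed in the
order of the plaintext index.
The challenge is about the share stored at `o` and the index `k`: a random one of the entries at
`i₀`, `i₁` is chosen and its final form is shown.  The outcome is whether the program guesses
right. -/
noncomputable def shuffleExp (T : TPF) (F : KeyedFun) (S : KeySplit) (n : ℕ) (I : PlainIndex)
    (u : ℕ) (c o : Server) (k : Kind) (i₀ i₁ : Fin (I.size k)) (A : Program) : PMF Bool := do
  let pp ← T.setup n
  let kM ← T.keyGen n
  let kU ← T.keyGen n
  let pq ← turSetup n
  let pdk ← S.keyGen n pq.1 pq.2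
  let N := pq.1 * pq.2
  let r ← unif (Server → ShuffleParam T n)
  let kT ← unif (Fin (2 ^ n))
  let hist ← unif (Server → ∀ k, Fin (I.size k) → History N u)
  -- `coins s t k`: the coins of server `t` on index `k` of the share of server `s`
  let coins ← unif (Server → Server → ∀ k, Coins N (I.size k))
  let b ← unif Bool
  let pre : Server → ∀ k, Fin (I.size k) → Entry T n := fun s k i =>
    currentEntry F pp N kM kT r s (I.word k i) (Nat.ofBits (I.bitmap s k i)) (hist s k i)
  let mid : Server → ∀ k, Fin (I.size k) → Entry T n := fun s k =>
    pass F N (r s.other) (coins s s.other k) (pre s k)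
  let post : Server → ∀ k, Fin (I.size k) → Entry T n := fun s k =>
    pass F N (r s) (coins s s k) (mid s k)
  let part : Server → Kind → List ℕ := fun s k =>
    listEntries (pre s k) ++ listEntries (mid s k) ++ listEntries (post s k) ++
      listCoins (coins s c k)
  -- the final position of the challenge entry
  let j := (coins o o k).2.symm ((coins o o.other k).2.symm (if b then i₁ else i₀))
  let view : List ℕ :=
    [N, pdk c, (r c).1.val.val, (r c).2.val, (T.recKeyGen kU kM).val.val] ++
      part .cs1 .pref ++ part .cs1 .keyword ++ part .cs2 .pref ++ part .cs2 .keyword ++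
      (pre o k i₀).toList ++ (pre o k i₁).toList ++ (post o k j).toList ++ [j.val]
  let b' ← A.out (env T F n pp fun _ => 0) view
  return b' == b

/-- Shuffle indistinguishability: for either server, every index family, every number of previous
rounds and every pair of entries, no adversary recognizes the origin of the challenge entry
noticeably better than by guessing. -/
def ShuffleIndistinguishable (T : TPF) (F : KeyedFun) (S : KeySplit) : Prop :=
  ∀ (I : IndexFamily) (u : ℕ → ℕ), PolyBounded u →
    ∀ (c o : Server) (k : Kind) (i₀ i₁ : ∀ n, Fin ((I.index n).size k)) (A : Adversary),
      ∃ ε : ℕ → ℝ, Negligible ε ∧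
        ∀ n, prob (shuffleExp T F S n (I.index n) (u n) c o k (i₀ n) (i₁ n) (A.prog n)) ≤
          1 / 2 + ε n

end Brasp

namespace Brasp

/-! ## Negligible and polynomially bounded functions -/

/-! The view of the corrupted server is a fixed function of its own keys, coins and permutations,
the permutations of the honest server, and two families of entries listed in the order of the
plaintext index: the entries before the round, and the entries immediately after the refresh by the
honest server. All other list entries arise from these by refreshes that the corrupted server can
perform itself. Exchanging the refreshed forms of the two challenge entries has the same effect on
the view as composing the permutations of the honest server with a transposition (conjugated, in the
share where the corrupted server shuffles first) and flipping the challenge bit. The honest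
permutations are uniform, so if the distribution of the refreshed entries is invariant under this
exchange, the bit is guessed with probability exactly 1/2 (`viewOf_permHon`, `prob_game_ideal`).

It remains to reach such a distribution by hybrids with negligible loss. First the experiment is
rewritten in independent variables (`shuffleGame_eq_game`). Translations in the key group make the
authorization key and the label keys before and after the honest refresh independent and uniform,
and each honest randomizer contributes a fresh factor to a ciphertext.

Labels: two applications of pseudorandomness of `TPF.rnd` replace both label families by uniform
ones. Tags: pseudorandomness of `F` makes the initial tags uniform and turns the tag function of the
honest server into a random function. Its successive values are independent and uniform unless an
argument repeats, and a repetition forces either a coincidence with a fresh uniform value or a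
collision of `F` under a random key at random points, which pseudorandomness makes rare
(`negligible_collision`, `chainDist_apply`). Ciphertexts: a re-encryption is a fresh encryption, so
unlinkability allows the plaintext of the first refreshed challenge entry to be replaced by that of
the second, once for each share (`negligible_kcDist_sub_kcDist`).

Since adversaries are non-uniform, each reduction fixes all randomness foreign to its experiment at
a best value, hardwires it, computes the view by explicit expressions from oracle answers or the
linking challenge, and runs the given adversary on the result. -/

theorem Negligible.add {f g : ℕ → ℝ} (hf : Negligible f) (hg : Negligible g) :
    Negligible fun n => f n + g n :=
  Asymptotics.SuperpolynomialDecay.add hf hg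

theorem Negligible.mono {f g : ℕ → ℝ} (hg : Negligible g) (h0 : ∀ n, 0 ≤ f n)
    (h : ∀ n, f n ≤ g n) : Negligible f :=
  Asymptotics.SuperpolynomialDecay.trans_abs_le hg fun n => by
    simpa [abs_of_nonneg (h0 n)] using (h n).trans (le_abs_self _)

theorem Negligible.abs {f : ℕ → ℝ} (hf : Negligible f) : Negligible fun n => |f n| :=
  Asymptotics.SuperpolynomialDecay.trans_abs_le hf fun n => by simp

theorem Negligible.const_mul {f : ℕ → ℝ} (hf : Negligible f) (c : ℝ) :
    Negligible fun n => c * f n :=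
  Asymptotics.SuperpolynomialDecay.const_mul hf c

theorem Negligible.poly_mul {f : ℕ → ℝ} {p : ℕ → ℕ} (hf : Negligible f) (hp : PolyBounded p) :
    Negligible fun n => (p n : ℝ) * f n := by
  obtain ⟨P, hP⟩ := hp
  have h := Asymptotics.SuperpolynomialDecay.polynomial_mul (hf.abs)
    (P.map (Nat.castRingHom ℝ))
  refine Asymptotics.SuperpolynomialDecay.trans_abs_le h fun n => ?_
  have e : (P.map (Nat.castRingHom ℝ)).eval (n : ℝ) = ((P.eval n : ℕ) : ℝ) := by
    rw [Polynomial.eval_natCast_map]; rfl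
  simp only [abs_mul, Nat.abs_cast, abs_abs, e]
  gcongr
  exact hP n

theorem negligible_two_pow_inv : Negligible fun n => ((2 : ℝ) ^ n)⁻¹ := by
  intro k
  simpa [div_eq_mul_inv] using
    tendsto_pow_const_div_const_pow_of_one_lt k (one_lt_two : (1 : ℝ) < 2)

theorem PolyBounded.mono {f g : ℕ → ℕ} (hg : PolyBounded g) (h : ∀ n, f n ≤ g n) :
    PolyBounded f := by
  obtain ⟨P, hP⟩ := hg
  exact ⟨P, fun n => (h n).trans (hP n)⟩

theorem polyBounded_const (c : ℕ) : PolyBounded fun _ => c :=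
  ⟨Polynomial.C c, fun n => by simp⟩

theorem polyBounded_id : PolyBounded fun n => n :=
  ⟨Polynomial.X, fun n => by simp⟩

theorem PolyBounded.add {f g : ℕ → ℕ} (hf : PolyBounded f) (hg : PolyBounded g) :
    PolyBounded fun n => f n + g n := by
  obtain ⟨P, hP⟩ := hf
  obtain ⟨Q, hQ⟩ := hg
  exact ⟨P + Q, fun n => by simpa using add_le_add (hP n) (hQ n)⟩

theorem PolyBounded.mul {f g : ℕ → ℕ} (hf : PolyBounded f) (hg : PolyBounded g) :
    PolyBounded fun n => f n * g n := by
  obtain ⟨P, hP⟩ := hf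
  obtain ⟨Q, hQ⟩ := hg
  exact ⟨P * Q, fun n => by simpa using Nat.mul_le_mul (hP n) (hQ n)⟩

/-! ## Probabilities -/

theorem prob_nonneg (d : PMF Bool) : 0 ≤ prob d := ENNReal.toReal_nonneg

theorem prob_le_one (d : PMF Bool) : prob d ≤ 1 :=
  ENNReal.toReal_le_of_le_ofReal zero_le_one (by simpa using d.coe_le_one true)

theorem summable_toReal {α : Type*} (p : PMF α) : Summable fun a => (p a).toReal :=
  ENNReal.summable_toReal p.tsum_coe_ne_top

theorem tsum_toReal {α : Type*} (p : PMF α) : ∑' a, (p a).toReal = 1 := by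
  rw [← ENNReal.tsum_toReal_eq fun a => p.apply_ne_top a, p.tsum_coe, ENNReal.toReal_one]

theorem summable_toReal_mul {α : Type*} (p : PMF α) (f : α → ℝ) (h0 : ∀ a, 0 ≤ f a)
    (h1 : ∀ a, f a ≤ 1) : Summable fun a => (p a).toReal * f a :=
  (summable_toReal p).of_nonneg_of_le (fun a => mul_nonneg ENNReal.toReal_nonneg (h0 a))
    fun a => mul_le_of_le_one_right ENNReal.toReal_nonneg (h1 a)

theorem prob_bind {α : Type*} (p : PMF α) (f : α → PMF Bool) :
    prob (p.bind f) = ∑' a, (p a).toReal * prob (f a) := by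
  unfold prob
  rw [PMF.bind_apply, ENNReal.tsum_toReal_eq]
  · simp [ENNReal.toReal_mul]
  · intro a
    exact ENNReal.mul_ne_top (p.apply_ne_top a) ((f a).apply_ne_top true)

theorem summable_prob_bind {α : Type*} (p : PMF α) (f : α → PMF Bool) :
    Summable fun a => (p a).toReal * prob (f a) :=
  summable_toReal_mul p _ (fun _ => prob_nonneg _) fun _ => prob_le_one _

theorem prob_bind_le {α : Type*} (p : PMF α) (f : α → PMF Bool) {ε : ℝ}
    (h : ∀ a, prob (f a) ≤ ε) : prob (p.bind f) ≤ ε := by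
  rw [prob_bind, ← one_mul ε, ← tsum_toReal p, ← tsum_mul_right]
  exact (summable_prob_bind p f).tsum_le_tsum
    (fun a => mul_le_mul_of_nonneg_left (h a) ENNReal.toReal_nonneg)
    ((summable_toReal p).mul_right ε)

/-- Averaging: some outcome of `p` is at least as good as the average. -/
theorem exists_mem_support_abs_prob_sub_le {α : Type*} (p : PMF α) (f g : α → PMF Bool) :
    ∃ a ∈ p.support,
      |prob (p.bind f) - prob (p.bind g)| ≤ |prob (f a) - prob (g a)| := by
  by_contra! H
  set D := |prob (p.bind f) - prob (p.bind g)| with hD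
  have hs : Summable fun a => (p a).toReal * |prob (f a) - prob (g a)| :=
    summable_toReal_mul p _ (fun a => abs_nonneg _) fun a => abs_sub_le_iff.2
      ⟨by linarith [prob_le_one (f a), prob_nonneg (g a)],
        by linarith [prob_le_one (g a), prob_nonneg (f a)]⟩
  have h1 : D ≤ ∑' a, (p a).toReal * |prob (f a) - prob (g a)| := by
    rw [hD, prob_bind, prob_bind, ← (summable_prob_bind p f).tsum_sub (summable_prob_bind p g)]
    have hs' : Summable fun a =>
        |(p a).toReal * prob (f a) - (p a).toReal * prob (g a)| := by
      refine hs.congr fun a => ?_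
      rw [← mul_sub, abs_mul, abs_of_nonneg (ENNReal.toReal_nonneg)]
    have h := norm_tsum_le_tsum_norm (f := fun a =>
      (p a).toReal * prob (f a) - (p a).toReal * prob (g a)) hs'
    refine h.trans_eq (tsum_congr fun a => ?_)
    rw [Real.norm_eq_abs, ← mul_sub, abs_mul, abs_of_nonneg (ENNReal.toReal_nonneg)]
  -- Outside the support the weights vanish, so the negated claim gives a termwise bound by `D`. It
  -- is strict at any one support point, which makes the weighted sum smaller than `D`.
  obtain ⟨a₀, ha₀⟩ := p.support_nonempty
  have hle : ∀ a, (p a).toReal * |prob (f a) - prob (g a)| ≤ (p a).toReal * D := by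
    intro a
    by_cases ha : a ∈ p.support
    · exact mul_le_mul_of_nonneg_left (H a ha).le ENNReal.toReal_nonneg
    · simp [(PMF.apply_eq_zero_iff p a).2 ha]
  have h2 : ∑' a, (p a).toReal * |prob (f a) - prob (g a)| < ∑' a, (p a).toReal * D := by
    refine Summable.tsum_lt_tsum (i := a₀) hle ?_ hs ((summable_toReal p).mul_right D)
    have : 0 < (p a₀).toReal := ENNReal.toReal_pos
      ((PMF.mem_support_iff p a₀).1 ha₀) (p.apply_ne_top a₀)
    exact mul_lt_mul_of_pos_left (H a₀ ha₀) this
  rw [tsum_mul_right, tsum_toReal, one_mul] at h2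
  linarith

theorem prob_add_false (d : PMF Bool) : prob d + (d false).toReal = 1 := by
  have := tsum_toReal d
  rw [tsum_fintype] at this
  simpa [prob] using this

theorem prob_map_not (d : PMF Bool) : prob (d.map not) = 1 - prob d := by
  have h := prob_add_false d
  have : prob (d.map not) = (d false).toReal := by
    unfold prob
    rw [PMF.map_apply, tsum_fintype]
    simp
  linarith

theorem abs_prob_sub_map_beq (d d' : PMF Bool) (b : Bool) :
    |prob (d.map (· == b)) - prob (d'.map (· == b))| = |prob d - prob d'| := by
  cases b
  · have : (fun x : Bool => x == false) = not := by funext x; cases x <;> rfl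
    rw [this, prob_map_not, prob_map_not, abs_sub_comm (prob d)]
    congr 1; ring
  · have : (fun x : Bool => x == true) = id := by funext x; cases x <;> rfl
    rw [this, PMF.map_id, PMF.map_id]

/-- Distributions that agree outside an event are as close as the event is unlikely. -/
theorem abs_prob_bind_sub_le_of_eq_off {α : Type*} (p q : PMF α) (B : α → Bool)
    (h : ∀ a, B a = false → p a = q a) (f : α → PMF Bool) :
    |prob (p.bind f) - prob (q.bind f)| ≤ prob (q.map B) := by
  have key : ∀ p q : PMF α, (∀ a, B a = false → p a = q a) →
      prob (p.bind f) - prob (q.bind f) ≤ prob (p.map B) := by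
    intro p q h
    rw [sub_le_iff_le_add', ← PMF.bind_pure_comp, prob_bind, prob_bind, prob_bind,
      ← (summable_prob_bind q f).tsum_add (summable_prob_bind p _)]
    refine (summable_prob_bind p f).tsum_le_tsum (fun a => ?_)
      ((summable_prob_bind q f).add (summable_prob_bind p _))
    cases hB : B a with
    | false =>
      rw [h a hB]
      linarith [mul_nonneg (ENNReal.toReal_nonneg (a := q a))
        (prob_nonneg ((PMF.pure ∘ B) a))]
    | true =>
      have e : prob ((PMF.pure ∘ B) a) = 1 := by simp [prob, hB]
      rw [e]
      have h1 : (p a).toReal * prob (f a) ≤ (p a).toReal * 1 :=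
        mul_le_mul_of_nonneg_left (prob_le_one _) ENNReal.toReal_nonneg
      linarith [mul_nonneg (ENNReal.toReal_nonneg (a := q a)) (prob_nonneg (f a))]
  -- The distributions agree on the complement of the event, so they also give the event itself the
  -- same mass.
  have hpq : prob (p.map B) = prob (q.map B) := by
    have : (p.map B) false = (q.map B) false := by
      rw [PMF.map_apply, PMF.map_apply]
      refine tsum_congr fun a => ?_
      cases hB : B a
      · simp [h a hB]
      · simp
    linarith [prob_add_false (p.map B), prob_add_false (q.map B),
      congrArg ENNReal.toReal this]
  rw [abs_sub_le_iff]
  exact ⟨hpq ▸ key p q h, key q p fun a ha => (h a ha).symm⟩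

/-! ## Uniform distributions -/

theorem unif_apply {α : Type} [Finite α] [Nonempty α] (a : α) :
    unif α a = (Nat.card α : ENNReal)⁻¹ := by
  let := Fintype.ofFinite α
  rw [unif, PMF.uniformOfFintype_apply, Nat.card_eq_fintype_card]

theorem unif_apply_toReal {α : Type} [Finite α] [Nonempty α] (a : α) :
    (unif α a).toReal = (Nat.card α : ℝ)⁻¹ := by
  rw [unif_apply, ENNReal.toReal_inv, ENNReal.toReal_natCast]

theorem eq_unif_of_const {α : Type} [Finite α] [Nonempty α] (p : PMF α)
    (h : ∀ a b, p a = p b) : p = unif α := by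
  let := Fintype.ofFinite α
  ext a
  have hs := p.tsum_coe
  rw [tsum_fintype, Finset.sum_congr rfl fun b _ => h b a, Finset.sum_const, nsmul_eq_mul,
    Finset.card_univ] at hs
  rw [unif_apply, Nat.card_eq_fintype_card]
  exact ENNReal.eq_inv_of_mul_eq_one_left (by rw [mul_comm]; exact hs)

/-- Permutations of the source carry every fibre of `f` onto every other, so all fibres have the
same size. This is the common source of the changes of variables below: bijections, surjective
homomorphisms, and restriction of random functions. -/
theorem unif_map_of_transitive {α β : Type} [Finite α] [Nonempty α] [Finite β] [Nonempty β]
    (f : α → β) (h : ∀ b b', ∃ E : Equiv.Perm α, ∀ a, f (E a) = b' ↔ f a = b) :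
    (unif α).map f = unif β := by
  classical
  refine eq_unif_of_const _ fun b b' => ?_
  obtain ⟨E, hE⟩ := h b b'
  rw [PMF.map_apply, PMF.map_apply,
    ← E.tsum_eq (fun a => if b' = f a then unif α a else 0)]
  refine tsum_congr fun a => ?_
  simp only [unif_apply, eq_comm (a := b), eq_comm (a := b'), hE]

theorem unif_map_equiv {α β : Type} [Finite α] [Nonempty α] [Finite β] [Nonempty β]
    (e : α ≃ β) : (unif α).map e = unif β := by
  classical
  refine unif_map_of_transitive _ fun b b' =>
    ⟨Equiv.swap (e.symm b) (e.symm b'), fun a => ?_⟩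
  rw [← Equiv.eq_symm_apply, ← Equiv.eq_symm_apply, Equiv.symm_swap,
    Equiv.swap_apply_right, ← Equiv.eq_symm_apply]

theorem unif_bind_equiv {α β : Type} {γ : Type*} [Finite α] [Nonempty α] [Finite β] [Nonempty β]
    (e : α ≃ β) (f : β → PMF γ) : ((unif α).bind fun a => f (e a)) = (unif β).bind f := by
  rw [← unif_map_equiv e, PMF.bind_map]; rfl

theorem unif_bind_of_map {α β : Type} {γ : Type*} [Finite α] [Nonempty α] [Finite β]
    [Nonempty β] {g : α → β} (h : (unif α).map g = unif β) (f : β → PMF γ) :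
    ((unif α).bind fun a => f (g a)) = (unif β).bind f := by
  rw [← h, PMF.bind_map]; rfl

/-- Left translation by a preimage of `b' * b⁻¹` carries the fibre over `b` onto the fibre over
`b'`. -/
theorem unif_map_hom {G H : Type} [Group G] [Group H] [Finite G] [Finite H] (f : G →* H)
    (hf : Function.Surjective f) : (unif G).map f = unif H := by
  refine unif_map_of_transitive _ fun b b' => ?_
  obtain ⟨g, hg⟩ := hf (b' * b⁻¹)
  refine ⟨Equiv.mulLeft g, fun a => ?_⟩
  rw [Equiv.coe_mulLeft, map_mul, hg, mul_assoc]
  constructor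
  · intro h
    have := mul_eq_left.1 h
    exact (inv_mul_eq_one.1 this).symm
  · rintro rfl; simp

/-- The values of a random function at distinct points are independent and uniform. -/
theorem unif_map_comp {Q D R : Type} [Finite Q] [Finite D] [Finite R] [Nonempty R]
    (i : Q → D) (hi : Function.Injective i) :
    (unif (D → R)).map (fun g q => g (i q)) = unif (Q → R) := by
  classical
  refine unif_map_of_transitive _ fun b b' => ?_
  -- Swapping `b q` with `b' q` in the coordinate `i q` moves one fibre to the other. Injectivity of
  -- `i` makes this choice of coordinatewise permutations well defined.
  let τ : D → Equiv.Perm R := Function.extend i (fun q => Equiv.swap (b q) (b' q)) 1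
  refine ⟨Equiv.piCongrRight τ, fun a => ?_⟩
  rw [funext_iff, funext_iff]
  refine forall_congr' fun q => ?_
  change τ (i q) (a (i q)) = b' q ↔ _
  simp only [τ]
  rw [hi.extend_apply, ← Equiv.eq_symm_apply, Equiv.symm_swap,
    Equiv.swap_apply_right]

theorem unif_prod (α β : Type) [Finite α] [Nonempty α] [Finite β] [Nonempty β] :
    unif (α × β) = (unif α).bind fun a => (unif β).map (Prod.mk a) := by
  symm
  refine eq_unif_of_const _ ?_
  have : ∀ x : α × β, ((unif α).bind fun a => (unif β).map (Prod.mk a)) x =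
      (Nat.card α : ENNReal)⁻¹ * (Nat.card β : ENNReal)⁻¹ := by
    rintro ⟨a, b⟩
    rw [PMF.bind_apply, tsum_eq_single a, PMF.map_apply, tsum_eq_single b]
    · simp [unif_apply]
    · intro b' hb'; simp [hb'.symm]
    · intro a' ha'
      rw [PMF.map_apply]
      simp [ha'.symm]
  intro x y
  rw [this, this]

theorem unif_prod_bind {α β : Type} {γ : Type*} [Finite α] [Nonempty α] [Finite β] [Nonempty β]
    (f : α × β → PMF γ) :
    (unif (α × β)).bind f = (unif α).bind fun a => (unif β).bind fun b => f (a, b) := by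
  rw [unif_prod, PMF.bind_bind]
  congr 1
  funext a
  rw [PMF.bind_map]; rfl

theorem prob_unif_bool_bind (f : Bool → PMF Bool) :
    prob ((unif Bool).bind f) = (prob (f true) + prob (f false)) / 2 := by
  rw [prob_bind, tsum_fintype]
  simp [unif_apply_toReal]
  ring

/-! ## Programs that evaluate expressions and then run another program -/

/-- Expressions that a program evaluates; `reg i` refers to an input register. -/
inductive Expr
  | const (c : ℕ)
  | reg (i : ℕ)
  | arith (op : Arith) (a b : Expr)
  | powMod (a b m : Expr)
  | call (p : Proc) (a b : Expr)

namespace Expr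

/-- The value of an expression computed with instructions of width `W`. -/
def eval (W : ℕ) (E : Env) (regs : List ℕ) : Expr → ℕ
  | const c => c
  | reg i => Brasp.reg regs i % 2 ^ W
  | arith op a b => op.eval (a.eval W E regs) (b.eval W E regs) % 2 ^ W
  | powMod a b m => a.eval W E regs ^ b.eval W E regs % m.eval W E regs % 2 ^ W
  | call p a b => E p (a.eval W E regs) (b.eval W E regs) % 2 ^ W

/-- The number of instructions of the compiled expression. -/
def len : Expr → ℕ
  | const _ => 1
  | reg _ => 1
  | arith _ a b => a.len + b.len + 1
  | powMod a b m => a.len + b.len + m.len + 1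
  | call _ a b => a.len + b.len + 1

def cost (W : ℕ) : Expr → ℕ
  | const c => 1 + c.size
  | reg _ => 1 + W
  | arith _ a b => a.cost W + b.cost W + (1 + W)
  | powMod a b m => a.cost W + b.cost W + m.cost W + (1 + W)
  | call _ a b => a.cost W + b.cost W + (1 + W)

/-- All registers of the expression are among the first `B`. -/
def Fits (B : ℕ) : Expr → Prop
  | const _ => True
  | reg i => i < B
  | arith _ a b => a.Fits B ∧ b.Fits B
  | powMod a b m => a.Fits B ∧ b.Fits B ∧ m.Fits B
  | call _ a b => a.Fits B ∧ b.Fits B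

/-- The compiled expression, when `t` registers are already in use; the value is put into the
last register. -/
def compile (W : ℕ) : Expr → ℕ → Program
  | const c, _ => [.const c]
  | reg i, t => [.arith .add W i t]
  | arith op a b, t => a.compile W t ++ b.compile W (t + a.len) ++
      [.arith op W (t + a.len - 1) (t + a.len + b.len - 1)]
  | powMod a b m, t => a.compile W t ++ b.compile W (t + a.len) ++
      m.compile W (t + a.len + b.len) ++
      [.powMod W (t + a.len - 1) (t + a.len + b.len - 1) (t + a.len + b.len + m.len - 1)]
  | call p a b, t => a.compile W t ++ b.compile W (t + a.len) ++
      [.call p W (t + a.len - 1) (t + a.len + b.len - 1)]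

theorem len_pos (e : Expr) : 0 < e.len := by cases e <;> simp [len]

end Expr

theorem Program.run_append (E : Env) (A B : Program) (regs : List ℕ) :
    Program.run E (A ++ B) regs = (Program.run E A regs).bind (Program.run E B) := by
  induction A generalizing regs with
  | nil => simp [Program.run]
  | cons i A ih => simp [Program.run, ih, PMF.bind_bind]

theorem Program.cost_append (A B : Program) :
    Program.cost (A ++ B) = Program.cost A + Program.cost B := by
  simp [Program.cost]

theorem reg_append_left {l l' : List ℕ} {i : ℕ} (h : i < l.length) :
    reg (l ++ l') i = reg l i := by
  simp [reg, List.getElem?_append_left h]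

theorem reg_append_right (l l' : List ℕ) (i : ℕ) : reg (l ++ l') (l.length + i) = reg l' i := by
  simp [reg, List.getElem?_append_right]

theorem reg_of_length_le {l : List ℕ} {i : ℕ} (h : l.length ≤ i) : reg l i = 0 := by
  simp [reg, h]

theorem reg_append_cons {l l' : List ℕ} {v i : ℕ} (h : i = l.length) :
    reg (l ++ v :: l') i = v := by
  subst h
  simp [reg]

/-- Instructions address registers absolutely, so the induction carries a fixed input block `base`,
an arbitrary scratch block `s`, and their total length `t`. Compiled code only appends registers,
which is why the value of the first operand is still in place when the last instruction reads it. -/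
theorem Expr.run_compile (W : ℕ) (E : Env) (base : List ℕ) (e : Expr)
    (he : e.Fits base.length) (s : List ℕ) (t : ℕ) (ht : t = (base ++ s).length) :
    ∃ s' : List ℕ, s'.length + 1 = e.len ∧
      Program.run E (e.compile W t) (base ++ s) =
        PMF.pure (base ++ s ++ s' ++ [e.eval W E base]) := by
  induction e generalizing s t with
  | const c =>
    exact ⟨[], rfl, by simp [Expr.compile, Program.run, Instr.eval, Expr.eval]⟩
  | reg i =>
    refine ⟨[], rfl, ?_⟩
    simp only [Expr.compile, Program.run, Instr.eval, Expr.eval, PMF.pure_bind, Arith.eval]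
    -- Register `t` is not yet written and reads as `0`, so adding it to register `i` is a copy.
    rw [reg_append_left (by exact he), reg_of_length_le (l := base ++ s) (by omega)]
    simp
  | arith op a b iha ihb =>
    obtain ⟨sa, hsa, ha⟩ := iha he.1 s t ht
    obtain ⟨sb, hsb, hb⟩ := ihb he.2 (s ++ sa ++ [a.eval W E base]) (t + a.len) (by
      simp at ht ⊢; omega)
    refine ⟨sa ++ [a.eval W E base] ++ sb ++ [b.eval W E base], by simp [Expr.len]; omega, ?_⟩
    simp only [Expr.compile, Program.run_append, ha, PMF.pure_bind]
    simp only [← List.append_assoc] at hb ⊢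
    rw [hb, PMF.pure_bind]
    simp only [Program.run, Instr.eval, PMF.pure_bind, Expr.eval]
    rw [List.length_append] at ht
    have ra := reg_append_cons (l := base ++ s ++ sa) (l' := sb ++ [b.eval W E base])
      (v := a.eval W E base) (i := t + a.len - 1) (by simp; omega)
    have rb := reg_append_cons (l := base ++ s ++ sa ++ [a.eval W E base] ++ sb) (l' := [])
      (v := b.eval W E base) (i := t + a.len + b.len - 1) (by simp; omega)
    simp only [List.append_assoc, List.cons_append, List.nil_append] at ra rb ⊢
    rw [ra, rb]
  | powMod a b m iha ihb ihm =>
    obtain ⟨sa, hsa, ha⟩ := iha he.1 s t ht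
    obtain ⟨sb, hsb, hb⟩ := ihb he.2.1 (s ++ sa ++ [a.eval W E base]) (t + a.len) (by
      simp at ht ⊢; omega)
    obtain ⟨sm, hsm, hm⟩ := ihm he.2.2
      (s ++ sa ++ [a.eval W E base] ++ sb ++ [b.eval W E base]) (t + a.len + b.len) (by
      simp at ht ⊢; omega)
    refine ⟨sa ++ [a.eval W E base] ++ sb ++ [b.eval W E base] ++ sm ++ [m.eval W E base],
      by simp [Expr.len]; omega, ?_⟩
    simp only [Expr.compile, Program.run_append, ha, PMF.pure_bind]
    simp only [← List.append_assoc] at hb hm ⊢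
    rw [hb, PMF.pure_bind, hm, PMF.pure_bind]
    simp only [Program.run, Instr.eval, PMF.pure_bind, Expr.eval]
    rw [List.length_append] at ht
    have ra := reg_append_cons (l := base ++ s ++ sa)
      (l' := sb ++ [b.eval W E base] ++ sm ++ [m.eval W E base])
      (v := a.eval W E base) (i := t + a.len - 1) (by simp; omega)
    have rb := reg_append_cons (l := base ++ s ++ sa ++ [a.eval W E base] ++ sb)
      (l' := sm ++ [m.eval W E base])
      (v := b.eval W E base) (i := t + a.len + b.len - 1) (by simp; omega)
    have rm := reg_append_cons
      (l := base ++ s ++ sa ++ [a.eval W E base] ++ sb ++ [b.eval W E base] ++ sm) (l' := [])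
      (v := m.eval W E base) (i := t + a.len + b.len + m.len - 1) (by simp; omega)
    simp only [List.append_assoc, List.cons_append, List.nil_append] at ra rb rm ⊢
    rw [ra, rb, rm]
  | call p a b iha ihb =>
    obtain ⟨sa, hsa, ha⟩ := iha he.1 s t ht
    obtain ⟨sb, hsb, hb⟩ := ihb he.2 (s ++ sa ++ [a.eval W E base]) (t + a.len) (by
      simp at ht ⊢; omega)
    refine ⟨sa ++ [a.eval W E base] ++ sb ++ [b.eval W E base], by simp [Expr.len]; omega, ?_⟩
    simp only [Expr.compile, Program.run_append, ha, PMF.pure_bind]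
    simp only [← List.append_assoc] at hb ⊢
    rw [hb, PMF.pure_bind]
    simp only [Program.run, Instr.eval, PMF.pure_bind, Expr.eval]
    rw [List.length_append] at ht
    have ra := reg_append_cons (l := base ++ s ++ sa) (l' := sb ++ [b.eval W E base])
      (v := a.eval W E base) (i := t + a.len - 1) (by simp; omega)
    have rb := reg_append_cons (l := base ++ s ++ sa ++ [a.eval W E base] ++ sb) (l' := [])
      (v := b.eval W E base) (i := t + a.len + b.len - 1) (by simp; omega)
    simp only [List.append_assoc, List.cons_append, List.nil_append] at ra rb ⊢
    rw [ra, rb]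

theorem Expr.cost_compile (W : ℕ) (e : Expr) (t : ℕ) :
    (e.compile W t).cost = e.cost W := by
  induction e generalizing t with
  | const c => simp [compile, cost, Program.cost, Instr.cost]
  | reg i => simp [compile, cost, Program.cost, Instr.cost]
  | arith op a b iha ihb =>
    simp only [compile, cost, Program.cost_append, iha, ihb]
    simp [Program.cost, Instr.cost]
  | powMod a b m iha ihb ihm =>
    simp only [compile, cost, Program.cost_append, iha, ihb, ihm]
    simp [Program.cost, Instr.cost]
  | call p a b iha ihb =>
    simp only [compile, cost, Program.cost_append, iha, ihb]
    simp [Program.cost, Instr.cost]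

/-- Evaluate a list of expressions. -/
def compileList (W : ℕ) : List Expr → ℕ → Program
  | [], _ => []
  | e :: es, t => e.compile W t ++ compileList W es (t + e.len)

/-- The registers that contain the values of a list of expressions. -/
def places : List Expr → ℕ → List ℕ
  | [], _ => []
  | e :: es, t => (t + e.len - 1) :: places es (t + e.len)

/-- The number of registers used by a list of expressions. -/
def lenList : List Expr → ℕ
  | [] => 0
  | e :: es => e.len + lenList es

theorem lt_of_mem_places {es : List Expr} {t p : ℕ} (h : p ∈ places es t) :
    p < t + lenList es := by
  induction es generalizing t with
  | nil => simp [places] at h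
  | cons e es ih =>
    have := e.len_pos
    simp only [places, List.mem_cons, lenList] at h ⊢
    rcases h with rfl | h
    · omega
    · have := ih h; omega

theorem run_compileList (W : ℕ) (E : Env) (base : List ℕ) (es : List Expr)
    (hes : ∀ e ∈ es, e.Fits base.length) (s : List ℕ) (t : ℕ) (ht : t = (base ++ s).length) :
    ∃ s' : List ℕ, s'.length = lenList es ∧
      Program.run E (compileList W es t) (base ++ s) = PMF.pure (base ++ s ++ s') ∧
      (places es t).map (reg (base ++ s ++ s')) = es.map (Expr.eval W E base) := by
  induction es generalizing s t with
  | nil => exact ⟨[], rfl, by simp [compileList, Program.run], rfl⟩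
  | cons e es ih =>
    obtain ⟨s₁, hs₁, h₁⟩ := e.run_compile W E base (hes e (by simp)) s t ht
    obtain ⟨s₂, hs₂, h₂, h₃⟩ := ih (fun e he => hes e (by simp [he]))
      (s ++ s₁ ++ [e.eval W E base]) (t + e.len) (by simp at ht ⊢; omega)
    refine ⟨s₁ ++ [e.eval W E base] ++ s₂, by simp [lenList]; omega, ?_, ?_⟩
    · simp only [← List.append_assoc] at h₂ ⊢
      rw [compileList, Program.run_append, h₁, PMF.pure_bind, h₂]
    · simp only [← List.append_assoc] at h₃ ⊢
      rw [places, List.map_cons, List.map_cons, h₃, List.append_assoc _ [_] s₂,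
        List.singleton_append, reg_append_cons (by simp at ht ⊢; omega)]

/-- Copy registers to the end. -/
def copies (W : ℕ) : List ℕ → ℕ → Program
  | [], _ => []
  | p :: ps, t => .arith .add W p t :: copies W ps (t + 1)

/-- The values of compiled expressions lie scattered among scratch registers, whereas a program
expects its input as a contiguous block. As before, adding the unwritten register `t` acts as a
copy. -/
theorem run_copies (W : ℕ) (E : Env) (ps : List ℕ) (regs s : List ℕ)
    (hps : ∀ p ∈ ps, p < regs.length) (t : ℕ) (ht : t = (regs ++ s).length) :
    Program.run E (copies W ps t) (regs ++ s) =
      PMF.pure (regs ++ s ++ ps.map fun p => reg regs p % 2 ^ W) := by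
  induction ps generalizing s t with
  | nil => simp [copies, Program.run]
  | cons p ps ih =>
    simp only [copies, Program.run, Instr.eval, PMF.pure_bind, Arith.eval]
    rw [reg_append_left (hps p (by simp)), reg_of_length_le (l := regs ++ s) (by omega),
      add_zero, List.append_assoc, ih _ (fun p hp => hps p (by simp [hp])) _ (by
        simp at ht ⊢; omega)]
    simp

/-- Move the registers of an instruction by `d`, and replace calls of the challenge oracle by the
constant `0`. -/
def Instr.shift (d : ℕ) : Instr → Instr
  | .const c => .const c
  | .arith op w i j => .arith op w (d + i) (d + j)
  | .powMod w i j k => .powMod w (d + i) (d + j) (d + k)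
  | .sample w i => .sample w (d + i)
  | .sampleUnit w i => .sampleUnit w (d + i)
  | .call .chal _ _ _ => .const 0
  | .call p w i j => .call p w (d + i) (d + j)

/-- The environment without challenge oracle. -/
def silence (E : Env) : Env
  | .chal, _, _ => 0
  | p, x, y => E p x y

theorem silence_env (T : TPF) (F : KeyedFun) (n : ℕ) (pp : T.Param n) (chal : ℕ → ℕ) :
    silence (env T F n pp chal) = env T F n pp fun _ => 0 := by
  funext p x y
  cases p <;> rfl

theorem Instr.eval_shift (E : Env) (s regs : List ℕ) (i : Instr) :
    (i.shift s.length).eval E (s ++ regs) = i.eval (silence E) regs := by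
  cases i with
  | const c => rfl
  | arith op w i j => simp only [Instr.shift, Instr.eval, reg_append_right]
  | powMod w i j k => simp only [Instr.shift, Instr.eval, reg_append_right]
  | sample w i =>
    have h : ∀ x y : ℕ, x = y → (unif (Fin (x - 1 + 1))).map (fun z => z.val % 2 ^ w) =
        (unif (Fin (y - 1 + 1))).map fun z => z.val % 2 ^ w := by
      rintro x _ rfl; rfl
    exact h _ _ (reg_append_right s regs i)
  | sampleUnit w i =>
    have h : ∀ x y : ℕ, x = y → (unif (ZMod x)ˣ).map (fun z => z.val.val % 2 ^ w) =
        (unif (ZMod y)ˣ).map fun z => z.val.val % 2 ^ w := by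
      rintro x _ rfl; rfl
    exact h _ _ (reg_append_right s regs i)
  | call p w i j =>
    cases p <;> simp only [Instr.shift, Instr.eval, reg_append_right, silence, Nat.zero_mod]

theorem Instr.cost_shift_le (d : ℕ) (i : Instr) : (i.shift d).cost ≤ i.cost := by
  cases i with
  | call p w i j => cases p <;> simp [Instr.shift, Instr.cost]
  | _ => simp [Instr.shift, Instr.cost]

theorem run_map_shift (E : Env) (A : Program) (s regs : List ℕ) :
    Program.run E (A.map (Instr.shift s.length)) (s ++ regs) =
      (Program.run (silence E) A regs).map (s ++ ·) := by
  induction A generalizing regs with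
  | nil => simp [Program.run, PMF.pure_map]
  | cons i A ih =>
    simp only [List.map_cons, Program.run, Instr.eval_shift, PMF.map_bind]
    congr 1
    funext v
    rw [List.append_assoc, ih]

/-- The output bit is read from the last register. For a program run behind a scratch block this is
its own last register only if its register list is nonempty. -/
theorem ne_nil_of_mem_support_run (E : Env) (A : Program) (regs : List ℕ) (h : regs ≠ [])
    (l : List ℕ) (hl : l ∈ (Program.run E A regs).support) : l ≠ [] := by
  induction A generalizing regs with
  | nil => simp [Program.run] at hl; exact hl ▸ h
  | cons i A ih =>
    simp only [Program.run, PMF.mem_support_bind_iff] at hl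
    obtain ⟨v, -, hv⟩ := hl
    exact ih _ (by simp) hv

theorem PMF_map_congr {α β : Type*} (p : PMF α) {f g : α → β}
    (h : ∀ a ∈ p.support, f a = g a) : p.map f = p.map g := by
  ext b
  rw [PMF.map_apply, PMF.map_apply]
  refine tsum_congr fun a => ?_
  by_cases ha : a ∈ p.support
  · rw [h a ha]
  · simp [(PMF.apply_eq_zero_iff p a).2 ha]

/-- The program that evaluates expressions in the first `t` registers and runs `A` on the
values. -/
def simProg (W t : ℕ) (es : List Expr) (A : Program) : Program :=
  compileList W es t ++ copies W (places es t) (t + lenList es) ++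
    A.map (Instr.shift (t + lenList es))

/-- After the copies the embedded program sees its usual input, displaced by a fixed offset, and
cannot reach the scratch block. Its own oracle calls become the constant `0`, hence `silence`: in
the shuffle and linking experiments the challenge procedure answers `0`. -/
theorem out_simProg (W : ℕ) (E : Env) (base : List ℕ) (es : List Expr) (A : Program)
    (hes : ∀ e ∈ es, e.Fits base.length) (hne : es ≠ []) :
    (simProg W base.length es A).out E base =
      A.out (silence E) (es.map fun e => e.eval W E base % 2 ^ W) := by
  obtain ⟨s, hs, h₁, h₂⟩ := run_compileList W E base es hes [] base.length (by simp)
  simp only [List.append_nil] at h₁ h₂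
  have hlen : base.length + lenList es = (base ++ s).length := by simp [hs]
  have h₃ := run_copies W E (places es base.length) (base ++ s) []
    (fun p hp => hlen ▸ lt_of_mem_places hp) (base.length + lenList es) (by simpa using hs.symm)
  simp only [List.append_nil] at h₃
  have h₄ : (places es base.length).map (fun p => reg (base ++ s) p % 2 ^ W) =
      es.map fun e => e.eval W E base % 2 ^ W := by
    have := congrArg (List.map (· % 2 ^ W)) h₂
    simpa [List.map_map, Function.comp_def] using this
  rw [Program.out, Program.out, simProg, Program.run_append, Program.run_append, h₁,
    PMF.pure_bind, h₃, PMF.pure_bind, h₄, hlen, run_map_shift, PMF.map_comp]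
  refine PMF_map_congr _ fun l hl => ?_
  have := ne_nil_of_mem_support_run _ _ _ (by simpa using hne) l hl
  simp [List.getLast?_append_of_ne_nil _ this, this]

theorem cost_compileList (W : ℕ) (es : List Expr) (t : ℕ) :
    (compileList W es t).cost = (es.map (Expr.cost W)).sum := by
  induction es generalizing t with
  | nil => rfl
  | cons e es ih => simp [compileList, Program.cost_append, ih, Expr.cost_compile]

theorem cost_copies (W : ℕ) (ps : List ℕ) (t : ℕ) :
    (copies W ps t).cost = ps.length * (1 + W) := by
  induction ps generalizing t with
  | nil => simp [copies, Program.cost]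
  | cons p ps ih =>
    have := ih (t + 1)
    simp only [Program.cost] at this
    simp [copies, Program.cost, this, Instr.cost]
    ring

theorem length_places (es : List Expr) (t : ℕ) : (places es t).length = es.length := by
  induction es generalizing t with
  | nil => rfl
  | cons e es ih => simp [places, ih]

theorem cost_map_shift_le (A : Program) (d : ℕ) :
    Program.cost (A.map (Instr.shift d)) ≤ A.cost := by
  induction A with
  | nil => simp [Program.cost]
  | cons i A ih =>
    simp only [Program.cost, List.map_cons, List.sum_cons] at ih ⊢
    exact add_le_add (Instr.cost_shift_le d i) ih

theorem cost_simProg_le (W t : ℕ) (es : List Expr) (A : Program) (B : ℕ)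
    (h : ∀ e ∈ es, e.cost W ≤ B) :
    (simProg W t es A).cost ≤ es.length * (B + (1 + W)) + A.cost := by
  rw [simProg, Program.cost_append, Program.cost_append, cost_compileList, cost_copies,
    length_places]
  have h1 := cost_map_shift_le A (t + lenList es)
  have h2 : (es.map (Expr.cost W)).sum ≤ es.length * B := by
    simpa using List.sum_le_card_nsmul (es.map (Expr.cost W)) B (by simpa using h)
  nlinarith

/-- Needed because `prfIdeal` samples the random function only on arguments below `2 ^ cost`. A
program with instructions of width `W` thus has all arguments below `2 ^ W` inside that domain. -/
theorem le_cost_simProg (W t : ℕ) (es : List Expr) (A : Program) (hne : es ≠ []) :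
    W ≤ (simProg W t es A).cost := by
  rw [simProg, Program.cost_append, Program.cost_append, cost_copies, length_places]
  have := List.length_pos_of_ne_nil hne
  nlinarith

/-! ## The shape of the view of the corrupted server -/

/-- An index entry with components in `X`. -/
structure Triple (X : Type) where
  lab : X
  id : X
  tag : X

namespace Triple

def toList {X : Type} (t : Triple X) : List X := [t.lab, t.id, t.tag]

/-- Componentwise relation. -/
structure Rel {X Y : Type} (R : X → Y → Prop) (t : Triple X) (t' : Triple Y) : Prop where
  lab : R t.lab t'.lab
  id : R t.id t'.id
  tag : R t.tag t'.tag

end Triple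

/-- The words of both indexes. -/
abbrev Word (sz : Kind → ℕ) : Type := Σ k, Fin (sz k)

abbrev Perms (sz : Kind → ℕ) : Type := Server → ∀ k, Equiv.Perm (Fin (sz k))

/-- The data from which the view is computed: the keys of the corrupted server, the entries
before the round, the entries after the refresh by the honest server (both in the order of the
plaintext index), and the randomizers of the corrupted server. -/
structure Leaves (X : Type) (sz : Kind → ℕ) where
  N : X
  pdk : X
  rho : X
  kap : X
  auth : X
  pre : Server → Word sz → Triple X
  hon : Server → Word sz → Triple X
  coin : Server → Word sz → X

structure Leaves.Rel {X Y : Type} {sz : Kind → ℕ} (R : X → Y → Prop) (V : Leaves X sz)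
    (V' : Leaves Y sz) : Prop where
  N : R V.N V'.N
  pdk : R V.pdk V'.pdk
  rho : R V.rho V'.rho
  kap : R V.kap V'.kap
  auth : R V.auth V'.auth
  pre : ∀ s w, (V.pre s w).Rel R (V'.pre s w)
  hon : ∀ s w, (V.hon s w).Rel R (V'.hon s w)
  coin : ∀ s w, R (V.coin s w) (V'.coin s w)

/-- The share, the index and the two entries the challenge is about. -/
structure Target (sz : Kind → ℕ) where
  o : Server
  k : Kind
  i₀ : Fin (sz k)
  i₁ : Fin (sz k)

section View

variable {X : Type} {sz : Kind → ℕ} (c : Server) (cref : Triple X → X → Triple X) (lit : ℕ → X)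
  (V : Leaves X sz) (πc πd : Perms sz)

/-- The intermediate list of the share of `s`; `cref` is the refresh by the corrupted server. -/
def midList (s : Server) (k : Kind) (j : Fin (sz k)) : Triple X :=
  if s = c then V.hon s ⟨k, πd s k j⟩
  else cref (V.pre s ⟨k, πc s k j⟩) (V.coin s ⟨k, πc s k j⟩)

/-- The final list of the share of `s`. -/
def postList (s : Server) (k : Kind) (j : Fin (sz k)) : Triple X :=
  if s = c then cref (V.hon s ⟨k, πd s k (πc s k j)⟩) (V.coin s ⟨k, πc s k j⟩)
  else V.hon s ⟨k, πc s k (πd s k j)⟩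

def flatTriples {l : ℕ} (L : Fin l → Triple X) : List X :=
  (List.ofFn fun j => (L j).toList).flatten

def viewPart (s : Server) (k : Kind) : List X :=
  flatTriples (fun i => V.pre s ⟨k, i⟩) ++ flatTriples (midList c cref V πc πd s k) ++
    flatTriples (postList c cref V πc πd s k) ++
    (List.ofFn (fun j => V.coin s ⟨k, j⟩) ++ List.ofFn fun j => lit (πc s k j).val)

/-- The final position of the challenge entry. -/
def Target.pos (tg : Target sz) (b : Bool) : Fin (sz tg.k) :=
  if tg.o = c then
    (πc tg.o tg.k).symm ((πd tg.o tg.k).symm (if b then tg.i₁ else tg.i₀))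
  else (πd tg.o tg.k).symm ((πc tg.o tg.k).symm (if b then tg.i₁ else tg.i₀))

def viewOf (tg : Target sz) (b : Bool) : List X :=
  [V.N, V.pdk, V.rho, V.kap, V.auth] ++
    viewPart c cref lit V πc πd .cs1 .pref ++ viewPart c cref lit V πc πd .cs1 .keyword ++
    viewPart c cref lit V πc πd .cs2 .pref ++ viewPart c cref lit V πc πd .cs2 .keyword ++
    (V.pre tg.o ⟨tg.k, tg.i₀⟩).toList ++ (V.pre tg.o ⟨tg.k, tg.i₁⟩).toList ++
    (postList c cref V πc πd tg.o tg.k (tg.pos c πc πd b)).toList ++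
    [lit (tg.pos c πc πd b).val]

theorem length_flatTriples {l : ℕ} (L : Fin l → Triple X) : (flatTriples L).length = 3 * l := by
  simp [flatTriples, Triple.toList, Function.comp_def, mul_comm]

/-- The constant 15 counts five keys, three entries of three components, and one position. Each word
contributes to each share three entries, one randomizer and one value of a permutation, that is 11
numbers, and there are two shares. -/
theorem length_viewOf (tg : Target sz) (b : Bool) :
    (viewOf c cref lit V πc πd tg b).length = 15 + 22 * (sz .pref + sz .keyword) := by
  simp [viewOf, viewPart, length_flatTriples, Triple.toList]
  ring

theorem viewOf_ne_nil (tg : Target sz) (b : Bool) : viewOf c cref lit V πc πd tg b ≠ [] := by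
  simp [viewOf]

end View

/-! ### Parametricity of the view in its leaves -/

theorem Triple.Rel.toList {X Y : Type} {R : X → Y → Prop} {t : Triple X} {t' : Triple Y}
    (h : t.Rel R t') : List.Forall₂ R t.toList t'.toList :=
  .cons h.lab (.cons h.id (.cons h.tag .nil))

theorem Triple.Rel.mono {X Y : Type} {R R' : X → Y → Prop} {t : Triple X} {t' : Triple Y}
    (h : t.Rel R t') (hR : ∀ x y, R x y → R' x y) : t.Rel R' t' :=
  ⟨hR _ _ h.lab, hR _ _ h.id, hR _ _ h.tag⟩

theorem forall₂_ofFn {X Y : Type} {R : X → Y → Prop} {l : ℕ} {f : Fin l → X} {g : Fin l → Y}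
    (h : ∀ i, R (f i) (g i)) : List.Forall₂ R (List.ofFn f) (List.ofFn g) := by
  induction l with
  | zero => simp
  | succ l ih =>
    rw [List.ofFn_succ, List.ofFn_succ]
    exact .cons (h 0) (ih fun i => h i.succ)

theorem forall₂_append {X Y : Type} {R : X → Y → Prop} {l₁ l₂ : List X} {l₁' l₂' : List Y}
    (h₁ : List.Forall₂ R l₁ l₁') (h₂ : List.Forall₂ R l₂ l₂') :
    List.Forall₂ R (l₁ ++ l₂) (l₁' ++ l₂') :=
  List.rel_append h₁ h₂

theorem exists_of_mem_forall₂ {X Y : Type} {R : X → Y → Prop} {l : List X} {l' : List Y}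
    (h : List.Forall₂ R l l') {x : X} (hx : x ∈ l) : ∃ y, R x y := by
  induction h with
  | nil => simp at hx
  | cons h _ ih =>
    rcases List.mem_cons.1 hx with rfl | hx
    · exact ⟨_, h⟩
    · exact ih hx

theorem forall₂_flatTriples {X Y : Type} {R : X → Y → Prop} {l : ℕ} {L : Fin l → Triple X}
    {L' : Fin l → Triple Y} (h : ∀ i, (L i).Rel R (L' i)) :
    List.Forall₂ R (flatTriples L) (flatTriples L') :=
  List.rel_flatten (forall₂_ofFn fun i => (h i).toList)

section ViewRel

variable {X Y : Type} {sz : Kind → ℕ} (c : Server) {R R' : X → Y → Prop}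
  {cref : Triple X → X → Triple X} {cref' : Triple Y → Y → Triple Y} {lit : ℕ → X}
  {lit' : ℕ → Y} {V : Leaves X sz} {V' : Leaves Y sz} (πc πd : Perms sz)

theorem midList_rel (hV : V.Rel R V') (hR : ∀ x y, R x y → R' x y)
    (hpre : ∀ s w w', (cref (V.pre s w) (V.coin s w')).Rel R' (cref' (V'.pre s w) (V'.coin s w')))
    (s : Server) (k : Kind) (j : Fin (sz k)) :
    (midList c cref V πc πd s k j).Rel R' (midList c cref' V' πc πd s k j) := by
  unfold midList
  split_ifs
  · exact (hV.hon _ _).mono hR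
  · exact hpre _ _ _

theorem postList_rel (hV : V.Rel R V') (hR : ∀ x y, R x y → R' x y)
    (hhon : ∀ s w w', (cref (V.hon s w) (V.coin s w')).Rel R' (cref' (V'.hon s w) (V'.coin s w')))
    (s : Server) (k : Kind) (j : Fin (sz k)) :
    (postList c cref V πc πd s k j).Rel R' (postList c cref' V' πc πd s k j) := by
  unfold postList
  split_ifs
  · exact hhon _ _ _
  · exact (hV.hon _ _).mono hR

/-- The view depends parametrically on its leaves. -/
theorem viewOf_rel (hV : V.Rel R V') (hR : ∀ x y, R x y → R' x y)
    (hpre : ∀ s w w', (cref (V.pre s w) (V.coin s w')).Rel R' (cref' (V'.pre s w) (V'.coin s w')))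
    (hhon : ∀ s w w', (cref (V.hon s w) (V.coin s w')).Rel R' (cref' (V'.hon s w) (V'.coin s w')))
    (hlit : ∀ k, ∀ i : Fin (sz k), R' (lit i.val) (lit' i.val)) (tg : Target sz) (b : Bool) :
    List.Forall₂ R' (viewOf c cref lit V πc πd tg b) (viewOf c cref' lit' V' πc πd tg b) := by
  have hpart : ∀ s k, List.Forall₂ R' (viewPart c cref lit V πc πd s k)
      (viewPart c cref' lit' V' πc πd s k) := fun s k =>
    forall₂_append (forall₂_append (forall₂_append
      (forall₂_flatTriples fun i => (hV.pre _ _).mono hR)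
      (forall₂_flatTriples fun i => midList_rel c πc πd hV hR hpre s k i))
      (forall₂_flatTriples fun i => postList_rel c πc πd hV hR hhon s k i))
      (forall₂_append (forall₂_ofFn fun i => hR _ _ (hV.coin _ _))
        (forall₂_ofFn fun i => hlit k _))
  refine forall₂_append (forall₂_append (forall₂_append (forall₂_append (forall₂_append
    (forall₂_append (forall₂_append (forall₂_append ?_ (hpart _ _)) (hpart _ _)) (hpart _ _))
    (hpart _ _)) ?_) ?_) ?_) ?_
  · exact .cons (hR _ _ hV.N) (.cons (hR _ _ hV.pdk) (.cons (hR _ _ hV.rho)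
      (.cons (hR _ _ hV.kap) (.cons (hR _ _ hV.auth) .nil))))
  · exact ((hV.pre _ _).mono hR).toList
  · exact ((hV.pre _ _).mono hR).toList
  · exact (postList_rel c πc πd hV hR hhon _ _ _).toList
  · exact .cons (hlit _ _) .nil

end ViewRel

/-! ## Programs that compute the view -/

/-- `F` on encoded keys. -/
def prfNat (F : KeyedFun) (n k x : ℕ) : ℕ := if h : k < 2 ^ n then (F n ⟨k, h⟩ x).val else 0

/-- The refresh by the corrupted server, on encoded entries. -/
noncomputable def refreshNat (T : TPF) (F : KeyedFun) (n : ℕ) {sz : Kind → ℕ} (V : Leaves ℕ sz)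
    (t : Triple ℕ) (r : ℕ) : Triple ℕ where
  lab := T.encPow n t.lab V.rho
  id := t.id * (r ^ V.N % V.N ^ 2) % V.N ^ 2
  tag := prfNat F n V.kap t.tag

/-- The refresh by the corrupted server, as an expression. -/
def refreshExpr {sz : Kind → ℕ} (V : Leaves Expr sz) (t : Triple Expr) (r : Expr) :
    Triple Expr where
  lab := .call .gpow t.lab V.rho
  id := .arith .mod (.arith .mul t.id (.powMod r V.N (.arith .mul V.N V.N)))
    (.arith .mul V.N V.N)
  tag := .call .prf V.kap t.tag

/-- The expression `e` represents the number `v` at cost at most `B`. -/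
structure Rep (W : ℕ) (E : Env) (base : List ℕ) (B : ℕ) (e : Expr) (v : ℕ) : Prop where
  eval : e.eval W E base = v
  lt : v < 2 ^ W
  fits : e.Fits base.length
  cost : e.cost W ≤ B

namespace Rep

variable {W : ℕ} {E : Env} {base : List ℕ} {B B₁ B₂ B₃ : ℕ} {e e₁ e₂ e₃ : Expr}
  {v v₁ v₂ v₃ : ℕ}

theorem mono (h : Rep W E base B₁ e v) (hB : B₁ ≤ B) : Rep W E base B e v :=
  ⟨h.eval, h.lt, h.fits, h.cost.trans hB⟩

theorem const (hv : v < 2 ^ W) : Rep W E base (W + 1) (.const v) v :=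
  ⟨rfl, hv, trivial, by
    have := Nat.size_le.2 hv
    simp only [Expr.cost]; omega⟩

theorem reg {i : ℕ} (hi : i < base.length) (hv : Brasp.reg base i = v) (hlt : v < 2 ^ W) :
    Rep W E base (W + 1) (.reg i) v :=
  ⟨by rw [Expr.eval, hv, Nat.mod_eq_of_lt hlt], hlt, hi, by simp only [Expr.cost]; omega⟩

theorem arith (op : Arith) (h₁ : Rep W E base B₁ e₁ v₁) (h₂ : Rep W E base B₂ e₂ v₂)
    (hv : op.eval v₁ v₂ = v) (hlt : v < 2 ^ W) :
    Rep W E base (B₁ + B₂ + (W + 1)) (.arith op e₁ e₂) v :=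
  ⟨by rw [Expr.eval, h₁.eval, h₂.eval, hv, Nat.mod_eq_of_lt hlt], hlt, ⟨h₁.fits, h₂.fits⟩, by
    have := h₁.cost
    have := h₂.cost
    simp only [Expr.cost]; omega⟩

theorem powMod (h₁ : Rep W E base B₁ e₁ v₁) (h₂ : Rep W E base B₂ e₂ v₂)
    (h₃ : Rep W E base B₃ e₃ v₃) (hv : v₁ ^ v₂ % v₃ = v) (hlt : v < 2 ^ W) :
    Rep W E base (B₁ + B₂ + B₃ + (W + 1)) (.powMod e₁ e₂ e₃) v :=
  ⟨by rw [Expr.eval, h₁.eval, h₂.eval, h₃.eval, hv, Nat.mod_eq_of_lt hlt], hlt,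
    ⟨h₁.fits, h₂.fits, h₃.fits⟩, by
    have := h₁.cost
    have := h₂.cost
    have := h₃.cost
    simp only [Expr.cost]; omega⟩

theorem call (p : Proc) (h₁ : Rep W E base B₁ e₁ v₁) (h₂ : Rep W E base B₂ e₂ v₂)
    (hv : E p v₁ v₂ = v) (hlt : v < 2 ^ W) :
    Rep W E base (B₁ + B₂ + (W + 1)) (.call p e₁ e₂) v :=
  ⟨by rw [Expr.eval, h₁.eval, h₂.eval, hv, Nat.mod_eq_of_lt hlt], hlt, ⟨h₁.fits, h₂.fits⟩, by
    have := h₁.cost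
    have := h₂.cost
    simp only [Expr.cost]; omega⟩

end Rep

theorem TPF.enc_lt (T : TPF) {n W : ℕ} (hW : T.len n ≤ W) (g : T.G n) : T.enc n g < 2 ^ W :=
  Nat.size_le.1 ((T.enc_size n g).trans hW)

theorem TPF.encPow_enc (T : TPF) (n : ℕ) (g : T.G n) (e : ℕ) :
    T.encPow n (T.enc n g) e = T.enc n (g ^ e) := by
  have h : ∃ g', T.enc n g' = T.enc n g := ⟨g, rfl⟩
  rw [TPF.encPow, dif_pos h, T.enc_injective n h.choose_spec]

theorem TPF.encPow_lt (T : TPF) {n W : ℕ} (hW : T.len n ≤ W) (x e : ℕ) :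
    T.encPow n x e < 2 ^ W := by
  unfold TPF.encPow
  split_ifs
  · exact T.enc_lt hW _
  · exact Nat.two_pow_pos W

theorem prfNat_lt (F : KeyedFun) {n W : ℕ} (hW : n ≤ W) (k x : ℕ) : prfNat F n k x < 2 ^ W := by
  refine lt_of_lt_of_le ?_ (Nat.pow_le_pow_right two_pos hW)
  unfold prfNat
  split_ifs
  · exact Fin.is_lt _
  · exact Nat.two_pow_pos n

theorem prfNat_val (F : KeyedFun) (n : ℕ) (k : Fin (2 ^ n)) (x : ℕ) :
    prfNat F n k.val x = (F n k x).val := by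
  simp [prfNat]

/-- The bound on `N ^ 4` is needed since the product of two residues modulo `N ^ 2` must fit into a
register before it is reduced. The cost is dominated by the ciphertext component: 7 leaf
evaluations, counting `N` each time it is used, and 5 further instructions. -/
theorem refresh_rel (T : TPF) (F : KeyedFun) {n W B : ℕ} (pp : T.Param n) (chal : ℕ → ℕ)
    {base : List ℕ} {sz : Kind → ℕ} {V : Leaves Expr sz} {V' : Leaves ℕ sz}
    (hW : T.len n ≤ W) (hn : n ≤ W) (hN : V'.N ≠ 0) (hN4 : V'.N ^ 4 < 2 ^ W)
    (hV : V.Rel (Rep W (env T F n pp chal) base B) V') {t : Triple Expr} {t' : Triple ℕ}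
    (ht : t.Rel (Rep W (env T F n pp chal) base B) t') (hid : t'.id < V'.N ^ 2) {r : Expr}
    {r' : ℕ} (hr : Rep W (env T F n pp chal) base B r r') :
    (refreshExpr V t r).Rel (Rep W (env T F n pp chal) base (7 * B + 5 * (W + 1)))
      (refreshNat T F n V' t' r') := by
  have hN2 : 0 < V'.N ^ 2 := by positivity
  have hN24 : V'.N ^ 2 ≤ V'.N ^ 4 := Nat.pow_le_pow_right (Nat.pos_of_ne_zero hN) (by norm_num)
  have hsq : Rep W (env T F n pp chal) base (B + B + (W + 1)) (.arith .mul V.N V.N)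
      (V'.N ^ 2) := .arith .mul hV.N hV.N (by simp [Arith.eval, sq]) (hN24.trans_lt hN4)
  have hm : r' ^ V'.N % V'.N ^ 2 < V'.N ^ 2 := Nat.mod_lt _ hN2
  have hlt : ∀ x, x % V'.N ^ 2 < 2 ^ W := fun x => (Nat.mod_lt _ hN2).trans (hN24.trans_lt hN4)
  refine ⟨(Rep.call .gpow ht.lab hV.rho rfl (T.encPow_lt hW _ _)).mono (by omega),
    (Rep.arith .mod (.arith .mul ht.id (.powMod hr hV.N hsq rfl (hlt _)) rfl ?_) hsq rfl
      (hlt _)).mono (by omega),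
    (Rep.call .prf hV.kap ht.tag rfl (prfNat_lt F hn _ _)).mono (by omega)⟩
  refine lt_trans ?_ hN4
  calc t'.id * (r' ^ V'.N % V'.N ^ 2) < V'.N ^ 2 * V'.N ^ 2 := Nat.mul_lt_mul'' hid hm
    _ = V'.N ^ 4 := by ring

/-- The program that runs `A` on the view computed from the leaves. -/
def viewProg (W t : ℕ) (c : Server) {sz : Kind → ℕ} (V : Leaves Expr sz) (πc πd : Perms sz)
    (tg : Target sz) (b : Bool) (A : Program) : Program :=
  simProg W t (viewOf c (refreshExpr V) .const V πc πd tg b) A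

section ViewProg

variable (T : TPF) (F : KeyedFun) {n W B : ℕ} (pp : T.Param n) (chal : ℕ → ℕ)
  {base : List ℕ} {sz : Kind → ℕ} {V : Leaves Expr sz} {V' : Leaves ℕ sz}

/-- The numbers in the view are small enough for instructions of width `W`. -/
structure Small (T : TPF) (n W : ℕ) {sz : Kind → ℕ} (V' : Leaves ℕ sz) : Prop where
  len : T.len n ≤ W
  n_le : n ≤ W
  sz : ∀ k, sz k ≤ W
  N_ne : V'.N ≠ 0
  N4 : V'.N ^ 4 < 2 ^ W
  pre : ∀ s w, (V'.pre s w).id < V'.N ^ 2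
  hon : ∀ s w, (V'.hon s w).id < V'.N ^ 2

/-- An instance of `viewOf_rel` with representability as the relation: the view built from
expressions evaluates to the view built from numbers as soon as the leaves do, so no list has to be
inspected again. -/
theorem viewOf_rep (hV : V.Rel (Rep W (env T F n pp chal) base B) V') (hs : Small T n W V')
    (c : Server) (πc πd : Perms sz) (tg : Target sz) (b : Bool) :
    List.Forall₂ (Rep W (env T F n pp chal) base (7 * B + 5 * (W + 1)))
      (viewOf c (refreshExpr V) .const V πc πd tg b)
      (viewOf c (refreshNat T F n V') id V' πc πd tg b) :=
  viewOf_rel c πc πd hV (fun _ _ h => h.mono (by omega))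
    (fun s w w' => refresh_rel T F pp chal hs.len hs.n_le hs.N_ne hs.N4 hV (hV.pre s w)
      (hs.pre s w) (hV.coin s w'))
    (fun s w w' => refresh_rel T F pp chal hs.len hs.n_le hs.N_ne hs.N4 hV (hV.hon s w)
      (hs.hon s w) (hV.coin s w'))
    (fun k i => (Rep.const (lt_of_lt_of_le (i.is_lt.trans_le (hs.sz k))
      Nat.lt_two_pow_self.le)).mono (by omega)) tg b

theorem out_viewProg (hV : V.Rel (Rep W (env T F n pp chal) base B) V') (hs : Small T n W V')
    (c : Server) (πc πd : Perms sz) (tg : Target sz) (b : Bool) (A : Program) :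
    (viewProg W base.length c V πc πd tg b A).out (env T F n pp chal) base =
      A.out (env T F n pp fun _ => 0) (viewOf c (refreshNat T F n V') id V' πc πd tg b) := by
  have h := viewOf_rep T F pp chal hV hs c πc πd tg b
  rw [viewProg, out_simProg, silence_env]
  · congr 1
    have : ∀ (l : List Expr) (l' : List ℕ),
        List.Forall₂ (Rep W (env T F n pp chal) base (7 * B + 5 * (W + 1))) l l' →
        l.map (fun e => e.eval W (env T F n pp chal) base % 2 ^ W) = l' := by
      intro l l' h
      induction h with
      | nil => rfl
      | cons h _ ih => rw [List.map_cons, ih, h.eval, Nat.mod_eq_of_lt h.lt]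
    exact this _ _ h
  · intro e he
    obtain ⟨v, hv⟩ := exists_of_mem_forall₂ h he
    exact hv.fits
  · exact viewOf_ne_nil _ _ _ _ _ _ _ _

theorem cost_viewProg_le (hV : V.Rel (Rep W (env T F n pp chal) base B) V')
    (hs : Small T n W V') (t : ℕ) (c : Server) (πc πd : Perms sz) (tg : Target sz) (b : Bool)
    (A : Program) :
    (viewProg W t c V πc πd tg b A).cost ≤
      (15 + 22 * (sz .pref + sz .keyword)) * (7 * B + 6 * (W + 1)) + A.cost := by
  have h := viewOf_rep T F pp chal hV hs c πc πd tg b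
  refine (cost_simProg_le W t _ A (7 * B + 5 * (W + 1)) fun e he => ?_).trans_eq ?_
  · obtain ⟨v, hv⟩ := exists_of_mem_forall₂ h he
    exact hv.cost
  · rw [length_viewOf]; ring

theorem le_cost_viewProg (W t : ℕ) (c : Server) (V : Leaves Expr sz) (πc πd : Perms sz)
    (tg : Target sz) (b : Bool) (A : Program) : W ≤ (viewProg W t c V πc πd tg b A).cost :=
  le_cost_simProg _ _ _ _ (viewOf_ne_nil _ _ _ _ _ _ _ _)

end ViewProg

/-! ## The games -/

/-- The labels of all words before and after the refresh by the honest server. -/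
abbrev Lab (T : TPF) (n : ℕ) (sz : Kind → ℕ) : Type := (Word sz → T.G n) × (Word sz → T.G n)

/-- The tags of all entries before the round and after the refresh by the honest server. -/
abbrev Tag (n : ℕ) (sz : Kind → ℕ) : Type :=
  (Server → Word sz → Fin (2 ^ n)) × (Server → Word sz → Fin (2 ^ n))

/-- The ciphertexts of all entries before the round and after the refresh by the honest server,
and the randomizers of the corrupted server. -/
abbrev Ct (sz : Kind → ℕ) : Type :=
  (Server → Word sz → ℕ) × (Server → Word sz → ℕ) × (Server → Word sz → ℕ)

/-- The exponent of the corrupted server, the authorization key, and the permutations of the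
corrupted and of the honest server. -/
abbrev Misc (T : TPF) (n : ℕ) (sz : Kind → ℕ) : Type :=
  (T.Key n × T.Key n) × Perms sz × Perms sz

/-- A family of shuffle experiments, with a width `W` that suffices for the reductions. -/
structure Setting (T : TPF) where
  sz : ℕ → Kind → ℕ
  word : ∀ n, Word (sz n) → ℕ
  word_injective : ∀ n, Function.Injective (word n)
  c : Server
  tg : ∀ n, Target (sz n)
  A : Adversary
  u : ℕ → ℕ
  u_poly : PolyBounded u
  W : ℕ → ℕ
  W_poly : PolyBounded W
  len_le : ∀ n, T.len n ≤ W n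
  n_le : ∀ n, n ≤ W n
  sz_le : ∀ n k, sz n k ≤ W n
  word_lt : ∀ n w, word n w < 2 ^ W n
  pair_lt : ∀ n (s : Server) w, Nat.pair s.num (word n w) < 2 ^ W n

/-- The leaves of the view for given labels, tags, keys and ciphertexts. -/
def leavesOf (T : TPF) {n : ℕ} {sz : Kind → ℕ} (c : Server) (rho auth : T.Key n)
    (κ : Fin (2 ^ n)) (lab : Lab T n sz) (tag : Tag n sz) (kc : (ℕ × ℕ) × Ct sz) :
    Leaves ℕ sz where
  N := kc.1.1
  pdk := kc.1.2
  rho := rho.val.val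
  kap := κ.val
  auth := auth.val.val
  pre s w := ⟨T.enc n (lab.1 w), kc.2.1 s w, (tag.1 s w).val⟩
  -- In the share of `c` the honest server acts first, in the other share it acts after `c`.
  -- Exponents commute, so the honest label of the other share is that of the share of `c` raised to
  -- the exponent `rho`, which `c` knows. One label family therefore serves both shares.
  hon s w := ⟨T.enc n (if s = c then lab.2 w else T.reEnc (lab.2 w) rho), kc.2.2.1 s w,
    (tag.2 s w).val⟩
  coin := kc.2.2.2

/-- The same leaves as expressions. -/
def exprLeaves {sz : Kind → ℕ} (c : Server) (rho auth κ : ℕ) (l₁ l₂ : Word sz → Expr)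
    (t₁ t₂ : Server → Word sz → Expr) (N pdk : Expr) (i₁ i₂ r : Server → Word sz → Expr) :
    Leaves Expr sz where
  N := N
  pdk := pdk
  rho := .const rho
  kap := .const κ
  auth := .const auth
  pre s w := ⟨l₁ w, i₁ s w, t₁ s w⟩
  hon s w := ⟨if s = c then l₂ w else .call .gpow (l₂ w) (.const rho), i₂ s w, t₂ s w⟩
  coin := r

/-- An exponent is below the order of the group, and the injective encoding bounds that order by `2
^ W`. -/
theorem TPF.key_lt (T : TPF) {n W : ℕ} (hW : T.len n ≤ W) (k : T.Key n) : k.val.val < 2 ^ W := by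
  refine (ZMod.val_lt _).trans_le ?_
  have := Fintype.card_le_of_injective (fun g => (⟨T.enc n g, T.enc_lt hW g⟩ : Fin (2 ^ W)))
    fun a b h => T.enc_injective n (congrArg Fin.val h)
  simpa using this

/-- The surcharge of two instructions over `B` pays for the exponentiation of a label with `rho` in
the share where `c` acts first. -/
theorem exprLeaves_rel (T : TPF) (F : KeyedFun) {n W B : ℕ} (pp : T.Param n) (chal : ℕ → ℕ)
    {base : List ℕ} {sz : Kind → ℕ} (c : Server) (rho auth : T.Key n) (κ : Fin (2 ^ n))
    {l₁ l₂ : Word sz → Expr} {t₁ t₂ : Server → Word sz → Expr} {N pdk : Expr}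
    {i₁ i₂ r : Server → Word sz → Expr} {lab : Lab T n sz} {tag : Tag n sz}
    {kc : (ℕ × ℕ) × Ct sz} (hW : T.len n ≤ W) (hn : n ≤ W) (hB : W + 1 ≤ B)
    (hl₁ : ∀ w, Rep W (env T F n pp chal) base B (l₁ w) (T.enc n (lab.1 w)))
    (hl₂ : ∀ w, Rep W (env T F n pp chal) base B (l₂ w) (T.enc n (lab.2 w)))
    (ht₁ : ∀ s w, Rep W (env T F n pp chal) base B (t₁ s w) (tag.1 s w).val)
    (ht₂ : ∀ s w, Rep W (env T F n pp chal) base B (t₂ s w) (tag.2 s w).val)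
    (hN : Rep W (env T F n pp chal) base B N kc.1.1)
    (hpdk : Rep W (env T F n pp chal) base B pdk kc.1.2)
    (hi₁ : ∀ s w, Rep W (env T F n pp chal) base B (i₁ s w) (kc.2.1 s w))
    (hi₂ : ∀ s w, Rep W (env T F n pp chal) base B (i₂ s w) (kc.2.2.1 s w))
    (hr : ∀ s w, Rep W (env T F n pp chal) base B (r s w) (kc.2.2.2 s w)) :
    (exprLeaves c rho.val.val auth.val.val κ.val l₁ l₂ t₁ t₂ N pdk i₁ i₂ r).Rel
      (Rep W (env T F n pp chal) base (B + 2 * (W + 1)))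
      (leavesOf T c rho auth κ lab tag kc) := by
  have hm : B ≤ B + 2 * (W + 1) := Nat.le_add_right _ _
  have hm' : W + 1 ≤ B + 2 * (W + 1) := hB.trans hm
  refine ⟨hN.mono hm, hpdk.mono hm, (Rep.const (T.key_lt hW rho)).mono hm',
    (Rep.const (κ.is_lt.trans_le (Nat.pow_le_pow_right two_pos hn))).mono hm',
    (Rep.const (T.key_lt hW auth)).mono hm',
    fun s w => ⟨(hl₁ w).mono hm, (hi₁ s w).mono hm, (ht₁ s w).mono hm⟩,
    fun s w => ⟨?_, (hi₂ s w).mono hm, (ht₂ s w).mono hm⟩, fun s w => (hr s w).mono hm⟩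
  simp only [exprLeaves, leavesOf]
  split_ifs
  · exact (hl₂ w).mono hm
  · exact (Rep.call .gpow (hl₂ w) (Rep.const (T.key_lt hW rho))
      (T.encPow_enc n _ _) (T.enc_lt hW _)).mono (by omega)

/-- Keys and ciphertexts are in their ranges. -/
structure InRange (W : ℕ) {sz : Kind → ℕ} (kc : (ℕ × ℕ) × Ct sz) : Prop where
  N_ne : kc.1.1 ≠ 0
  N4 : kc.1.1 ^ 4 < 2 ^ W
  pdk : kc.1.2 < 2 ^ W
  pre : ∀ s w, kc.2.1 s w < kc.1.1 ^ 2
  hon : ∀ s w, kc.2.2.1 s w < kc.1.1 ^ 2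
  coin : ∀ s w, kc.2.2.2 s w < 2 ^ W

namespace InRange

variable {W : ℕ} {sz : Kind → ℕ} {kc : (ℕ × ℕ) × Ct sz}

theorem N_lt (h : InRange W kc) : kc.1.1 < 2 ^ W :=
  (Nat.le_self_pow (by norm_num) _).trans_lt h.N4

theorem sq_lt (h : InRange W kc) : kc.1.1 ^ 2 < 2 ^ W :=
  (Nat.pow_le_pow_right (Nat.pos_of_ne_zero h.N_ne) (by norm_num)).trans_lt h.N4

end InRange

/-! ### Games with exchangeable components, and fixing the randomness outside a reduction -/

namespace Setting

variable {T : TPF} (F : KeyedFun) (X : Setting T) (n : ℕ)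

/-- The output of the adversary on the view. -/
noncomputable def play (b : Bool) (m : Misc T n (X.sz n)) (κ : Fin (2 ^ n))
    (tag : Tag n (X.sz n)) (kc : (ℕ × ℕ) × Ct (X.sz n)) (pp : T.Param n)
    (lab : Lab T n (X.sz n)) : PMF Bool :=
  (X.A.prog n).out (env T F n pp fun _ => 0)
    (viewOf X.c (refreshNat T F n (leavesOf T X.c m.1.1 m.1.2 κ lab tag kc)) id
      (leavesOf T X.c m.1.1 m.1.2 κ lab tag kc) m.2.1 m.2.2 (X.tg n) b)

/-- The shuffle experiment with given distributions of labels, tags, and ciphertexts. -/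
noncomputable def game (Dl : T.Param n → PMF (Lab T n (X.sz n)))
    (Dt : Fin (2 ^ n) → PMF (Tag n (X.sz n))) (Dk : PMF ((ℕ × ℕ) × Ct (X.sz n))) : PMF Bool :=
  (unif Bool).bind fun b => (unif (Misc T n (X.sz n))).bind fun m =>
    (unif (Fin (2 ^ n))).bind fun κ => (Dt κ).bind fun tag => Dk.bind fun kc =>
      (T.setup n).bind fun pp => (Dl pp).bind fun lab =>
        (X.play F n b m κ tag kc pp lab).map (· == b)

theorem small {rho auth : T.Key n} {κ : Fin (2 ^ n)} {lab : Lab T n (X.sz n)}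
    {tag : Tag n (X.sz n)} {kc : (ℕ × ℕ) × Ct (X.sz n)} (h : InRange (X.W n) kc) :
    Small T n (X.W n) (leavesOf T X.c rho auth κ lab tag kc) :=
  ⟨X.len_le n, X.n_le n, X.sz_le n, h.N_ne, h.N4, h.pre, h.hon⟩

/-- Averaging fixes everything except the public parameters and the labels, which depend on them.
Keeping `kc` in the support preserves the size bounds that the hardwired constants have to satisfy.
-/
theorem exists_game_sub_le_lab (Dl Dl' : T.Param n → PMF (Lab T n (X.sz n)))
    (Dt : Fin (2 ^ n) → PMF (Tag n (X.sz n))) (Dk : PMF ((ℕ × ℕ) × Ct (X.sz n))) :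
    ∃ b m κ tag, ∃ kc ∈ Dk.support,
      |prob (X.game F n Dl Dt Dk) - prob (X.game F n Dl' Dt Dk)| ≤
        |prob ((T.setup n).bind fun pp => (Dl pp).bind (X.play F n b m κ tag kc pp)) -
          prob ((T.setup n).bind fun pp => (Dl' pp).bind (X.play F n b m κ tag kc pp))| := by
  obtain ⟨b, -, hb⟩ := exists_mem_support_abs_prob_sub_le (unif Bool) _ _
  obtain ⟨m, -, hm⟩ := exists_mem_support_abs_prob_sub_le (unif (Misc T n (X.sz n))) _ _
  obtain ⟨κ, -, hκ⟩ := exists_mem_support_abs_prob_sub_le (unif (Fin (2 ^ n))) _ _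
  obtain ⟨tag, -, htag⟩ := exists_mem_support_abs_prob_sub_le (Dt κ) _ _
  obtain ⟨kc, hkc, h⟩ := exists_mem_support_abs_prob_sub_le Dk _ _
  refine ⟨b, m, κ, tag, kc, hkc,
    hb.trans (hm.trans (hκ.trans (htag.trans (h.trans_eq ?_))))⟩
  -- Comparing the guess with a fixed bit is the identity or a negation, neither of which changes
  -- the distance of two probabilities.
  simp only [← PMF.map_bind]
  exact abs_prob_sub_map_beq _ _ _

theorem bind_comm₃ {α β γ δ : Type*} (p : PMF α) (q : PMF β) (r : PMF γ)
    (f : α → β → γ → PMF δ) :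
    (p.bind fun a => q.bind fun b => r.bind fun c => f a b c) =
      q.bind fun b => r.bind fun c => p.bind fun a => f a b c := by
  rw [PMF.bind_comm]
  congr 1
  funext b
  rw [PMF.bind_comm]

/-- Here the labels no longer depend on the public parameters, so they can be drawn first and
hardwired. This is why the labels are replaced before the tags. The key `κ` of the corrupted server
is fixed too, while the tag distribution for that key remains. -/
theorem exists_game_sub_le_tag (L : PMF (Lab T n (X.sz n)))
    (Dt Dt' : Fin (2 ^ n) → PMF (Tag n (X.sz n))) (Dk : PMF ((ℕ × ℕ) × Ct (X.sz n))) :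
    ∃ b m κ lab, ∃ kc ∈ Dk.support,
      |prob (X.game F n (fun _ => L) Dt Dk) - prob (X.game F n (fun _ => L) Dt' Dk)| ≤
        |prob ((T.setup n).bind fun pp =>
            (Dt κ).bind fun tag => X.play F n b m κ tag kc pp lab) -
          prob ((T.setup n).bind fun pp =>
            (Dt' κ).bind fun tag => X.play F n b m κ tag kc pp lab)| := by
  obtain ⟨b, -, hb⟩ := exists_mem_support_abs_prob_sub_le (unif Bool) _ _
  obtain ⟨m, -, hm⟩ := exists_mem_support_abs_prob_sub_le (unif (Misc T n (X.sz n))) _ _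
  obtain ⟨κ, -, hκ⟩ := exists_mem_support_abs_prob_sub_le (unif (Fin (2 ^ n))) _ _
  have hc : ∀ Dt : Fin (2 ^ n) → PMF (Tag n (X.sz n)),
      ((Dt κ).bind fun tag => Dk.bind fun kc =>
        (T.setup n).bind fun pp => L.bind fun lab =>
          (X.play F n b m κ tag kc pp lab).map (· == b)) =
      Dk.bind fun kc => L.bind fun lab => (T.setup n).bind fun pp => (Dt κ).bind fun tag =>
          (X.play F n b m κ tag kc pp lab).map (· == b) := by
    intro Dt
    rw [PMF.bind_comm]
    congr 1
    funext kc
    rw [bind_comm₃, PMF.bind_comm]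
  obtain ⟨kc, hkc, h₁⟩ := exists_mem_support_abs_prob_sub_le Dk _ _
  obtain ⟨lab, -, h₂⟩ := exists_mem_support_abs_prob_sub_le L _ _
  refine ⟨b, m, κ, lab, kc, hkc, hb.trans (hm.trans (hκ.trans ?_))⟩
  rw [hc, hc]
  refine h₁.trans (h₂.trans_eq ?_)
  simp only [← PMF.map_bind]
  exact abs_prob_sub_map_beq _ _ _

/-- Keys and ciphertexts stay random, since in the linking experiment they are supplied by the
challenger; labels and tags are hardwired. -/
theorem exists_game_sub_le_ct (L : PMF (Lab T n (X.sz n)))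
    (Dt : Fin (2 ^ n) → PMF (Tag n (X.sz n))) (Dk Dk' : PMF ((ℕ × ℕ) × Ct (X.sz n))) :
    ∃ b m κ lab tag,
      |prob (X.game F n (fun _ => L) Dt Dk) - prob (X.game F n (fun _ => L) Dt Dk')| ≤
        |prob ((T.setup n).bind fun pp =>
            Dk.bind fun kc => X.play F n b m κ tag kc pp lab) -
          prob ((T.setup n).bind fun pp =>
            Dk'.bind fun kc => X.play F n b m κ tag kc pp lab)| := by
  obtain ⟨b, -, hb⟩ := exists_mem_support_abs_prob_sub_le (unif Bool) _ _
  obtain ⟨m, -, hm⟩ := exists_mem_support_abs_prob_sub_le (unif (Misc T n (X.sz n))) _ _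
  obtain ⟨κ, -, hκ⟩ := exists_mem_support_abs_prob_sub_le (unif (Fin (2 ^ n))) _ _
  obtain ⟨tag, -, htag⟩ := exists_mem_support_abs_prob_sub_le (Dt κ) _ _
  have hc : ∀ Dk : PMF ((ℕ × ℕ) × Ct (X.sz n)),
      (Dk.bind fun kc => (T.setup n).bind fun pp => L.bind fun lab =>
          (X.play F n b m κ tag kc pp lab).map (· == b)) =
      L.bind fun lab => (T.setup n).bind fun pp => Dk.bind fun kc =>
          (X.play F n b m κ tag kc pp lab).map (· == b) := by
    intro Dk
    rw [bind_comm₃, PMF.bind_comm]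
  obtain ⟨lab, -, h₂⟩ := exists_mem_support_abs_prob_sub_le L _ _
  refine ⟨b, m, κ, lab, tag, hb.trans (hm.trans (hκ.trans (htag.trans ?_)))⟩
  rw [hc, hc]
  refine h₂.trans_eq ?_
  simp only [← PMF.map_bind]
  exact abs_prob_sub_map_beq _ _ _

end Setting

namespace Setting

variable {T : TPF} (F : KeyedFun) (X : Setting T) (n : ℕ)

/-! ## Reductions to pseudorandomness -/

/-- The cost of the expressions for the leaves in the reductions. -/
def budget : ℕ := (4 * X.u n + 20) * (X.W n + 1)

/-- The cost of the reductions. -/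
def bound : ℕ :=
  (15 + 22 * (X.W n + X.W n)) * (7 * (X.budget n + 2 * (X.W n + 1)) + 6 * (X.W n + 1)) +
    (X.A.prog n).cost

theorem polyBounded_bound : PolyBounded X.bound := by
  have hW1 : PolyBounded fun n => X.W n + 1 := X.W_poly.add (polyBounded_const 1)
  have hB : PolyBounded X.budget :=
    (((polyBounded_const 4).mul X.u_poly).add (polyBounded_const 20)).mul hW1
  exact (((polyBounded_const 15).add ((polyBounded_const 22).mul (X.W_poly.add X.W_poly))).mul
    (((polyBounded_const 7).mul (hB.add ((polyBounded_const 2).mul hW1))).add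
      ((polyBounded_const 6).mul hW1))).add X.A.poly

/-- The adversary, run on a view whose leaves are given by expressions. -/
def reduction (t : ℕ) (b : Bool) (m : Misc T n (X.sz n)) (κ : Fin (2 ^ n))
    (l₁ l₂ : Word (X.sz n) → Expr) (t₁ t₂ : Server → Word (X.sz n) → Expr) (N pdk : Expr)
    (i₁ i₂ r : Server → Word (X.sz n) → Expr) : Program :=
  viewProg (X.W n) t X.c (exprLeaves X.c m.1.1.val.val m.1.2.val.val κ.val l₁ l₂ t₁ t₂ N pdk
    i₁ i₂ r) m.2.1 m.2.2 (X.tg n) b (X.A.prog n)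

section Reduction

variable {n} {b : Bool} {m : Misc T n (X.sz n)} {κ : Fin (2 ^ n)} {pp : T.Param n}
  {chal : ℕ → ℕ} {base : List ℕ} {lab : Lab T n (X.sz n)} {tag : Tag n (X.sz n)}
  {kc : (ℕ × ℕ) × Ct (X.sz n)}
  {l₁ l₂ : Word (X.sz n) → Expr} {t₁ t₂ : Server → Word (X.sz n) → Expr} {N pdk : Expr}
  {i₁ i₂ r : Server → Word (X.sz n) → Expr}

/-- The expressions represent the leaves of the view. -/
structure Represents (pp : T.Param n) (chal : ℕ → ℕ) (base : List ℕ) (lab : Lab T n (X.sz n))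
    (tag : Tag n (X.sz n)) (kc : (ℕ × ℕ) × Ct (X.sz n))
    (l₁ l₂ : Word (X.sz n) → Expr) (t₁ t₂ : Server → Word (X.sz n) → Expr) (N pdk : Expr)
    (i₁ i₂ r : Server → Word (X.sz n) → Expr) : Prop where
  l₁ : ∀ w, Rep (X.W n) (env T F n pp chal) base (X.budget n) (l₁ w) (T.enc n (lab.1 w))
  l₂ : ∀ w, Rep (X.W n) (env T F n pp chal) base (X.budget n) (l₂ w) (T.enc n (lab.2 w))
  t₁ : ∀ s w, Rep (X.W n) (env T F n pp chal) base (X.budget n) (t₁ s w) (tag.1 s w).val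
  t₂ : ∀ s w, Rep (X.W n) (env T F n pp chal) base (X.budget n) (t₂ s w) (tag.2 s w).val
  N : Rep (X.W n) (env T F n pp chal) base (X.budget n) N kc.1.1
  pdk : Rep (X.W n) (env T F n pp chal) base (X.budget n) pdk kc.1.2
  i₁ : ∀ s w, Rep (X.W n) (env T F n pp chal) base (X.budget n) (i₁ s w) (kc.2.1 s w)
  i₂ : ∀ s w, Rep (X.W n) (env T F n pp chal) base (X.budget n) (i₂ s w) (kc.2.2.1 s w)
  r : ∀ s w, Rep (X.W n) (env T F n pp chal) base (X.budget n) (r s w) (kc.2.2.2 s w)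

/-- The unit `W + 1` bounds the cost of one instruction. In `4 * u + 20` the first term pays for the
two tag functions of each previous round, at two units each. The constant covers what remains: an
oracle call and two more tag functions take 7 units, an encryption takes 19. -/
theorem le_budget {k : ℕ} (hk : k ≤ 4 * X.u n + 20) : k * (X.W n + 1) ≤ X.budget n :=
  Nat.mul_le_mul_right _ hk

theorem represents_rel
    (h : X.Represents F pp chal base lab tag kc l₁ l₂ t₁ t₂ N pdk i₁ i₂ r)
    (m : Misc T n (X.sz n)) (κ : Fin (2 ^ n)) :
    (exprLeaves X.c m.1.1.val.val m.1.2.val.val κ.val l₁ l₂ t₁ t₂ N pdk i₁ i₂ r).Rel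
      (Rep (X.W n) (env T F n pp chal) base (X.budget n + 2 * (X.W n + 1)))
      (leavesOf T X.c m.1.1 m.1.2 κ lab tag kc) :=
  exprLeaves_rel T F pp chal X.c m.1.1 m.1.2 κ (X.len_le n) (X.n_le n)
    (by simpa using X.le_budget (n := n) (k := 1) (by omega))
    h.l₁ h.l₂ h.t₁ h.t₂ h.N h.pdk h.i₁ h.i₂ h.r

theorem out_reduction (hkc : InRange (X.W n) kc)
    (h : X.Represents F pp chal base lab tag kc l₁ l₂ t₁ t₂ N pdk i₁ i₂ r) :
    (X.reduction n base.length b m κ l₁ l₂ t₁ t₂ N pdk i₁ i₂ r).out (env T F n pp chal) base =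
      X.play F n b m κ tag kc pp lab :=
  out_viewProg T F pp chal (X.represents_rel F h m κ) (X.small n hkc) X.c m.2.1 m.2.2 (X.tg n) b _

theorem cost_reduction_le (hkc : InRange (X.W n) kc)
    (h : X.Represents F pp chal base lab tag kc l₁ l₂ t₁ t₂ N pdk i₁ i₂ r) (t : ℕ) :
    (X.reduction n t b m κ l₁ l₂ t₁ t₂ N pdk i₁ i₂ r).cost ≤ X.bound n := by
  refine (cost_viewProg_le T F pp chal (X.represents_rel F h m κ) (X.small n hkc) t X.c m.2.1 m.2.2
    (X.tg n)
    b _).trans ?_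
  unfold bound
  gcongr
  · exact X.sz_le n _
  · exact X.sz_le n _

theorem rep_const {v : ℕ} (hv : v < 2 ^ X.W n) :
    Rep (X.W n) (env T F n pp chal) base (X.budget n) (.const v) v :=
  (Rep.const hv).mono (by simpa using X.le_budget (n := n) (k := 1) (by omega))

theorem fin_lt (x : Fin (2 ^ n)) : x.val < 2 ^ X.W n :=
  x.is_lt.trans_le (Nat.pow_le_pow_right two_pos (X.n_le n))

theorem represents_of_const (hkc : InRange (X.W n) kc)
    (hl₁ : ∀ w, Rep (X.W n) (env T F n pp chal) base (X.budget n) (l₁ w) (T.enc n (lab.1 w)))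
    (hl₂ : ∀ w, Rep (X.W n) (env T F n pp chal) base (X.budget n) (l₂ w) (T.enc n (lab.2 w)))
    (ht₁ : ∀ s w, Rep (X.W n) (env T F n pp chal) base (X.budget n) (t₁ s w) (tag.1 s w).val)
    (ht₂ : ∀ s w, Rep (X.W n) (env T F n pp chal) base (X.budget n) (t₂ s w) (tag.2 s w).val) :
    X.Represents F pp chal base lab tag kc l₁ l₂ t₁ t₂ (.const kc.1.1) (.const kc.1.2)
      (fun s w => .const (kc.2.1 s w)) (fun s w => .const (kc.2.2.1 s w))
      (fun s w => .const (kc.2.2.2 s w)) :=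
  ⟨hl₁, hl₂, ht₁, ht₂, X.rep_const F hkc.N_lt, X.rep_const F hkc.pdk,
    fun s w => X.rep_const F ((hkc.pre s w).trans hkc.sq_lt),
    fun s w => X.rep_const F ((hkc.hon s w).trans hkc.sq_lt),
    fun s w => X.rep_const F (hkc.coin s w)⟩

theorem rep_chal {x v : ℕ} (hx : x < 2 ^ X.W n) (hv : v < 2 ^ X.W n) (h : chal x = v) :
    Rep (X.W n) (env T F n pp chal) base (3 * (X.W n + 1))
      (.call .chal (.const x) (.const 0)) v :=
  (Rep.call .chal (Rep.const hx) (Rep.const (Nat.two_pow_pos _)) h hv).mono (by omega)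

end Reduction

/-! ## Replacing the labels -/

/-- The labels under independent keys. -/
noncomputable def labReal (pp : T.Param n) : PMF (Lab T n (X.sz n)) :=
  (unif (T.Key n)).bind fun k₂ => (unif (T.Key n)).bind fun k₁ =>
    PMF.pure (fun w => T.rnd pp k₁ (X.word n w), fun w => T.rnd pp k₂ (X.word n w))

/-- Random labels before the refresh, and labels under a key afterwards. -/
noncomputable def labMid (pp : T.Param n) : PMF (Lab T n (X.sz n)) :=
  (unif (T.Key n)).bind fun k₂ => (unif (Word (X.sz n) → T.G n)).bind fun L₁ =>
    PMF.pure (L₁, fun w => T.rnd pp k₂ (X.word n w))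

/-- Random labels. -/
noncomputable def labIdeal : PMF (Lab T n (X.sz n)) :=
  (unif (Word (X.sz n) → T.G n)).bind fun L₁ => (unif (Word (X.sz n) → T.G n)).bind fun L₂ =>
    PMF.pure (L₁, L₂)

/-- If the output depends on the oracle only through its values at the distinct points `q`, a random
function may be replaced by a uniform vector of values, by `unif_map_comp`. -/
theorem bind_ideal_out {R : Type} [Finite R] [Nonempty R] (encR : R → ℕ) (P : Program)
    {Q : Type} [Finite Q] (q : Q → ℕ) (hq : Function.Injective q) (hlt : ∀ x, q x < 2 ^ P.cost)
    (f : T.Param n → (Q → R) → PMF Bool)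
    (h : ∀ pp chal v, (∀ x, chal (q x) = encR (v x)) → P.out (env T F n pp chal) [] = f pp v) :
    prfIdeal T F n encR P = (T.setup n).bind fun pp => (unif (Q → R)).bind (f pp) := by
  unfold prfIdeal
  change ((T.setup n).bind fun pp => (unif (Fin (2 ^ P.cost) → R)).bind fun g =>
    P.out (env T F n pp fun x => if h : x < 2 ^ P.cost then encR (g ⟨x, h⟩) else 0) []) = _
  congr 1
  funext pp
  rw [← unif_bind_of_map (unif_map_comp (R := R)
    (fun x => (⟨q x, hlt x⟩ : Fin (2 ^ P.cost))) fun x y hxy => hq (congrArg Fin.val hxy))]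
  congr 1
  funext g
  exact h _ _ _ fun x => by simp [hlt x]

theorem bind_real_out {K R : Type} [Finite K] [Nonempty K] (encR : R → ℕ)
    (φ : T.Param n → K → ℕ → R) (P : Program) {Q : Type} (q : Q → ℕ)
    (f : T.Param n → (Q → R) → PMF Bool)
    (h : ∀ pp chal v, (∀ x, chal (q x) = encR (v x)) → P.out (env T F n pp chal) [] = f pp v) :
    prfReal T F n encR φ P =
      (T.setup n).bind fun pp => (unif K).bind fun k => f pp fun x => φ pp k (q x) := by
  unfold prfReal
  change ((T.setup n).bind fun pp => (unif K).bind fun k =>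
    P.out (env T F n pp fun x => encR (φ pp k x)) []) = _
  congr 1
  funext pp
  congr 1
  funext k
  exact h _ _ _ fun x => rfl

/-- A pseudorandomness adversary that runs the shuffle adversary on a view computed from oracle
answers at the points `q`. -/
theorem exists_prf_adversary {K R Q : Type} [Finite K] [Nonempty K] [Finite R] [Nonempty R]
    [Finite Q] (encR : R → ℕ) (φ : T.Param n → K → ℕ → R) (q : Q → ℕ)
    (hq : Function.Injective q) (hlt : ∀ x, q x < 2 ^ X.W n) (b : Bool)
    (m : Misc T n (X.sz n)) (κ : Fin (2 ^ n)) {kc : (ℕ × ℕ) × Ct (X.sz n)}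
    (hkc : InRange (X.W n) kc) {l₁ l₂ : Word (X.sz n) → Expr}
    {t₁ t₂ : Server → Word (X.sz n) → Expr} (lab : T.Param n → (Q → R) → Lab T n (X.sz n))
    (tag : (Q → R) → Tag n (X.sz n))
    (hr : ∀ pp chal v, (∀ x, chal (q x) = encR (v x)) →
      X.Represents F pp chal [] (lab pp v) (tag v) kc l₁ l₂ t₁ t₂ (.const kc.1.1) (.const kc.1.2)
        (fun s w => .const (kc.2.1 s w)) (fun s w => .const (kc.2.2.1 s w))
        (fun s w => .const (kc.2.2.2 s w))) :
    ∃ P : Program, P.cost ≤ X.bound n ∧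
      prfReal T F n encR φ P = ((T.setup n).bind fun pp => (unif K).bind fun k =>
        X.play F n b m κ (tag fun x => φ pp k (q x)) kc pp (lab pp fun x => φ pp k (q x))) ∧
      prfIdeal T F n encR P = (T.setup n).bind fun pp => (unif (Q → R)).bind fun v =>
        X.play F n b m κ (tag v) kc pp (lab pp v) := by
  have ho := fun pp chal v hv =>
    X.out_reduction F (b := b) (m := m) (κ := κ) hkc (hr pp chal v hv)
  refine ⟨X.reduction n 0 b m κ l₁ l₂ t₁ t₂ _ _ _ _ _, ?_,
    bind_real_out F n encR φ _ q (fun pp v => X.play F n b m κ (tag v) kc pp (lab pp v)) ho,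
    bind_ideal_out F n encR _ q hq
      (fun x => (hlt x).trans_le (Nat.pow_le_pow_right two_pos (le_cost_viewProg ..)))
      (fun pp v => X.play F n b m κ (tag v) kc pp (lab pp v)) ho⟩
  -- The cost bound is extracted from a representation statement, which refers to some parameters
  -- and oracle; any choice serves.
  obtain ⟨pp, -⟩ := (T.setup n).support_nonempty
  obtain ⟨k⟩ : Nonempty K := inferInstance
  exact X.cost_reduction_le F hkc
    (hr pp (fun x => encR (φ pp k x)) (fun x => φ pp k (q x)) fun x => rfl) 0

variable {F}

/-- The oracle supplies the labels before the round. The independent key `k₂` is hardwired, and the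
labels after the honest refresh are computed with the public map and one exponentiation. -/
theorem negligible_labReal_sub_labMid (hT : TPFSecure T F)
    (Dt : ∀ n, Fin (2 ^ n) → PMF (Tag n (X.sz n))) (Dk : ∀ n, PMF ((ℕ × ℕ) × Ct (X.sz n)))
    (hDk : ∀ n, ∀ kc ∈ (Dk n).support, InRange (X.W n) kc) :
    Negligible fun n => |prob (X.game F n (X.labReal n) (Dt n) (Dk n)) -
      prob (X.game F n (X.labMid n) (Dt n) (Dk n))| := by
  have key : ∀ n, ∃ P : Program, P.cost ≤ X.bound n ∧
      |prob (X.game F n (X.labReal n) (Dt n) (Dk n)) -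
        prob (X.game F n (X.labMid n) (Dt n) (Dk n))| ≤
      |prob (prfReal T F n (T.enc n) (fun pp (k : T.Key n) => T.rnd pp k) P) -
        prob (prfIdeal T F n (T.enc n) P)| := by
    intro n
    obtain ⟨b, m, κ, tag, kc, hkc, h⟩ :=
      X.exists_game_sub_le_lab F n (X.labReal n) (X.labMid n) (Dt n) (Dk n)
    simp only [labReal, labMid, PMF.bind_bind, PMF.pure_bind] at h
    -- Drawing `k₂` ahead of the public parameters lets it be fixed as well.
    rw [PMF.bind_comm (T.setup n), PMF.bind_comm (T.setup n)] at h
    obtain ⟨k₂, -, h₂⟩ := exists_mem_support_abs_prob_sub_le (unif (T.Key n))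
      (fun k₂ => (T.setup n).bind fun pp => (unif (T.Key n)).bind fun k₁ =>
        X.play F n b m κ tag kc pp
          (fun w => T.rnd pp k₁ (X.word n w), fun w => T.rnd pp k₂ (X.word n w)))
      (fun k₂ => (T.setup n).bind fun pp => (unif (Word (X.sz n) → T.G n)).bind fun L₁ =>
        X.play F n b m κ tag kc pp (L₁, fun w => T.rnd pp k₂ (X.word n w)))
    have hr : ∀ pp chal (L : Word (X.sz n) → T.G n),
        (∀ w, chal (X.word n w) = T.enc n (L w)) →
        X.Represents F pp chal [] (L, fun w => T.rnd pp k₂ (X.word n w)) tag kc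
          (fun w => .call .chal (.const (X.word n w)) (.const 0))
          (fun w => .call .gpow (.call .hash (.const (X.word n w)) (.const 0))
            (.const k₂.val.val))
          (fun s w => .const (tag.1 s w).val) (fun s w => .const (tag.2 s w).val) _ _ _ _ _ :=
      fun pp chal L hL => X.represents_of_const F (hDk n kc hkc)
        (fun w => (X.rep_chal F (X.word_lt n w) (T.enc_lt (X.len_le n) _) (hL w)).mono
          (X.le_budget (by omega)))
        (fun w => (Rep.call .gpow (Rep.call .hash (Rep.const (X.word_lt n w))
          (Rep.const (Nat.two_pow_pos _)) rfl (T.enc_lt (X.len_le n) _))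
          (Rep.const (T.key_lt (X.len_le n) k₂)) (T.encPow_enc n _ _)
          (T.enc_lt (X.len_le n) _)).mono
            (le_trans (by linarith) (X.le_budget (k := 5) (by omega))))
        (fun s w => X.rep_const F (X.fin_lt _)) (fun s w => X.rep_const F (X.fin_lt _))
    obtain ⟨P, hP, hreal, hideal⟩ := X.exists_prf_adversary F n (T.enc n)
      (fun pp (k : T.Key n) => T.rnd pp k) (X.word n) (X.word_injective n) (X.word_lt n) b m κ
      (hDk n kc hkc) (fun pp L => (L, fun w => T.rnd pp k₂ (X.word n w))) (fun _ => tag) hr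
    exact ⟨P, hP, (h.trans h₂).trans_eq (by rw [hreal, hideal])⟩
  choose P hP hle using key
  exact (hT ⟨P, X.polyBounded_bound.mono hP⟩).mono (fun _ => abs_nonneg _) hle

/-- Now the oracle supplies the labels after the honest refresh. Those before it are already random
and independent of the parameters, so they are hardwired. -/
theorem negligible_labMid_sub_labIdeal (hT : TPFSecure T F)
    (Dt : ∀ n, Fin (2 ^ n) → PMF (Tag n (X.sz n))) (Dk : ∀ n, PMF ((ℕ × ℕ) × Ct (X.sz n)))
    (hDk : ∀ n, ∀ kc ∈ (Dk n).support, InRange (X.W n) kc) :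
    Negligible fun n => |prob (X.game F n (X.labMid n) (Dt n) (Dk n)) -
      prob (X.game F n (fun _ => X.labIdeal n) (Dt n) (Dk n))| := by
  have key : ∀ n, ∃ P : Program, P.cost ≤ X.bound n ∧
      |prob (X.game F n (X.labMid n) (Dt n) (Dk n)) -
        prob (X.game F n (fun _ => X.labIdeal n) (Dt n) (Dk n))| ≤
      |prob (prfReal T F n (T.enc n) (fun pp (k : T.Key n) => T.rnd pp k) P) -
        prob (prfIdeal T F n (T.enc n) P)| := by
    intro n
    obtain ⟨b, m, κ, tag, kc, hkc, h⟩ :=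
      X.exists_game_sub_le_lab F n (X.labMid n) (fun _ => X.labIdeal n) (Dt n) (Dk n)
    simp only [labMid, labIdeal, PMF.bind_bind, PMF.pure_bind] at h
    simp only [PMF.bind_comm (unif (T.Key n))] at h
    rw [PMF.bind_comm (T.setup n), PMF.bind_comm (T.setup n)] at h
    obtain ⟨L₁, -, h₂⟩ := exists_mem_support_abs_prob_sub_le (unif (Word (X.sz n) → T.G n))
      (fun L₁ => (T.setup n).bind fun pp => (unif (T.Key n)).bind fun k₂ =>
        X.play F n b m κ tag kc pp (L₁, fun w => T.rnd pp k₂ (X.word n w)))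
      (fun L₁ => (T.setup n).bind fun pp => (unif (Word (X.sz n) → T.G n)).bind fun L₂ =>
        X.play F n b m κ tag kc pp (L₁, L₂))
    have hr : ∀ pp chal (L : Word (X.sz n) → T.G n),
        (∀ w, chal (X.word n w) = T.enc n (L w)) →
        X.Represents F pp chal [] (L₁, L) tag kc
          (fun w => .const (T.enc n (L₁ w)))
          (fun w => .call .chal (.const (X.word n w)) (.const 0))
          (fun s w => .const (tag.1 s w).val) (fun s w => .const (tag.2 s w).val) _ _ _ _ _ :=
      fun pp chal L hL => X.represents_of_const F (hDk n kc hkc)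
        (fun w => X.rep_const F (T.enc_lt (X.len_le n) _))
        (fun w => (X.rep_chal F (X.word_lt n w) (T.enc_lt (X.len_le n) _) (hL w)).mono
          (X.le_budget (by omega)))
        (fun s w => X.rep_const F (X.fin_lt _)) (fun s w => X.rep_const F (X.fin_lt _))
    obtain ⟨P, hP, hreal, hideal⟩ := X.exists_prf_adversary F n (T.enc n)
      (fun pp (k : T.Key n) => T.rnd pp k) (X.word n) (X.word_injective n) (X.word_lt n) b m κ
      (hDk n kc hkc) (fun pp L => (L₁, L)) (fun _ => tag) hr
    exact ⟨P, hP, (h.trans h₂).trans_eq (by rw [hreal, hideal])⟩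
  choose P hP hle using key
  exact (hT ⟨P, X.polyBounded_bound.mono hP⟩).mono (fun _ => abs_nonneg _) hle

end Setting

/-! ## The chains of tags -/

section Chain

variable {Y Z : Type} (c : Server) (fc fd : Y → Y)

/-- The tag of an entry of the share of `s` after `u` rounds, where `fc` and `fd` are the tag
functions of the corrupted and of the honest server. -/
def preTag (u : ℕ) (s : Server) (t : Y) : Y :=
  if s = c then (fun x => fc (fd x))^[u] t else (fun x => fd (fc x))^[u] t

/-- The tag after the refresh by the honest server in the next round. -/
def honTag (u : ℕ) (s : Server) (t : Y) : Y :=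
  fd (if s = c then preTag c fc fd u s t else fc (preTag c fc fd u s t))

end Chain

section ChainRep

variable {W n : ℕ} {E : Env} {base : List ℕ} {fc fd : Fin (2 ^ n) → Fin (2 ^ n)}
  {ec ed : Expr → Expr} (c : Server)

theorem rep_iterate {B D : ℕ} {f : Fin (2 ^ n) → Fin (2 ^ n)} {ef : Expr → Expr}
    (hf : ∀ B e t, Rep W E base B e t.val → Rep W E base (B + D) (ef e) (f t).val) (u : ℕ)
    {e : Expr} {t : Fin (2 ^ n)} (h : Rep W E base B e t.val) :
    Rep W E base (B + u * D) (ef^[u] e) (f^[u] t).val := by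
  induction u generalizing B e t with
  | zero => simpa using h
  | succ u ih =>
    rw [Function.iterate_succ_apply, Function.iterate_succ_apply]
    exact (ih (hf _ _ _ h)).mono (by rw [Nat.succ_mul]; omega)

theorem rep_preTag {B D : ℕ}
    (hc : ∀ B e t, Rep W E base B e t.val → Rep W E base (B + D) (ec e) (fc t).val)
    (hd : ∀ B e t, Rep W E base B e t.val → Rep W E base (B + D) (ed e) (fd t).val)
    (u : ℕ) (s : Server) {e : Expr} {t : Fin (2 ^ n)} (h : Rep W E base B e t.val) :
    Rep W E base (B + u * (2 * D)) (preTag c ec ed u s e) (preTag c fc fd u s t).val := by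
  unfold preTag
  split_ifs
  · exact rep_iterate (ef := fun e => ec (ed e)) (f := fun x => fc (fd x))
      (fun B e t h => (hc _ _ _ (hd _ _ _ h)).mono (by omega)) u h
  · exact rep_iterate (ef := fun e => ed (ec e)) (f := fun x => fd (fc x))
      (fun B e t h => (hd _ _ _ (hc _ _ _ h)).mono (by omega)) u h

theorem rep_honTag {B D : ℕ}
    (hc : ∀ B e t, Rep W E base B e t.val → Rep W E base (B + D) (ec e) (fc t).val)
    (hd : ∀ B e t, Rep W E base B e t.val → Rep W E base (B + D) (ed e) (fd t).val)
    (u : ℕ) (s : Server) {e : Expr} {t : Fin (2 ^ n)} (h : Rep W E base B e t.val) :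
    Rep W E base (B + u * (2 * D) + 2 * D) (honTag c ec ed u s e)
      (honTag c fc fd u s t).val := by
  have hp := rep_preTag c hc hd u s h
  unfold honTag
  split_ifs
  · exact (hd _ _ _ hp).mono (by omega)
  · exact (hd _ _ _ (hc _ _ _ hp)).mono (by omega)

end ChainRep

/-- `F` with an explicitly given key, as an expression. -/
def prfExpr (k : ℕ) (e : Expr) : Expr := .call .prf (.const k) e

/-- The challenge oracle, as an expression. -/
def chalExpr (e : Expr) : Expr := .call .chal e (.const 0)

namespace Setting

variable {T : TPF} (F : KeyedFun) (X : Setting T) (n : ℕ)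

/-- All tags, for given tag functions of the servers and initial tags. -/
def tagsOf (fc fd : Fin (2 ^ n) → Fin (2 ^ n)) (t : Server × Word (X.sz n) → Fin (2 ^ n)) :
    Tag n (X.sz n) :=
  (fun s w => preTag X.c fc fd (X.u n) s (t (s, w)),
    fun s w => honTag X.c fc fd (X.u n) s (t (s, w)))

/-- The string from which the initial tag is computed. -/
def tagInput (x : Server × Word (X.sz n)) : ℕ := Nat.pair x.1.num (X.word n x.2)

theorem tagInput_injective : Function.Injective (X.tagInput n) := by
  rintro ⟨s, w⟩ ⟨s', w'⟩ h
  obtain ⟨h₁, h₂⟩ := Nat.pair_eq_pair.1 h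
  have := X.word_injective n h₂
  cases s <;> cases s' <;> simp_all [Server.num]

/-- The real tags. -/
noncomputable def tagReal (κ : Fin (2 ^ n)) : PMF (Tag n (X.sz n)) :=
  (unif (Fin (2 ^ n))).bind fun κd => (unif (Fin (2 ^ n))).bind fun kT =>
    PMF.pure (X.tagsOf n (fun x => F n κ x.val) (fun x => F n κd x.val)
      fun x => F n kT (X.tagInput n x))

/-- The tags with random initial tags. -/
noncomputable def tagInit (κ : Fin (2 ^ n)) : PMF (Tag n (X.sz n)) :=
  (unif (Fin (2 ^ n))).bind fun κd => (unif (Server × Word (X.sz n) → Fin (2 ^ n))).bind fun t =>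
    PMF.pure (X.tagsOf n (fun x => F n κ x.val) (fun x => F n κd x.val) t)

/-- The tags with random initial tags and a random function of the honest server. -/
noncomputable def tagFun (κ : Fin (2 ^ n)) : PMF (Tag n (X.sz n)) :=
  (unif (Server × Word (X.sz n) → Fin (2 ^ n))).bind fun t =>
    (unif (Fin (2 ^ n) → Fin (2 ^ n))).bind fun g =>
      PMF.pure (X.tagsOf n (fun x => F n κ x.val) g t)

section

variable {n} {pp : T.Param n} {chal : ℕ → ℕ} {base : List ℕ}

theorem rep_prfExpr (κ : Fin (2 ^ n)) (B : ℕ) (e : Expr) (t : Fin (2 ^ n))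
    (h : Rep (X.W n) (env T F n pp chal) base B e t.val) :
    Rep (X.W n) (env T F n pp chal) base (B + 2 * (X.W n + 1)) (prfExpr κ.val e)
      (F n κ t.val).val :=
  (Rep.call .prf (Rep.const (X.fin_lt κ)) h (prfNat_val F n κ t.val) (X.fin_lt _)).mono
    (by omega)

theorem rep_chalExpr {g : Fin (2 ^ n) → Fin (2 ^ n)} (hg : ∀ x, chal x.val = (g x).val) (B : ℕ)
    (e : Expr) (t : Fin (2 ^ n)) (h : Rep (X.W n) (env T F n pp chal) base B e t.val) :
    Rep (X.W n) (env T F n pp chal) base (B + 2 * (X.W n + 1)) (chalExpr e) (g t).val :=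
  (Rep.call .chal h (Rep.const (Nat.two_pow_pos _)) (hg t) (X.fin_lt _)).mono (by omega)

end

variable {F}

/-- The oracle plays `F` under the key `kT` at the distinct strings `tagInput`. The tag key of the
honest server is independent of `kT`; it is hardwired, and the chains of later tags are computed by
calls to `F`. -/
theorem negligible_tagReal_sub_tagInit (hF : FSecure T F) (L : ∀ n, PMF (Lab T n (X.sz n)))
    (Dk : ∀ n, PMF ((ℕ × ℕ) × Ct (X.sz n)))
    (hDk : ∀ n, ∀ kc ∈ (Dk n).support, InRange (X.W n) kc) :
    Negligible fun n => |prob (X.game F n (fun _ => L n) (X.tagReal F n) (Dk n)) -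
      prob (X.game F n (fun _ => L n) (X.tagInit F n) (Dk n))| := by
  have key : ∀ n, ∃ P : Program, P.cost ≤ X.bound n ∧
      |prob (X.game F n (fun _ => L n) (X.tagReal F n) (Dk n)) -
        prob (X.game F n (fun _ => L n) (X.tagInit F n) (Dk n))| ≤
      |prob (prfReal T F n Fin.val (fun _ k => F n k) P) -
        prob (prfIdeal T F n (Fin.val : Fin (2 ^ n) → ℕ) P)| := by
    intro n
    obtain ⟨b, m, κ, lab, kc, hkc, h⟩ :=
      X.exists_game_sub_le_tag F n (L n) (X.tagReal F n) (X.tagInit F n) (Dk n)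
    simp only [tagReal.eq_1 F X n κ, tagInit.eq_1 F X n κ, PMF.bind_bind, PMF.pure_bind] at h
    rw [PMF.bind_comm (T.setup n), PMF.bind_comm (T.setup n)] at h
    obtain ⟨κd, -, h₂⟩ := exists_mem_support_abs_prob_sub_le (unif (Fin (2 ^ n)))
      (fun κd => (T.setup n).bind fun pp => (unif (Fin (2 ^ n))).bind fun kT =>
        X.play F n b m κ (X.tagsOf n (fun x => F n κ x.val) (fun x => F n κd x.val)
          fun x => F n kT (X.tagInput n x)) kc pp lab)
      (fun κd => (T.setup n).bind fun pp =>
        (unif (Server × Word (X.sz n) → Fin (2 ^ n))).bind fun t =>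
        X.play F n b m κ (X.tagsOf n (fun x => F n κ x.val) (fun x => F n κd x.val) t) kc pp lab)
    have hr : ∀ pp chal (t : Server × Word (X.sz n) → Fin (2 ^ n)),
        (∀ x, chal (X.tagInput n x) = (t x).val) →
        X.Represents F pp chal [] lab
          (X.tagsOf n (fun x => F n κ x.val) (fun x => F n κd x.val) t) kc
          (fun w => .const (T.enc n (lab.1 w))) (fun w => .const (T.enc n (lab.2 w)))
          (fun s w => preTag X.c (prfExpr κ.val) (prfExpr κd.val) (X.u n) s
            (.call .chal (.const (X.tagInput n (s, w))) (.const 0)))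
          (fun s w => honTag X.c (prfExpr κ.val) (prfExpr κd.val) (X.u n) s
            (.call .chal (.const (X.tagInput n (s, w))) (.const 0))) _ _ _ _ _ :=
      fun pp chal t ht => X.represents_of_const F (hDk n kc hkc)
        (fun w => X.rep_const F (T.enc_lt (X.len_le n) _))
        (fun w => X.rep_const F (T.enc_lt (X.len_le n) _))
        (fun s w => (rep_preTag X.c (X.rep_prfExpr F κ) (X.rep_prfExpr F κd) (X.u n) s
          (X.rep_chal F (X.pair_lt n s w) (X.fin_lt _) (ht (s, w)))).mono
            (by unfold budget; nlinarith))
        (fun s w => (rep_honTag X.c (X.rep_prfExpr F κ) (X.rep_prfExpr F κd) (X.u n) s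
          (X.rep_chal F (X.pair_lt n s w) (X.fin_lt _) (ht (s, w)))).mono
            (by unfold budget; nlinarith))
    obtain ⟨P, hP, hreal, hideal⟩ := X.exists_prf_adversary F n (Fin.val : Fin (2 ^ n) → ℕ)
      (fun _ k => F n k) (X.tagInput n) (X.tagInput_injective n)
      (fun x => X.pair_lt n x.1 x.2) b m κ (hDk n kc hkc) (fun _ _ => lab)
      (fun t => X.tagsOf n (fun x => F n κ x.val) (fun x => F n κd x.val) t) hr
    exact ⟨P, hP, (h.trans h₂).trans_eq (by rw [hreal, hideal])⟩
  choose P hP hle using key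
  exact (hF ⟨P, X.polyBounded_bound.mono hP⟩).mono (fun _ => abs_nonneg _) hle

/-- The oracle plays the tag function of the honest server. Its queries are adaptive, since each
argument depends on earlier answers, so the query set is taken to be all of `Fin (2 ^ n)`; only the
queries along the chains are actually made. -/
theorem negligible_tagInit_sub_tagFun (hF : FSecure T F) (L : ∀ n, PMF (Lab T n (X.sz n)))
    (Dk : ∀ n, PMF ((ℕ × ℕ) × Ct (X.sz n)))
    (hDk : ∀ n, ∀ kc ∈ (Dk n).support, InRange (X.W n) kc) :
    Negligible fun n => |prob (X.game F n (fun _ => L n) (X.tagInit F n) (Dk n)) -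
      prob (X.game F n (fun _ => L n) (X.tagFun F n) (Dk n))| := by
  have key : ∀ n, ∃ P : Program, P.cost ≤ X.bound n ∧
      |prob (X.game F n (fun _ => L n) (X.tagInit F n) (Dk n)) -
        prob (X.game F n (fun _ => L n) (X.tagFun F n) (Dk n))| ≤
      |prob (prfReal T F n Fin.val (fun _ k => F n k) P) -
        prob (prfIdeal T F n (Fin.val : Fin (2 ^ n) → ℕ) P)| := by
    intro n
    obtain ⟨b, m, κ, lab, kc, hkc, h⟩ :=
      X.exists_game_sub_le_tag F n (L n) (X.tagInit F n) (X.tagFun F n) (Dk n)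
    have hc : X.tagInit F n κ =
        (unif (Server × Word (X.sz n) → Fin (2 ^ n))).bind fun t =>
          (unif (Fin (2 ^ n))).bind fun κd =>
            PMF.pure (X.tagsOf n (fun x => F n κ x.val) (fun x => F n κd x.val) t) :=
      PMF.bind_comm _ _ _
    simp only [hc, tagFun.eq_1 F X n κ, PMF.bind_bind, PMF.pure_bind] at h
    rw [PMF.bind_comm (T.setup n), PMF.bind_comm (T.setup n)] at h
    obtain ⟨t, -, h₂⟩ := exists_mem_support_abs_prob_sub_le
      (unif (Server × Word (X.sz n) → Fin (2 ^ n)))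
      (fun t => (T.setup n).bind fun pp => (unif (Fin (2 ^ n))).bind fun κd =>
        X.play F n b m κ (X.tagsOf n (fun x => F n κ x.val) (fun x => F n κd x.val) t) kc pp lab)
      (fun t => (T.setup n).bind fun pp => (unif (Fin (2 ^ n) → Fin (2 ^ n))).bind fun g =>
        X.play F n b m κ (X.tagsOf n (fun x => F n κ x.val) g t) kc pp lab)
    have hr : ∀ pp chal (g : Fin (2 ^ n) → Fin (2 ^ n)), (∀ x, chal (Fin.val x) = (g x).val) →
        X.Represents F pp chal [] lab (X.tagsOf n (fun x => F n κ x.val) g t) kc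
          (fun w => .const (T.enc n (lab.1 w))) (fun w => .const (T.enc n (lab.2 w)))
          (fun s w => preTag X.c (prfExpr κ.val) chalExpr (X.u n) s (.const (t (s, w)).val))
          (fun s w => honTag X.c (prfExpr κ.val) chalExpr (X.u n) s (.const (t (s, w)).val))
          _ _ _ _ _ :=
      fun pp chal g hg => X.represents_of_const F (hDk n kc hkc)
        (fun w => X.rep_const F (T.enc_lt (X.len_le n) _))
        (fun w => X.rep_const F (T.enc_lt (X.len_le n) _))
        (fun s w => (rep_preTag X.c (X.rep_prfExpr F κ) (X.rep_chalExpr F hg) (X.u n) s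
          (Rep.const (X.fin_lt _))).mono (by unfold budget; nlinarith))
        (fun s w => (rep_honTag X.c (X.rep_prfExpr F κ) (X.rep_chalExpr F hg) (X.u n) s
          (Rep.const (X.fin_lt _))).mono (by unfold budget; nlinarith))
    obtain ⟨P, hP, hreal, hideal⟩ := X.exists_prf_adversary F n (Fin.val : Fin (2 ^ n) → ℕ)
      (fun _ k => F n k) (Fin.val : Fin (2 ^ n) → ℕ) Fin.val_injective
      X.fin_lt b m κ (hDk n kc hkc) (fun _ _ => lab)
      (fun g => X.tagsOf n (fun x => F n κ x.val) g t) hr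
    exact ⟨P, hP, (h.trans h₂).trans_eq (by rw [hreal, hideal])⟩
  choose P hP hle using key
  exact (hF ⟨P, X.polyBounded_bound.mono hP⟩).mono (fun _ => abs_nonneg _) hle

end Setting

/-! ## Union bounds -/

theorem prob_bind_le_add {α : Type*} (p : PMF α) (f : α → PMF Bool) (B : α → Bool) {η : ℝ}
    (hη : 0 ≤ η) (h : ∀ a, B a = false → prob (f a) ≤ η) :
    prob (p.bind f) ≤ prob (p.map B) + η := by
  rw [← PMF.bind_pure_comp, prob_bind, prob_bind]
  have hη' : η = ∑' a, (p a).toReal * η := by rw [tsum_mul_right, tsum_toReal, one_mul]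
  rw [hη', ← (summable_prob_bind p _).tsum_add ((summable_toReal p).mul_right η)]
  refine (summable_prob_bind p f).tsum_le_tsum (fun a => ?_)
    ((summable_prob_bind p _).add ((summable_toReal p).mul_right η))
  rw [← mul_add]
  refine mul_le_mul_of_nonneg_left ?_ ENNReal.toReal_nonneg
  cases hB : B a with
  | false => linarith [h a hB, prob_nonneg ((PMF.pure ∘ B) a)]
  | true =>
    have e : prob ((PMF.pure ∘ B) a) = 1 := by simp [prob, hB]
    linarith [prob_le_one (f a)]

theorem abs_prob_bind_sub_le {α : Type*} (p : PMF α) (f g h : α → PMF Bool)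
    (H : ∀ a, |prob (f a) - prob (g a)| ≤ prob (h a)) :
    |prob (p.bind f) - prob (p.bind g)| ≤ prob (p.bind h) := by
  have key : ∀ f g : α → PMF Bool, (∀ a, prob (f a) ≤ prob (g a) + prob (h a)) →
      prob (p.bind f) ≤ prob (p.bind g) + prob (p.bind h) := by
    intro f g H
    rw [prob_bind, prob_bind, prob_bind,
      ← (summable_prob_bind p g).tsum_add (summable_prob_bind p h)]
    refine (summable_prob_bind p f).tsum_le_tsum (fun a => ?_)
      ((summable_prob_bind p g).add (summable_prob_bind p h))
    rw [← mul_add]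
    exact mul_le_mul_of_nonneg_left (H a) ENNReal.toReal_nonneg
  rw [abs_sub_le_iff]
  constructor
  · linarith [key f g fun a => by linarith [(abs_sub_le_iff.1 (H a)).1]]
  · linarith [key g f fun a => by linarith [(abs_sub_le_iff.1 (H a)).2]]

theorem prob_map_eq_tsum {α : Type*} (p : PMF α) (B : α → Bool) :
    prob (p.map B) = ∑' a, (p a).toReal * (if B a then 1 else 0) := by
  rw [← PMF.bind_pure_comp, prob_bind]
  refine tsum_congr fun a => ?_
  cases hB : B a <;> simp [prob, hB]

theorem prob_map_exists_le {α ι : Type*} [Fintype ι] (p : PMF α) (B : α → Bool)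
    (E : ι → α → Bool) (h : ∀ a, B a = true → ∃ i, E i a = true) :
    prob (p.map B) ≤ ∑ i, prob (p.map (E i)) := by
  have hs : ∀ i, Summable fun a => (p a).toReal * (if E i a then (1 : ℝ) else 0) := fun i =>
    summable_toReal_mul p _ (fun a => by split_ifs <;> simp) fun a => by split_ifs <;> simp
  simp only [prob_map_eq_tsum]
  rw [← Summable.tsum_finsetSum fun i _ => hs i]
  refine Summable.tsum_le_tsum (fun a => ?_)
    (summable_toReal_mul p _ (fun a => by split_ifs <;> simp) fun a => by split_ifs <;> simp)
    (summable_sum fun i _ => hs i)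
  rw [← Finset.mul_sum]
  refine mul_le_mul_of_nonneg_left ?_ ENNReal.toReal_nonneg
  have h0 : ∀ i ∈ Finset.univ, (0 : ℝ) ≤ if E i a then 1 else 0 := fun i _ => by
    split_ifs <;> simp
  split_ifs with hB
  · obtain ⟨i, hi⟩ := h a hB
    calc (1 : ℝ) = if E i a then 1 else 0 := by simp [hi]
      _ ≤ _ := Finset.single_le_sum h0 (Finset.mem_univ i)
  · exact Finset.sum_nonneg h0

theorem prob_unif_eq {α : Type} [Finite α] [Nonempty α] [DecidableEq α] (d : α) :
    prob ((unif α).map fun a => decide (a = d)) = (Nat.card α : ℝ)⁻¹ := by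
  rw [prob_map_eq_tsum, tsum_eq_single d]
  · simp [unif_apply_toReal]
  · intro a ha; simp [ha]

/-! ## Collisions of a pseudorandom function -/

section Collision

/-- Two different values of a random function, one of which may be transformed, rarely agree. -/
theorem prob_pair_eq_le {α : Type} [Finite α] [Nonempty α] [DecidableEq α] (f : α → α) :
    prob ((unif (α × α)).map fun v => decide (v.1 = f v.2)) = (Nat.card α : ℝ)⁻¹ := by
  rw [← PMF.bind_pure_comp, unif_prod_bind, PMF.bind_comm]
  have : ∀ b : α, ((unif α).bind fun a => (PMF.pure ∘ fun v : α × α => decide (v.1 = f v.2)) (a, b))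
      = (unif α).map fun a => decide (a = f b) := fun b => by
    rw [← PMF.bind_pure_comp]; rfl
  simp only [this]
  rw [prob_bind]
  simp only [prob_unif_eq, tsum_mul_right, tsum_toReal, one_mul]

theorem prob_random_collision_le {α : Type} [Finite α] [Nonempty α] [DecidableEq α]
    (v : α × α) (hv : v.1 ≠ v.2) :
    prob ((unif (α → α)).map fun g => decide (g v.1 = g v.2)) = (Nat.card α : ℝ)⁻¹ := by
  let i : Bool → α := fun b => if b then v.1 else v.2
  have hi : Function.Injective i := by
    intro b b' h
    cases b <;> cases b' <;> simp_all [i, eq_comm]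
  have h₁ : ((unif (α → α)).map fun g => decide (g v.1 = g v.2)) =
      (unif (α × α)).map fun v => decide (v.1 = id v.2) := by
    rw [← unif_map_equiv (Equiv.boolArrowEquivProd α), ← unif_map_comp (R := α) i hi,
      PMF.map_comp, PMF.map_comp]
    congr 1
    funext g
    simp [i, eq_comm]
  rw [h₁, prob_pair_eq_le]

/-- A program that tests whether the oracle answers at `x` and `y` agree. -/
def collisionExpr (x y : ℕ) : Expr :=
  let a := Expr.call .chal (.const x) (.const 0)
  let b := Expr.call .chal (.const y) (.const 0)
  .arith .sub (.const 1) (.arith .add (.arith .sub a b) (.arith .sub b a))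

/-- With truncated subtraction the two differences add up to the distance of the answers, so the
value is 1 exactly if they agree. Width `n + 1` accommodates the constant 1 even for `n = 0`. The 17
units are four constants and two oracle calls, each difference evaluated separately, and the
remaining arithmetic. -/
theorem rep_collisionExpr {E : Env} {n x y gx gy : ℕ} (hx : x < 2 ^ n) (hy : y < 2 ^ n)
    (hgx : gx < 2 ^ n) (hgy : gy < 2 ^ n) (h₁ : E .chal x 0 = gx) (h₂ : E .chal y 0 = gy) :
    Rep (n + 1) E [] (17 * (n + 2)) (collisionExpr x y)
      (1 - ((gx - gy) + (gy - gx))) := by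
  have h2 : 2 ^ (n + 1) = 2 ^ n + 2 ^ n := by ring
  have h0 : 0 < 2 ^ n := Nat.two_pow_pos n
  have a := Rep.call (W := n + 1) (base := []) .chal (Rep.const (by omega))
    (Rep.const (by omega)) h₁ (by omega)
  have b := Rep.call (W := n + 1) (base := []) .chal (Rep.const (by omega))
    (Rep.const (by omega)) h₂ (by omega)
  exact (Rep.arith .sub (Rep.const (by omega)) (Rep.arith .add (Rep.arith .sub a b rfl
    (by simp only [Arith.eval]; omega)) (Rep.arith .sub b a rfl
    (by simp only [Arith.eval]; omega)) rfl (by simp only [Arith.eval]; omega)) rfl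
    (by simp only [Arith.eval]; omega)).mono (by omega)

theorem out_compile {W B : ℕ} {E : Env} {e : Expr} {v : ℕ} (h : Rep W E [] B e v) :
    Program.out (e.compile W 0) E [] = PMF.pure (decide (v = 1)) := by
  obtain ⟨s, -, hs⟩ := e.run_compile W E [] h.fits [] 0 rfl
  simp only [List.append_nil, List.nil_append] at hs
  rw [Program.out, hs, PMF.pure_map, h.eval]
  simp

variable {T : TPF} {F : KeyedFun}

/-- The probability that `F` with a random key has a collision at two random points. -/
noncomputable def collision (F : KeyedFun) (n : ℕ) : ℝ :=
  prob ((unif (Fin (2 ^ n) × Fin (2 ^ n))).bind fun v => (unif (Fin (2 ^ n))).map fun κ =>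
    decide (F n κ v.1.val = F n κ v.2.val))

/-- A best pair of points is hardwired into a program that queries both and compares. For a random
function the collision probability is at most `2 * 2⁻ⁿ`: the two random points coincide, or two
independent values do. -/
theorem negligible_collision (hF : FSecure T F) : Negligible (collision F) := by
  let real : ∀ n, Fin (2 ^ n) × Fin (2 ^ n) → PMF Bool := fun n v =>
    (unif (Fin (2 ^ n))).map fun κ => decide (F n κ v.1.val = F n κ v.2.val)
  let ideal : ∀ n, Fin (2 ^ n) × Fin (2 ^ n) → PMF Bool := fun n v =>
    (unif (Fin (2 ^ n) → Fin (2 ^ n))).map fun g => decide (g v.1 = g v.2)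
  have key : ∀ n, ∃ P : Program, P.cost ≤ 17 * (n + 2) ∧
      |prob ((unif _).bind (real n)) - prob ((unif _).bind (ideal n))| ≤
      |prob (prfReal T F n Fin.val (fun _ k => F n k) P) -
        prob (prfIdeal T F n (Fin.val : Fin (2 ^ n) → ℕ) P)| := by
    intro n
    obtain ⟨v, -, hv⟩ := exists_mem_support_abs_prob_sub_le (unif (Fin (2 ^ n) × Fin (2 ^ n)))
      (real n) (ideal n)
    have hr : ∀ (pp : T.Param n) (chal : ℕ → ℕ) (g : Fin (2 ^ n) → Fin (2 ^ n)),
        (∀ x, chal (Fin.val x) = (g x).val) →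
        Rep (n + 1) (env T F n pp chal) [] (17 * (n + 2)) (collisionExpr v.1.val v.2.val)
          (1 - (((g v.1).val - (g v.2).val) + ((g v.2).val - (g v.1).val))) :=
      fun pp chal g hg => rep_collisionExpr v.1.is_lt v.2.is_lt (g v.1).is_lt (g v.2).is_lt
        (hg v.1) (hg v.2)
    have ho : ∀ (pp : T.Param n) (chal : ℕ → ℕ) (g : Fin (2 ^ n) → Fin (2 ^ n)),
        (∀ x, chal (Fin.val x) = (g x).val) →
        Program.out ((collisionExpr v.1.val v.2.val).compile (n + 1) 0) (env T F n pp chal) [] =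
          PMF.pure (decide (g v.1 = g v.2)) := by
      intro pp chal g hg
      rw [out_compile (hr pp chal g hg)]
      congr 2
      rw [Fin.ext_iff, eq_iff_iff]
      omega
    have hcost : n + 1 ≤ Program.cost ((collisionExpr v.1.val v.2.val).compile (n + 1) 0) := by
      rw [Expr.cost_compile]
      simp only [collisionExpr, Expr.cost]
      omega
    refine ⟨(collisionExpr v.1.val v.2.val).compile (n + 1) 0, ?_, hv.trans_eq ?_⟩
    · obtain ⟨pp, -⟩ := (T.setup n).support_nonempty
      rw [Expr.cost_compile]
      -- The identity serves as oracle, since only the cost of the expression is read off.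
      exact (hr pp (fun x => if h : x < 2 ^ n then x else 0) id fun x => by simp).cost
    · rw [Setting.bind_real_out F n Fin.val (fun _ k => F n k) _ (Fin.val : Fin (2 ^ n) → ℕ)
          (fun _ g => PMF.pure (decide (g v.1 = g v.2))) ho,
        Setting.bind_ideal_out F n Fin.val _ (Fin.val : Fin (2 ^ n) → ℕ) Fin.val_injective
          (fun x => x.is_lt.trans_le (Nat.pow_le_pow_right two_pos (by omega)))
          (fun _ g => PMF.pure (decide (g v.1 = g v.2))) ho]
      rw [PMF.bind_const, PMF.bind_const]
      rfl
  choose P hP hle using key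
  have hadv := (hF ⟨P, (((polyBounded_const 17).mul
    (polyBounded_id.add (polyBounded_const 2)))).mono hP⟩).mono (fun _ => abs_nonneg _) hle
  refine Negligible.mono (hadv.add (negligible_two_pow_inv.const_mul 2))
    (fun n => prob_nonneg _) fun n => ?_
  have hid : prob ((unif _).bind (ideal n)) ≤ 2 * ((2 : ℝ) ^ n)⁻¹ := by
    have h := prob_bind_le_add (unif (Fin (2 ^ n) × Fin (2 ^ n))) (ideal n)
      (fun v => decide (v.1 = id v.2)) (η := ((2 : ℝ) ^ n)⁻¹) (by positivity) (fun v hv => by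
        simp only [ideal]
        rw [prob_random_collision_le v (by simpa using hv)]
        simp)
    rw [prob_pair_eq_le] at h
    simp only [Nat.card_eq_fintype_card, Fintype.card_fin, Nat.cast_pow, Nat.cast_ofNat] at h
    linarith
  have := le_abs_self (prob ((unif _).bind (real n)) - prob ((unif _).bind (ideal n)))
  change prob ((unif _).bind (real n)) ≤ _
  linarith

end Collision

/-! ## Replacing the tags by random ones -/

section Tape

variable {Y : Type} (c : Server) (fc : Y → Y)

/-- The argument of the tag function of the honest server in round `j`, where `x` is its previous
value. -/
def honestInput (s : Server) (j : ℕ) (x : Y) : Y := if s = c ∧ j = 0 then x else fc x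

/-- The initial tag and the successive values of the tag function `g` of the honest server. -/
def honestChain (g : Y → Y) (s : Server) (t : Y) : ℕ → Y
  | 0 => t
  | j + 1 => g (honestInput c fc s j (honestChain g s t j))

/-- Regroups the alternating composition around the values of the honest function. In the share of
`c` a round ends with `fc`, so the current tag is the next argument of `g`; before any round no `fc`
has been applied, which explains the case `j = 0` of `honestInput`. In the other share a round ends
with `g`. -/
theorem preTag_eq (g : Y → Y) (u : ℕ) (s : Server) (t : Y) :
    preTag c fc g u s t =
      if s = c then honestInput c fc s u (honestChain c fc g s t u)
      else honestChain c fc g s t u := by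
  unfold preTag
  split_ifs with h
  · induction u with
    | zero => simp [honestInput, honestChain, h]
    | succ u ih =>
      rw [Function.iterate_succ_apply', ih]
      simp [honestInput, honestChain]
  · induction u with
    | zero => simp [honestChain]
    | succ u ih =>
      rw [Function.iterate_succ_apply', ih]
      simp [honestInput, honestChain, h]

theorem honTag_eq (g : Y → Y) (u : ℕ) (s : Server) (t : Y) :
    honTag c fc g u s t = honestChain c fc g s t (u + 1) := by
  rw [honTag, preTag_eq, honestChain]
  split_ifs with h
  · rfl
  · simp [honestInput, h]

variable {A : Type} (srv : A → Server) (u : ℕ)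

/-- All chains. -/
def chainTape (t : A → Y) (g : Y → Y) : A × Fin (u + 2) → Y :=
  fun x => honestChain c fc g (srv x.1) (t x.1) x.2

/-- All arguments of the tag function of the honest server. -/
def inputs (z : A × Fin (u + 2) → Y) (x : A × Fin (u + 1)) : Y :=
  honestInput c fc (srv x.1) x.2 (z (x.1, x.2.castSucc))

/-- The arguments at which `g` is evaluated can be read off the tape `z` itself. The recursive
condition on `g` thus becomes a prescription of its values at explicitly known points. -/
theorem chainTape_eq_iff (t : A → Y) (g : Y → Y) (z : A × Fin (u + 2) → Y) :
    chainTape c fc srv u t g = z ↔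
      (t = fun a => z (a, 0)) ∧
        (fun x => g (inputs c fc srv u z x)) = fun x : A × Fin (u + 1) => z (x.1, x.2.succ) := by
  constructor
  · rintro rfl
    exact ⟨rfl, rfl⟩
  · rintro ⟨rfl, h⟩
    funext ⟨a, j⟩
    induction j using Fin.induction with
    | zero => rfl
    | succ j ih =>
      rw [← congrFun h (a, j)]
      change g (honestInput c fc (srv a) j _) = g (honestInput c fc (srv a) j _)
      rw [← ih]
      rfl

variable [Finite A] [Finite Y] [Nonempty Y]

/-- The distribution of the chains for random initial tags and a random function. -/
noncomputable def chainDist : PMF (A × Fin (u + 2) → Y) :=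
  (unif (A → Y)).bind fun t => (unif (Y → Y)).map (chainTape c fc srv u t)

/-- Tapes without repeated arguments are as likely as if all values were random. -/
theorem chainDist_apply (z : A × Fin (u + 2) → Y)
    (hz : Function.Injective (inputs c fc srv u z)) :
    chainDist c fc srv u z = unif (A × Fin (u + 2) → Y) z := by
  classical
  -- The initial tags are part of the tape, so exactly one choice of them contributes.
  have h₁ : ∀ t, t ≠ (fun a => z (a, 0)) →
      unif (A → Y) t * ((unif (Y → Y)).map (chainTape c fc srv u t)) z = 0 := by
    intro t ht
    rw [PMF.map_apply, mul_eq_zero, ENNReal.tsum_eq_zero]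
    right
    intro g
    rw [if_neg]
    intro h
    exact ht ((chainTape_eq_iff c fc srv u t g z).1 h.symm).1
  -- The arguments are distinct by hypothesis, so the values of the random function at them are
  -- independent and uniform.
  have h₂ : ((unif (Y → Y)).map (chainTape c fc srv u fun a => z (a, 0))) z =
      unif (A × Fin (u + 1) → Y) fun x => z (x.1, x.2.succ) := by
    rw [← unif_map_comp (R := Y) _ hz, PMF.map_apply, PMF.map_apply]
    refine tsum_congr fun g => ?_
    have := chainTape_eq_iff c fc srv u (fun a => z (a, 0)) g z
    simp only [true_and] at this
    simp only [eq_comm (a := z), this, eq_comm (b := fun x => g (inputs c fc srv u z x))]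
  rw [chainDist, PMF.bind_apply, tsum_eq_single _ h₁, h₂, unif_apply, unif_apply, unif_apply,
    ← ENNReal.mul_inv (.inr (ENNReal.natCast_ne_top _)) (.inl (ENNReal.natCast_ne_top _)),
    ← Nat.cast_mul]
  congr 2
  -- One initial value and `u + 1` function values for each chain account for its `u + 2` cells.
  rw [Nat.card_fun, Nat.card_fun, Nat.card_fun, ← pow_add, Nat.card_prod, Nat.card_prod]
  congr 1
  simp
  ring

end Tape

namespace Setting

variable {T : TPF} (F : KeyedFun) (X : Setting T) (n : ℕ)

abbrev Tape : Type := (Server × Word (X.sz n)) × Fin (X.u n + 2) → Fin (2 ^ n)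

/-- The tags, as a function of the initial tags and all values of the tag function of the honest
server. -/
def tapeTags (κ : Fin (2 ^ n)) (z : X.Tape n) : Tag n (X.sz n) :=
  (fun s w => if s = X.c then
      honestInput X.c (fun x => F n κ x.val) s (X.u n) (z ((s, w), (Fin.last _).castSucc))
    else z ((s, w), (Fin.last _).castSucc),
    fun s w => z ((s, w), Fin.last _))

/-- The tags for independent random values. -/
noncomputable def tagIdeal (κ : Fin (2 ^ n)) : PMF (Tag n (X.sz n)) :=
  (unif (X.Tape n)).map (X.tapeTags F n κ)

theorem tagFun_eq (κ : Fin (2 ^ n)) :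
    X.tagFun F n κ =
      (chainDist X.c (fun x => F n κ x.val) Prod.fst (X.u n)).map (X.tapeTags F n κ) := by
  rw [tagFun, chainDist, PMF.map_bind]
  congr 1
  funext t
  rw [PMF.map_comp, ← PMF.bind_pure_comp]
  congr 1
  funext g
  simp only [Function.comp, tagsOf, preTag_eq, honTag_eq]
  rfl

open Classical in
/-- Some argument of the tag function of the honest server is repeated. -/
noncomputable def repeats (κ : Fin (2 ^ n)) (z : X.Tape n) : Bool :=
  decide ¬ Function.Injective (inputs X.c (fun x : Fin (2 ^ n) => F n κ x.val) Prod.fst (X.u n) z)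

/-- Both tag distributions are images of tapes that are equally likely as long as no argument
repeats. The key `κ` must stay random and cannot be fixed by averaging, because repetitions are rare
only on average over `κ`. -/
theorem game_tagFun_sub_tagIdeal_le (Dl : T.Param n → PMF (Lab T n (X.sz n)))
    (Dk : PMF ((ℕ × ℕ) × Ct (X.sz n))) :
    |prob (X.game F n Dl (X.tagFun F n) Dk) - prob (X.game F n Dl (X.tagIdeal F n) Dk)| ≤
      prob ((unif (Fin (2 ^ n))).bind fun κ => (unif (X.Tape n)).map (X.repeats F n κ)) := by
  obtain ⟨b, -, hb⟩ := exists_mem_support_abs_prob_sub_le (unif Bool) _ _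
  obtain ⟨m, -, hm⟩ := exists_mem_support_abs_prob_sub_le (unif (Misc T n (X.sz n))) _ _
  refine hb.trans (hm.trans (abs_prob_bind_sub_le _ _ _ _ fun κ => ?_))
  rw [tagFun_eq, tagIdeal, PMF.bind_map, PMF.bind_map]
  refine abs_prob_bind_sub_le_of_eq_off _ _ _ (fun z hz => ?_) _
  exact chainDist_apply _ _ _ _ z (by simpa [repeats] using hz)

/-- A bound for the probability that two given arguments agree. -/
noncomputable def pairBound (n : ℕ) : ℝ := collision F n + ((2 : ℝ) ^ n)⁻¹

theorem pairBound_nonneg : 0 ≤ pairBound F n := add_nonneg (prob_nonneg _) (by positivity)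

/-- If one argument is an unprocessed initial tag, it is uniform and independent of the other
argument, which gives `2⁻ⁿ`. Otherwise both are values of `F` under `κ` at independent uniform
points, and equality is a collision. -/
theorem prob_honestInput_eq_le (s s' : Server) (j j' : ℕ) :
    prob ((unif (Fin (2 ^ n))).bind fun κ => (unif (Fin (2 ^ n) × Fin (2 ^ n))).map fun v =>
      decide (honestInput X.c (fun x : Fin (2 ^ n) => F n κ x.val) s j v.1 =
        honestInput X.c (fun x : Fin (2 ^ n) => F n κ x.val) s' j' v.2)) ≤ pairBound F n := by
  have hc : (Nat.card (Fin (2 ^ n)) : ℝ)⁻¹ = ((2 : ℝ) ^ n)⁻¹ := by simp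
  have h₀ : 0 ≤ collision F n := prob_nonneg _
  by_cases h : s = X.c ∧ j = 0
  · refine (prob_bind_le _ _ fun κ => ?_).trans (le_add_of_nonneg_left h₀)
    simp only [honestInput, h, and_self, if_true]
    exact (prob_pair_eq_le fun x : Fin (2 ^ n) =>
      if s' = X.c ∧ j' = 0 then x else F n κ x.val).trans_le hc.le
  by_cases h' : s' = X.c ∧ j' = 0
  · refine (prob_bind_le _ _ fun κ => ?_).trans (le_add_of_nonneg_left h₀)
    simp only [honestInput, h', and_self, if_true]
    rw [← unif_map_equiv (Equiv.prodComm (Fin (2 ^ n)) (Fin (2 ^ n))), PMF.map_comp]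
    simp only [Function.comp_def, Equiv.prodComm_apply, Prod.fst_swap, Prod.snd_swap,
      eq_comm (b := Prod.fst _)]
    exact (prob_pair_eq_le fun x : Fin (2 ^ n) =>
      if s = X.c ∧ j = 0 then x else F n κ x.val).trans_le hc.le
  · refine le_trans (le_of_eq ?_) (le_add_of_nonneg_right (by positivity))
    simp only [honestInput, h, h', if_false, collision, ← PMF.bind_pure_comp, Function.comp_def]
    rw [PMF.bind_comm]

theorem card_word_le : Fintype.card (Word (X.sz n)) ≤ X.W n + X.W n := by
  rw [Fintype.card_sigma]
  simp only [Fintype.card_fin]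
  have : ∑ k : Kind, X.sz n k = X.sz n .pref + X.sz n .keyword := rfl
  rw [this]
  exact add_le_add (X.sz_le n _) (X.sz_le n _)

/-- A union bound over ordered pairs of arguments, with at most `2 * (W + W) * (u + 1)` arguments
for two shares, both indexes and `u + 1` rounds. Distinct arguments are computed from distinct cells
of the tape. -/
theorem prob_repeats_le :
    prob ((unif (Fin (2 ^ n))).bind fun κ => (unif (X.Tape n)).map (X.repeats F n κ)) ≤
      ((2 * (X.W n + X.W n) * (X.u n + 1)) ^ 2 : ℕ) * pairBound F n := by
  classical
  let I := (Server × Word (X.sz n)) × Fin (X.u n + 1)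
  let q : Fin (2 ^ n) → X.Tape n → I → Fin (2 ^ n) := fun κ =>
    inputs X.c (fun x : Fin (2 ^ n) => F n κ x.val) Prod.fst (X.u n)
  have h₁ : ((unif (Fin (2 ^ n))).bind fun κ => (unif (X.Tape n)).map (X.repeats F n κ)) =
      (unif (Fin (2 ^ n) × X.Tape n)).map fun v => X.repeats F n v.1 v.2 := by
    rw [← PMF.bind_pure_comp, unif_prod_bind]
    simp only [← PMF.bind_pure_comp, Function.comp_def]
  rw [h₁]
  refine (prob_map_exists_le (ι := I × I) _ _
    (fun p v => decide (p.1 ≠ p.2 ∧ q v.1 v.2 p.1 = q v.1 v.2 p.2)) fun v hv => ?_).trans ?_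
  · obtain ⟨x, y, hxy, hne⟩ : ∃ x y, q v.1 v.2 x = q v.1 v.2 y ∧ x ≠ y := by
      have hv' := of_decide_eq_true hv
      simp only [Function.Injective, not_forall, exists_prop] at hv'
      exact hv'
    exact ⟨(x, y), by simpa using ⟨hne, hxy⟩⟩
  have h₂ : ∀ p : I × I, prob ((unif (Fin (2 ^ n) × X.Tape n)).map fun v =>
      decide (p.1 ≠ p.2 ∧ q v.1 v.2 p.1 = q v.1 v.2 p.2)) ≤ pairBound F n := by
    rintro ⟨x, y⟩
    by_cases hxy : x = y
    · have : prob ((unif (Fin (2 ^ n) × X.Tape n)).map fun v =>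
          decide (x ≠ y ∧ q v.1 v.2 x = q v.1 v.2 y)) = 0 := by
        rw [prob_map_eq_tsum]
        simp [hxy]
      exact this.trans_le (pairBound_nonneg F n)
    · refine le_trans (le_of_eq ?_) (X.prob_honestInput_eq_le F n x.1.1 y.1.1 x.2 y.2)
      -- Selects the two cells concerned; the restriction of a uniform tape to them is a uniform
      -- pair.
      let i : Bool → (Server × Word (X.sz n)) × Fin (X.u n + 2) := fun b =>
        if b then (y.1, y.2.castSucc) else (x.1, x.2.castSucc)
      have hi : Function.Injective i := by
        intro b b' h
        have hne : (y.1, y.2.castSucc) ≠ (x.1, x.2.castSucc) := fun h =>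
          hxy (Prod.ext (congrArg Prod.fst h).symm
            (Fin.castSucc_injective _ (congrArg Prod.snd h)).symm)
        cases b <;> cases b'
        · rfl
        · exact absurd h.symm hne
        · exact absurd h hne
        · rfl
      rw [← PMF.bind_pure_comp, unif_prod_bind]
      congr 2
      funext κ
      rw [← unif_map_equiv (Equiv.boolArrowEquivProd (Fin (2 ^ n))),
        ← unif_map_comp (R := Fin (2 ^ n)) i hi, PMF.map_comp, PMF.map_comp,
        ← PMF.bind_pure_comp]
      congr 1
      funext z
      simp [hxy, q, inputs, i]
  refine (Finset.sum_le_card_nsmul _ _ _ fun p _ => h₂ p).trans ?_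
  rw [nsmul_eq_mul]
  refine mul_le_mul_of_nonneg_right ?_ (pairBound_nonneg F n)
  rw [Nat.cast_le, Finset.card_univ]
  have hK := X.card_word_le n
  have hS : Fintype.card Server = 2 := rfl
  simp only [I, Fintype.card_prod, Fintype.card_fin, hS]
  rw [sq]
  gcongr

variable {F}

theorem negligible_tagFun_sub_tagIdeal (hF : FSecure T F)
    (Dl : ∀ n, T.Param n → PMF (Lab T n (X.sz n))) (Dk : ∀ n, PMF ((ℕ × ℕ) × Ct (X.sz n))) :
    Negligible fun n => |prob (X.game F n (Dl n) (X.tagFun F n) (Dk n)) -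
      prob (X.game F n (Dl n) (X.tagIdeal F n) (Dk n))| := by
  have hp : PolyBounded fun n => 2 * (X.W n + X.W n) * (X.u n + 1) :=
    ((polyBounded_const 2).mul (X.W_poly.add X.W_poly)).mul (X.u_poly.add (polyBounded_const 1))
  have hp2 : PolyBounded fun n => (2 * (X.W n + X.W n) * (X.u n + 1)) ^ 2 := by
    simp only [sq]
    exact hp.mul hp
  exact (((negligible_collision hF).add negligible_two_pow_inv).poly_mul hp2).mono
    (fun _ => abs_nonneg _) fun n =>
      (X.game_tagFun_sub_tagIdeal_le F n (Dl n) (Dk n)).trans (X.prob_repeats_le F n)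

end Setting

/-! ## Paillier re-encryption -/

/-- An `N`-th power modulo `N ^ 2` depends only on the base modulo `N`, so multiplying ciphertexts
multiplies their randomizers in the unit group. A chain of re-encryptions thus collapses to a single
encryption. -/
theorem turReEnc_turEnc {N : ℕ} (hN : N ≠ 0) (m : ℕ) (r₀ r : (ZMod N)ˣ) :
    turReEnc N (turEnc N m r₀) r = turEnc N m (r₀ * r) := by
  have : NeZero N := ⟨hN⟩
  have h : r₀.val.val * r.val.val ≡ (r₀ * r).val.val [MOD N] := by
    rw [Units.val_mul, ZMod.val_mul]
    exact (Nat.mod_modEq _ _).symm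
  have h₂ : (r₀.val.val * r.val.val) ^ N ≡ (r₀ * r).val.val ^ N [MOD N ^ 2] := by
    rw [Nat.modEq_iff_dvd] at h ⊢
    have := dvd_sub_pow_of_dvd_sub h 1
    push_cast at this ⊢
    simpa using this
  unfold turReEnc turEnc
  rw [pow_zero, one_mul]
  change _ ≡ _ [MOD N ^ 2]
  calc (1 + N) ^ m * r₀.val.val ^ N % N ^ 2 * (r.val.val ^ N % N ^ 2)
      ≡ (1 + N) ^ m * r₀.val.val ^ N * r.val.val ^ N [MOD N ^ 2] :=
        (Nat.mod_modEq _ _).mul (Nat.mod_modEq _ _)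
    _ = (1 + N) ^ m * (r₀.val.val * r.val.val) ^ N := by ring
    _ ≡ (1 + N) ^ m * (r₀ * r).val.val ^ N [MOD N ^ 2] := h₂.mul_left _

theorem turEnc_lt {N : ℕ} (hN : N ≠ 0) (m : ℕ) (r : (ZMod N)ˣ) : turEnc N m r < N ^ 2 :=
  Nat.mod_lt _ (by positivity)

theorem bind_congr_support {α β : Type*} (p : PMF α) {f g : α → PMF β}
    (h : ∀ a ∈ p.support, f a = g a) : p.bind f = p.bind g := by
  ext b
  rw [PMF.bind_apply, PMF.bind_apply]
  refine tsum_congr fun a => ?_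
  by_cases ha : a ∈ p.support
  · rw [h a ha]
  · simp [(PMF.apply_eq_zero_iff p a).2 ha]

theorem turSetup_range {n : ℕ} {pq : ℕ × ℕ} (h : pq ∈ (turSetup n).support) :
    pq.1 * pq.2 ≠ 0 ∧ (pq.1 * pq.2) ^ 4 < 2 ^ (8 * n + 24) := by
  -- Three bits are added to `n` because the fallback primes 5 and 7 are only known to be below 8.
  -- The product of the primes then has at most `2 * n + 6` bits, whence the exponent `8 * n + 24`.
  have key : pq.1 ≠ 0 ∧ pq.2 ≠ 0 ∧ pq.1 < 2 ^ (n + 3) ∧ pq.2 < 2 ^ (n + 3) := by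
    have h8 : 2 ^ (n + 3) = 8 * 2 ^ n := by ring
    have h1 : 1 ≤ 2 ^ n := Nat.one_le_two_pow
    unfold turSetup at h
    split_ifs at h with hne
    · simp only [PMF.mem_support_uniformOfFinset_iff, primePairs, Finset.mem_filter,
        Finset.mem_product, Finset.mem_range] at h
      obtain ⟨⟨h₁, h₂⟩, -, -, hp, hq, -⟩ := h
      exact ⟨hp.ne_zero, hq.ne_zero, by omega, by omega⟩
    · simp only [PMF.support_pure, Set.mem_singleton_iff] at h
      subst h
      refine ⟨by norm_num, by norm_num, ?_, ?_⟩ <;> simp only <;> omega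
  obtain ⟨h₁, h₂, h₃, h₄⟩ := key
  refine ⟨mul_ne_zero h₁ h₂, ?_⟩
  calc (pq.1 * pq.2) ^ 4 < (2 ^ (n + 3) * 2 ^ (n + 3)) ^ 4 :=
        Nat.pow_lt_pow_left (Nat.mul_lt_mul'' h₃ h₄) (by norm_num)
    _ = 2 ^ (8 * n + 24) := by ring

/-- The public key and the partial decryption key of `c`. -/
noncomputable def keyDist (S : KeySplit) (n : ℕ) (c : Server) : PMF (ℕ × ℕ) :=
  (turSetup n).bind fun pq => (S.keyGen n pq.1 pq.2).map fun pdk => (pq.1 * pq.2, pdk c)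

theorem keyDist_range {S : KeySplit} {n : ℕ} {c : Server} {key : ℕ × ℕ}
    (h : key ∈ (keyDist S n c).support) :
    key.1 ≠ 0 ∧ key.1 ^ 4 < 2 ^ (8 * n + 24) ∧ key.2 < 2 ^ S.len n := by
  rw [keyDist, PMF.mem_support_bind_iff] at h
  obtain ⟨pq, hpq, h⟩ := h
  rw [PMF.mem_support_map_iff] at h
  obtain ⟨pdk, hpdk, rfl⟩ := h
  exact ⟨(turSetup_range hpq).1, (turSetup_range hpq).2,
    Nat.size_le.1 (S.pdk_size n pq hpq pdk hpdk c)⟩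

/-! ## Sampling units -/

theorem run_sampleUnits (E : Env) (W N : ℕ) (hN : N ≠ 0) (hW : N < 2 ^ W) (M : ℕ)
    (l : List ℕ) :
    Program.run E (List.replicate M (.sampleUnit W 0)) (N :: l) =
      (unif (Fin M → (ZMod N)ˣ)).map fun ρ => (N :: l) ++ List.ofFn fun j => (ρ j).val.val := by
  have : NeZero N := ⟨hN⟩
  induction M generalizing l with
  | zero =>
    simp only [List.replicate_zero, Program.run, List.ofFn_zero, List.append_nil]
    exact (PMF.map_const _ _).symm
  | succ M ih =>
    rw [List.replicate_succ, Program.run]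
    have h₁ : Instr.eval E (N :: l) (.sampleUnit W 0) =
        (unif (ZMod N)ˣ).map fun x => x.val.val := by
      change ((unif (ZMod N)ˣ).map fun x => x.val.val % 2 ^ W) = _
      congr 1
      funext x
      exact Nat.mod_eq_of_lt ((ZMod.val_lt _).trans hW)
    rw [h₁, PMF.bind_map, ← unif_map_equiv (Fin.consEquiv fun _ : Fin (M + 1) => (ZMod N)ˣ),
      PMF.map_comp, ← PMF.bind_pure_comp, unif_prod_bind]
    congr 1
    funext x
    rw [Function.comp, List.cons_append, ih, ← PMF.bind_pure_comp]
    congr 1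
    funext ρ
    simp [Fin.consEquiv, List.ofFn_succ]

/-- Overwriting one coordinate of a uniform vector by a fresh uniform value is a surjective
homomorphism, so the result is again uniform. This inserts the linking challenge among the sampled
ciphertexts. -/
theorem unif_bind_update {ι G : Type} {γ : Type*} [Finite ι] [DecidableEq ι] [Group G] [Finite G]
    (i : ι) (f : (ι → G) → PMF γ) :
    ((unif G).bind fun ρ => (unif (ι → G)).bind fun R => f (Function.update R i ρ)) =
      (unif (ι → G)).bind f := by
  rw [← unif_prod_bind (fun x : G × (ι → G) => f (Function.update x.2 i x.1))]
  refine unif_bind_of_map (g := fun x : G × (ι → G) => Function.update x.2 i x.1)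
    (unif_map_hom (G := G × (ι → G)) (H := ι → G)
      { toFun := fun x => Function.update x.2 i x.1
        map_one' := Function.update_eq_self i 1
        map_mul' := fun x y => Function.update_mul x.2 y.2 i x.1 y.1 } fun R => ?_) f
  exact ⟨(R i, R), Function.update_eq_self i R⟩

/-- Encryption, as an expression. -/
def encExpr (N : Expr) (m : ℕ) (r : Expr) : Expr :=
  .arith .mod (.arith .mul (.powMod (.arith .add (.const 1) N) (.const m) (.arith .mul N N))
    (.powMod r N (.arith .mul N N))) (.arith .mul N N)

/-- The two powers are reduced separately before they are multiplied. They take 8 and 6 units, the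
product one more, and the final reduction four, including a recomputation of `N ^ 2`. -/
theorem rep_encExpr {W N m : ℕ} {E : Env} {base : List ℕ} {eN er : Expr} (hN : N ≠ 0)
    (hN4 : N ^ 4 < 2 ^ W) (hN1 : 1 + N < 2 ^ W) (hm : m < 2 ^ W) {r : (ZMod N)ˣ}
    (heN : Rep W E base (W + 1) eN N) (her : Rep W E base (W + 1) er r.val.val) :
    Rep W E base (19 * (W + 1)) (encExpr eN m er) (turEnc N m r) := by
  have hN2 : 0 < N ^ 2 := by positivity
  have hN24 : N ^ 2 < 2 ^ W :=
    (Nat.pow_le_pow_right (Nat.pos_of_ne_zero hN) (by norm_num)).trans_lt hN4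
  have hsq : Rep W E base (3 * (W + 1)) (.arith .mul eN eN) (N ^ 2) :=
    (Rep.arith .mul heN heN (by simp [Arith.eval, sq]) hN24).mono (by omega)
  have h1 : Rep W E base (3 * (W + 1)) (.arith .add (.const 1) eN) (1 + N) :=
    (Rep.arith .add (Rep.const (by omega)) heN rfl hN1).mono (by omega)
  have hlt : ∀ x, x % N ^ 2 < 2 ^ W := fun x => (Nat.mod_lt _ hN2).trans hN24
  refine (Rep.arith .mod (Rep.arith .mul (Rep.powMod h1 (Rep.const hm) hsq rfl (hlt _))
    (Rep.powMod her heN hsq rfl (hlt _)) rfl ?_) hsq ?_ (hlt _)).mono (by omega)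
  · refine lt_of_lt_of_le (Nat.mul_lt_mul'' (Nat.mod_lt _ hN2) (Nat.mod_lt _ hN2)) ?_
    calc N ^ 2 * N ^ 2 = N ^ 4 := by ring
      _ ≤ _ := hN4.le
  · simp only [Arith.eval]
    exact (Nat.mul_mod _ _ _).symm

/-! ## Replacing the ciphertexts -/

namespace Setting

variable {T : TPF} (F : KeyedFun) (X : Setting T) (n : ℕ)

/-- The ciphertexts for given plaintexts and randomizers; the last component of the randomizers
belongs to the corrupted server. -/
def ctOf (m₁ m₂ : Server → Word (X.sz n) → ℕ) (N : ℕ)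
    (R : Fin 3 × Server × Word (X.sz n) → (ZMod N)ˣ) : Ct (X.sz n) :=
  (fun s w => turEnc N (m₁ s w) (R (0, s, w)), fun s w => turEnc N (m₂ s w) (R (1, s, w)),
    fun s w => (R (2, s, w)).val.val)

/-- Keys and ciphertexts for given plaintexts. -/
noncomputable def kcDist (S : KeySplit) (m₁ m₂ : Server → Word (X.sz n) → ℕ) :
    PMF ((ℕ × ℕ) × Ct (X.sz n)) :=
  (keyDist S n X.c).bind fun key => (unif _).map fun R => (key, X.ctOf n m₁ m₂ key.1 R)

theorem inRange_of_key {S : KeySplit} (hW : 8 * n + 24 + S.len n ≤ X.W n) {key : ℕ × ℕ}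
    (hkey : key ∈ (keyDist S n X.c).support) {ct : Ct (X.sz n)}
    (h₁ : ∀ s w, ct.1 s w < key.1 ^ 2) (h₂ : ∀ s w, ct.2.1 s w < key.1 ^ 2)
    (h₃ : ∀ s w, ct.2.2 s w < key.1) : InRange (X.W n) (key, ct) := by
  obtain ⟨k₁, k₂, k₃⟩ := keyDist_range hkey
  have hN4 : key.1 ^ 4 < 2 ^ X.W n := k₂.trans_le (Nat.pow_le_pow_right two_pos (by omega))
  exact ⟨k₁, hN4, k₃.trans_le (Nat.pow_le_pow_right two_pos (by omega)), h₁, h₂,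
    fun s w => (h₃ s w).trans ((Nat.le_self_pow (by norm_num) _).trans_lt hN4)⟩

theorem inRange_kcDist {S : KeySplit} (hW : 8 * n + 24 + S.len n ≤ X.W n)
    (m₁ m₂ : Server → Word (X.sz n) → ℕ) :
    ∀ kc ∈ (X.kcDist n S m₁ m₂).support, InRange (X.W n) kc := by
  intro kc h
  rw [kcDist, PMF.mem_support_bind_iff] at h
  obtain ⟨key, hkey, h⟩ := h
  rw [PMF.mem_support_map_iff] at h
  obtain ⟨R, -, rfl⟩ := h
  have hN := (keyDist_range hkey).1
  have : NeZero key.1 := ⟨hN⟩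
  exact X.inRange_of_key n hW hkey (fun s w => turEnc_lt hN _ _) (fun s w => turEnc_lt hN _ _)
    fun s w => ZMod.val_lt _

/-- The number of sampled randomizers. -/
def numUnits : ℕ := Fintype.card (Fin 3 × Server × Word (X.sz n))

noncomputable def unitEquiv : Fin 3 × Server × Word (X.sz n) ≃ Fin (X.numUnits n) :=
  Fintype.equivFin _

/-- The register of a sampled randomizer. -/
noncomputable def unitReg (i : Fin 3 × Server × Word (X.sz n)) : Expr :=
  .reg (5 + (X.unitEquiv n i).val)

/-- The linking adversary: it samples all randomizers, and uses the challenge as the ciphertext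
of the entry `x` after the refresh by the honest server. -/
noncomputable def linkProg (m₁ m₂ : Server → Word (X.sz n) → ℕ) (x : Server × Word (X.sz n))
    (b : Bool) (m : Misc T n (X.sz n)) (κ : Fin (2 ^ n)) (lab : Lab T n (X.sz n))
    (tag : Tag n (X.sz n)) : Program :=
  List.replicate (X.numUnits n) (.sampleUnit (X.W n) 0) ++
    X.reduction n (5 + X.numUnits n) b m κ
      (fun w => .const (T.enc n (lab.1 w))) (fun w => .const (T.enc n (lab.2 w)))
      (fun s w => .const (tag.1 s w).val) (fun s w => .const (tag.2 s w).val) (.reg 0) (.reg 1)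
      (fun s w => encExpr (.reg 0) (m₁ s w) (X.unitReg n (0, s, w)))
      (fun s w => if (s, w) = x then .reg 4
        else encExpr (.reg 0) (m₂ s w) (X.unitReg n (1, s, w)))
      (fun s w => X.unitReg n (2, s, w))

/-- The ciphertexts, where that of `x` after the refresh by the honest server is `C`. -/
def ctWith (m₁ m₂ : Server → Word (X.sz n) → ℕ) (x : Server × Word (X.sz n)) (N C : ℕ)
    (R : Fin 3 × Server × Word (X.sz n) → (ZMod N)ˣ) : Ct (X.sz n) :=
  (fun s w => turEnc N (m₁ s w) (R (0, s, w)),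
    fun s w => if (s, w) = x then C else turEnc N (m₂ s w) (R (1, s, w)),
    fun s w => (R (2, s, w)).val.val)

section

variable {n} {m₁ m₂ : Server → Word (X.sz n) → ℕ} {x : Server × Word (X.sz n)} {b : Bool}
  {m : Misc T n (X.sz n)} {κ : Fin (2 ^ n)} {lab : Lab T n (X.sz n)} {tag : Tag n (X.sz n)}

theorem represents_link (hW : 2 ≤ X.W n) (hm₁ : ∀ s w, m₁ s w < 2 ^ X.W n)
    (hm₂ : ∀ s w, m₂ s w < 2 ^ X.W n)
    (pp : T.Param n) (chal : ℕ → ℕ) {N pdk C₀ C₁ C : ℕ}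
    {R : Fin 3 × Server × Word (X.sz n) → (ZMod N)ˣ} (hC : C < N ^ 2)
    (h : InRange (X.W n) ((N, pdk), X.ctWith n m₁ m₂ x N C R)) :
    X.Represents F pp chal ([N, pdk, C₀, C₁, C] ++
        List.ofFn fun j : Fin (X.numUnits n) => (R ((X.unitEquiv n).symm j)).val.val)
      lab tag ((N, pdk), X.ctWith n m₁ m₂ x N C R)
      (fun w => .const (T.enc n (lab.1 w))) (fun w => .const (T.enc n (lab.2 w)))
      (fun s w => .const (tag.1 s w).val) (fun s w => .const (tag.2 s w).val) (.reg 0) (.reg 1)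
      (fun s w => encExpr (.reg 0) (m₁ s w) (X.unitReg n (0, s, w)))
      (fun s w => if (s, w) = x then .reg 4
        else encExpr (.reg 0) (m₂ s w) (X.unitReg n (1, s, w)))
      (fun s w => X.unitReg n (2, s, w)) := by
  have hN0 : N ≠ 0 := h.N_ne
  have : NeZero N := ⟨hN0⟩
  have hN4 : N ^ 4 < 2 ^ X.W n := h.N4
  have hNlt : N < 2 ^ X.W n := h.N_lt
  -- The bound on `N ^ 4` controls `1 + N` only from `N = 2` on; `N = 1` uses that the width is at
  -- least 2.
  have hN1 : 1 + N < 2 ^ X.W n := by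
    have h4 : 2 ^ 2 ≤ 2 ^ X.W n := Nat.pow_le_pow_right two_pos hW
    by_cases hN : N = 1
    · omega
    · have : 2 ≤ N := by omega
      nlinarith [Nat.pow_le_pow_left this 3]
  have hb : X.W n + 1 ≤ X.budget n := by simpa using X.le_budget (n := n) (k := 1) (by omega)
  have rN : ∀ l, Rep (X.W n) (env T F n pp chal) ([N, pdk, C₀, C₁, C] ++ l) (X.W n + 1)
      (.reg 0) N := fun l => Rep.reg (by simp) rfl hNlt
  have ru : ∀ i, Rep (X.W n) (env T F n pp chal) ([N, pdk, C₀, C₁, C] ++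
      List.ofFn fun j : Fin (X.numUnits n) => (R ((X.unitEquiv n).symm j)).val.val)
      (X.W n + 1) (X.unitReg n i) (R i).val.val := fun i =>
    Rep.reg (by rw [List.length_append, List.length_ofFn]; exact Nat.add_lt_add_left (Fin.is_lt _) 5) (by
      rw [show 5 = [N, pdk, C₀, C₁, C].length from rfl, reg_append_right]
      simp [reg]) ((ZMod.val_lt _).trans hNlt)
  refine ⟨fun w => X.rep_const F (T.enc_lt (X.len_le n) _),
    fun w => X.rep_const F (T.enc_lt (X.len_le n) _), fun s w => X.rep_const F (X.fin_lt _),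
    fun s w => X.rep_const F (X.fin_lt _), (rN _).mono hb,
    (Rep.reg (by simp) rfl h.pdk).mono hb,
    fun s w => (rep_encExpr hN0 hN4 hN1 (hm₁ s w) (rN _) (ru _)).mono (X.le_budget (by omega)),
    fun s w => ?_, fun s w => (ru _).mono hb⟩
  simp only [ctWith]
  split_ifs
  · exact (Rep.reg (by simp) rfl (hC.trans h.sq_lt)).mono hb
  · exact (rep_encExpr hN0 hN4 hN1 (hm₂ s w) (rN _) (ru _)).mono (X.le_budget (by omega))

/-- Sampling appends the randomizers directly behind the five inputs, where `unitReg` looks for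
them. The remaining program is deterministic up to its call of the shuffle adversary, so the outcome
is that adversary on a view with uniform randomizers and the challenge at the entry `x`. -/
theorem out_linkProg (hW : 2 ≤ X.W n) (hm₁ : ∀ s w, m₁ s w < 2 ^ X.W n)
    (hm₂ : ∀ s w, m₂ s w < 2 ^ X.W n)
    (pp : T.Param n) (chal : ℕ → ℕ) {N pdk C₀ C₁ C : ℕ} (hC : C < N ^ 2)
    (h : ∀ R, InRange (X.W n) ((N, pdk), X.ctWith n m₁ m₂ x N C R)) :
    (X.linkProg n m₁ m₂ x b m κ lab tag).out (env T F n pp chal) [N, pdk, C₀, C₁, C] =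
      (unif (Fin 3 × Server × Word (X.sz n) → (ZMod N)ˣ)).bind fun R =>
        X.play F n b m κ tag ((N, pdk), X.ctWith n m₁ m₂ x N C R) pp lab := by
  have hN := (h 1).N_ne
  rw [linkProg, Program.out, Program.run_append,
    run_sampleUnits _ _ N hN (h 1).N_lt, PMF.bind_map, PMF.map_bind,
    ← unif_bind_equiv (Equiv.arrowCongr (X.unitEquiv n) (Equiv.refl (ZMod N)ˣ))]
  congr 1
  funext R
  have ho := X.out_reduction F (b := b) (m := m) (κ := κ) (h R)
    (X.represents_link F (lab := lab) (tag := tag) (C₀ := C₀) (C₁ := C₁) hW hm₁ hm₂ pp chal hC (h R))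
  rw [← ho, Program.out]
  simp [Function.comp_def, Nat.add_comm 5]

theorem cost_linkProg_le (hW : 2 ≤ X.W n) (hm₁ : ∀ s w, m₁ s w < 2 ^ X.W n)
    (hm₂ : ∀ s w, m₂ s w < 2 ^ X.W n)
    {N pdk C : ℕ} (hC : C < N ^ 2)
    {R : Fin 3 × Server × Word (X.sz n) → (ZMod N)ˣ}
    (h : InRange (X.W n) ((N, pdk), X.ctWith n m₁ m₂ x N C R)) :
    (X.linkProg n m₁ m₂ x b m κ lab tag).cost ≤
      3 * (2 * (X.W n + X.W n)) * (1 + X.W n) + X.bound n := by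
  obtain ⟨pp, -⟩ := (T.setup n).support_nonempty
  rw [linkProg, Program.cost_append]
  refine add_le_add ?_ (X.cost_reduction_le default h
    (X.represents_link default (C₀ := 0) (C₁ := 0) hW hm₁ hm₂ pp (fun _ => 0) hC h) _)
  have hM : X.numUnits n ≤ 3 * (2 * (X.W n + X.W n)) := by
    have hS : Fintype.card Server = 2 := rfl
    simp only [numUnits, Fintype.card_prod, Fintype.card_fin, hS]
    gcongr
    exact X.card_word_le n
  simp only [Program.cost, List.map_replicate, List.sum_replicate, Instr.cost, smul_eq_mul]
  gcongr

end

end Setting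

theorem linkExp_eq (T : TPF) (F : KeyedFun) (S : KeySplit) (n : ℕ) (c : Server) (m₀ m₁ : ℕ)
    (A : Program) :
    linkExp T F S n c m₀ m₁ A =
      (T.setup n).bind fun pp => (turSetup n).bind fun pq =>
        (S.keyGen n pq.1 pq.2).bind fun pdk =>
        (unif (ZMod (pq.1 * pq.2))ˣ).bind fun r₀ => (unif (ZMod (pq.1 * pq.2))ˣ).bind fun r₁ =>
        (unif (ZMod (pq.1 * pq.2))ˣ).bind fun r => (unif Bool).bind fun b =>
          (A.out (env T F n pp fun _ => 0)
            [pq.1 * pq.2, pdk c, turEnc (pq.1 * pq.2) m₀ r₀, turEnc (pq.1 * pq.2) m₁ r₁,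
              turReEnc (pq.1 * pq.2) (if b then turEnc (pq.1 * pq.2) m₁ r₁
                else turEnc (pq.1 * pq.2) m₀ r₀) r]).map (· == b) :=
  rfl

/-- The linking experiment of a program that only uses the keys and the challenge. -/
theorem prob_linkExp (T : TPF) (F : KeyedFun) (S : KeySplit) (n : ℕ) (c : Server) (m₀ m₁ : ℕ)
    (A : Program) (f : T.Param n → ℕ × ℕ → ℕ → PMF Bool)
    (h : ∀ pp, ∀ key ∈ (keyDist S n c).support, ∀ C₀ C₁ m r,
      A.out (env T F n pp fun _ => 0) [key.1, key.2, C₀, C₁, turEnc key.1 m r] =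
        f pp key (turEnc key.1 m r)) :
    prob (linkExp T F S n c m₀ m₁ A) =
      (prob ((T.setup n).bind fun pp => (keyDist S n c).bind fun key =>
          (unif (ZMod key.1)ˣ).bind fun r => f pp key (turEnc key.1 m₁ r)) +
        (1 - prob ((T.setup n).bind fun pp => (keyDist S n c).bind fun key =>
          (unif (ZMod key.1)ˣ).bind fun r => f pp key (turEnc key.1 m₀ r)))) / 2 := by
  have h₁ : linkExp T F S n c m₀ m₁ A = (unif Bool).bind fun b =>
      ((T.setup n).bind fun pp => (keyDist S n c).bind fun key =>
        (unif (ZMod key.1)ˣ).bind fun r =>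
          f pp key (turEnc key.1 (if b then m₁ else m₀) r)).map (· == b) := by
    rw [linkExp_eq]
    simp only [PMF.bind_comm _ (unif Bool)]
    congr 1
    funext b
    simp only [PMF.map_bind, keyDist, PMF.bind_bind, PMF.bind_map, Function.comp_def]
    congr 1
    funext pp
    refine bind_congr_support _ fun pq hpq => bind_congr_support _ fun pdk hpdk => ?_
    have hN := (turSetup_range hpq).1
    have hkey : (pq.1 * pq.2, pdk c) ∈ (keyDist S n c).support := by
      rw [keyDist, PMF.mem_support_bind_iff]
      exact ⟨pq, hpq, (PMF.mem_support_map_iff _ _ _).2 ⟨pdk, hpdk, rfl⟩⟩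
    cases b
    · simp only [Bool.false_eq_true, if_false, turReEnc_turEnc hN]
      simp only [h pp _ hkey, PMF.bind_const]
      -- For each fixed `r₀`, multiplication by it permutes the units. The challenge is therefore a
      -- fresh encryption, independent of the original ciphertexts.
      have := fun r₀ : (ZMod (pq.1 * pq.2))ˣ => unif_bind_equiv (Equiv.mulLeft r₀) fun r =>
        (f pp (pq.1 * pq.2, pdk c) (turEnc (pq.1 * pq.2) m₀ r)).map (· == false)
      simp only [Equiv.coe_mulLeft] at this
      simp only [this, PMF.bind_const]
    · simp only [if_true, turReEnc_turEnc hN]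
      simp only [h pp _ hkey, PMF.bind_const]
      have := fun r₀ : (ZMod (pq.1 * pq.2))ˣ => unif_bind_equiv (Equiv.mulLeft r₀) fun r =>
        (f pp (pq.1 * pq.2, pdk c) (turEnc (pq.1 * pq.2) m₁ r)).map (· == true)
      simp only [Equiv.coe_mulLeft] at this
      simp only [this, PMF.bind_const]
  have ht : (fun x : Bool => x == true) = id := by funext x; cases x <;> rfl
  have hf : (fun x : Bool => x == false) = not := by funext x; cases x <;> rfl
  rw [h₁, prob_unif_bool_bind, ht, hf, prob_map_not, PMF.map_id]
  simp

namespace Setting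

variable {T : TPF} {F : KeyedFun} (X : Setting T)

/-- The randomizer of the challenge takes the place of the coordinate `(1, x)`, which the program
samples but does not use. The plaintext inside the challenge alone decides which ciphertext
distribution results. -/
theorem bind_kcDist (S : KeySplit) (n : ℕ) (m₁ m₂ m₂' : Server → Word (X.sz n) → ℕ)
    (x : Server × Word (X.sz n)) (hx : ∀ s w, (s, w) ≠ x → m₂' s w = m₂ s w)
    (f : (ℕ × ℕ) × Ct (X.sz n) → PMF Bool) :
    ((keyDist S n X.c).bind fun key => (unif (ZMod key.1)ˣ).bind fun r => (unif _).bind fun R =>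
      f (key, X.ctWith n m₁ m₂ x key.1 (turEnc key.1 (m₂' x.1 x.2) r) R)) =
      (X.kcDist n S m₁ m₂').bind f := by
  rw [kcDist, PMF.bind_bind]
  congr 1
  funext key
  rw [PMF.bind_map, ← unif_bind_update (1, x)]
  congr 1
  funext r
  congr 1
  funext R
  simp only [Function.comp]
  congr 2
  simp only [ctWith, ctOf, Prod.mk.injEq]
  refine ⟨?_, ?_, ?_⟩
  · funext s w
    rw [Function.update_of_ne (by simp)]
  · funext s w
    split_ifs with h
    · subst h
      rw [Function.update_self]
    · rw [Function.update_of_ne (by simpa using h), hx s w h]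
  · funext s w
    rw [Function.update_of_ne (by simp)]

/-- The linking success is one half plus half the signed difference of the two games. Unlinkability
bounds it from above only, so it is applied to both orders of the plaintexts to control the absolute
value. -/
theorem negligible_kcDist_sub_kcDist {S : KeySplit} (hS : TURUnlinkable T F S)
    (hW : ∀ n, 8 * n + 24 + S.len n ≤ X.W n) (L : ∀ n, PMF (Lab T n (X.sz n)))
    (Dt : ∀ n, Fin (2 ^ n) → PMF (Tag n (X.sz n)))
    (m₁ m₂ m₂' : ∀ n, Server → Word (X.sz n) → ℕ) (h₁ : ∀ n s w, m₁ n s w < 2 ^ X.W n)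
    (h₂ : ∀ n s w, m₂ n s w < 2 ^ X.W n) (h₂' : ∀ n s w, m₂' n s w < 2 ^ X.W n)
    (x : ∀ n, Server × Word (X.sz n)) (hx : ∀ n s w, (s, w) ≠ x n → m₂' n s w = m₂ n s w) :
    Negligible fun n =>
      |prob (X.game F n (fun _ => L n) (Dt n) (X.kcDist n S (m₁ n) (m₂ n))) -
        prob (X.game F n (fun _ => L n) (Dt n) (X.kcDist n S (m₁ n) (m₂' n)))| := by
  choose b m κ lab tag hle using fun n => X.exists_game_sub_le_ct F n (L n) (Dt n)
    (X.kcDist n S (m₁ n) (m₂ n)) (X.kcDist n S (m₁ n) (m₂' n))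
  let P : ℕ → Program := fun n =>
    X.linkProg n (m₁ n) (m₂ n) (x n) (b n) (m n) (κ n) (lab n) (tag n)
  have hW2 : ∀ n, 2 ≤ X.W n := fun n => by have := hW n; omega
  have hin : ∀ n, ∀ key ∈ (keyDist S n X.c).support, ∀ mC r R, InRange (X.W n)
      (key, X.ctWith n (m₁ n) (m₂ n) (x n) key.1 (turEnc key.1 mC r) R) := by
    intro n key hkey mC r R
    have hN := (keyDist_range hkey).1
    have : NeZero key.1 := ⟨hN⟩
    refine X.inRange_of_key n (hW n) hkey (fun s w => turEnc_lt hN _ _) (fun s w => ?_)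
      fun s w => ZMod.val_lt _
    simp only [ctWith]
    split_ifs
    · exact turEnc_lt hN _ _
    · exact turEnc_lt hN _ _
  have hP : PolyBounded fun n => (P n).cost := by
    have hp : PolyBounded fun n => 3 * (2 * (X.W n + X.W n)) * (1 + X.W n) + X.bound n :=
      (((polyBounded_const 3).mul ((polyBounded_const 2).mul (X.W_poly.add X.W_poly))).mul
        ((polyBounded_const 1).add X.W_poly)).add X.polyBounded_bound
    refine hp.mono fun n => ?_
    -- The cost of the program does not depend on keys or randomizers, so any instance in range
    -- yields the bound.
    obtain ⟨key, hkey⟩ := (keyDist S n X.c).support_nonempty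
    exact X.cost_linkProg_le (hW2 n) (h₁ n) (h₂ n)
      (turEnc_lt (keyDist_range hkey).1 0 1) (hin n key hkey 0 1 1)
  let D : ∀ n, (Server → Word (X.sz n) → ℕ) → ℝ := fun n μ =>
    prob ((T.setup n).bind fun pp => (X.kcDist n S (m₁ n) μ).bind fun kc =>
      X.play F n (b n) (m n) (κ n) (tag n) kc pp (lab n))
  have hlink : ∀ n, ∀ μ μ' : Server → Word (X.sz n) → ℕ,
      (∀ s w, (s, w) ≠ x n → μ s w = m₂ n s w) → (∀ s w, (s, w) ≠ x n → μ' s w = m₂ n s w) →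
      prob (linkExp T F S n X.c (μ (x n).1 (x n).2) (μ' (x n).1 (x n).2) (P n)) =
        (D n μ' + (1 - D n μ)) / 2 := by
    intro n μ μ' hμ hμ'
    rw [prob_linkExp T F S n X.c _ _ (P n) (fun pp key C => (unif _).bind fun R =>
      X.play F n (b n) (m n) (κ n) (tag n)
        (key, X.ctWith n (m₁ n) (m₂ n) (x n) key.1 C R) pp (lab n))
      fun pp key hkey C₀ C₁ mC r => X.out_linkProg F (hW2 n) (h₁ n) (h₂ n) pp _
        (turEnc_lt (keyDist_range hkey).1 _ _) (hin n key hkey mC r)]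
    have e : ∀ ν : Server → Word (X.sz n) → ℕ, (∀ s w, (s, w) ≠ x n → ν s w = m₂ n s w) →
        ∀ pp, _ = _ := fun ν hν pp => X.bind_kcDist S n (m₁ n) (m₂ n) ν (x n) hν
      fun kc => X.play F n (b n) (m n) (κ n) (tag n) kc pp (lab n)
    simp only [D, ← e μ hμ, ← e μ' hμ']
  have hs : ∀ μ : ∀ n, Server → Word (X.sz n) → ℕ, (∀ n s w, μ n s w < 2 ^ X.W n) →
      PolyBounded fun n => (μ n (x n).1 (x n).2).size := fun μ hμ =>
    X.W_poly.mono fun n => Nat.size_le.2 (hμ n _ _)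
  obtain ⟨ε, hε, hle₁⟩ := hS X.c (fun n => m₂ n (x n).1 (x n).2)
    (fun n => m₂' n (x n).1 (x n).2) (hs m₂ h₂) (hs m₂' h₂') ⟨P, hP⟩
  obtain ⟨ε', hε', hle₂⟩ := hS X.c (fun n => m₂' n (x n).1 (x n).2)
    (fun n => m₂ n (x n).1 (x n).2) (hs m₂' h₂') (hs m₂ h₂) ⟨P, hP⟩
  refine ((hε.abs.add hε'.abs).const_mul 2).mono (fun _ => abs_nonneg _) fun n =>
    (hle n).trans ?_
  have e₁ := hle₁ n
  have e₂ := hle₂ n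
  simp only [hlink n (m₂ n) (m₂' n) (fun _ _ _ => rfl) (hx n)] at e₁
  simp only [hlink n (m₂' n) (m₂ n) (hx n) fun _ _ _ => rfl] at e₂
  change |D n (m₂ n) - D n (m₂' n)| ≤ _
  have a₁ := le_abs_self (ε n)
  have a₂ := le_abs_self (ε' n)
  have b₁ := abs_nonneg (ε n)
  have b₂ := abs_nonneg (ε' n)
  rw [abs_sub_le_iff]
  constructor <;> linarith

end Setting

/-! ## The symmetric game -/

theorem bind_eq_bind_of_map_eq {α : Type*} {β : Type*} {p : PMF α} {φ : α → α} (h : p.map φ = p)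
    {f g : α → PMF β} (hfg : ∀ a, f (φ a) = g a) : p.bind f = p.bind g := by
  conv_lhs => rw [← h, PMF.bind_map]
  exact congrArg _ (funext hfg)

section Symmetry

variable {sz : Kind → ℕ} (σ : ∀ k, Equiv.Perm (Fin (sz k)))

/-- The permutation of all words given by a permutation of each index. -/
def permWord : Equiv.Perm (Word sz) := Equiv.sigmaCongrRight σ

/-- The leaves with the entries after the refresh by the honest server permuted. -/
def Leaves.permHon {X : Type} (V : Leaves X sz) : Leaves X sz :=
  { V with hon := fun s w => V.hon s (permWord σ w) }

/-- The permutations of the honest server that undo `Leaves.permHon`. -/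
def conjPerms (c : Server) (πc πd : Perms sz) : Perms sz := fun s k =>
  if s = c then (πd s k).trans (σ k)
  else (πd s k).trans ((πc s k).trans ((σ k).trans (πc s k).symm))

/-- Refreshed entries enter the lists only through the honest permutation: directly in the share of
`c`, and after `πc` in the other share, where `σ` must be conjugated by `πc`. The randomizers of `c`
are indexed by positions in the list it receives and stay in place. Since `σ` exchanges the
challenge entries, flipping the bit keeps the final position. -/
theorem viewOf_permHon {X : Type} (c : Server) (cref : Triple X → X → Triple X) (lit : ℕ → X)
    (V : Leaves X sz) (πc πd : Perms sz) (tg : Target sz) (b : Bool)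
    (h : ∀ b : Bool, σ tg.k (if b then tg.i₁ else tg.i₀) = if !b then tg.i₁ else tg.i₀) :
    viewOf c cref lit (V.permHon σ) πc πd tg b =
      viewOf c cref lit V πc (conjPerms σ c πc πd) tg (!b) := by
  have hmid : midList c cref (V.permHon σ) πc πd =
      midList c cref V πc (conjPerms σ c πc πd) := by
    funext s k j
    unfold midList conjPerms
    split_ifs with hs
    · rfl
    · rfl
  have hpost : postList c cref (V.permHon σ) πc πd =
      postList c cref V πc (conjPerms σ c πc πd) := by
    funext s k j
    unfold postList conjPerms
    split_ifs with hs
    · rfl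
    · simp [Leaves.permHon, permWord]
  have hpos : tg.pos c πc πd b = tg.pos c πc (conjPerms σ c πc πd) (!b) := by
    unfold Target.pos conjPerms
    rw [← h b]
    split_ifs with hs <;> simp
  simp only [viewOf, viewPart, hmid, hpost, hpos]
  rfl

end Symmetry

namespace Setting

variable {T : TPF} (F : KeyedFun) (X : Setting T) (n : ℕ)
  (σ : ∀ k, Equiv.Perm (Fin (X.sz n k)))

theorem play_perm (hσ : ∀ b : Bool, σ (X.tg n).k (if b then (X.tg n).i₁ else (X.tg n).i₀) =
      if !b then (X.tg n).i₁ else (X.tg n).i₀) (b : Bool) (m : Misc T n (X.sz n))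
    (κ : Fin (2 ^ n)) (tag : Tag n (X.sz n)) (kc : (ℕ × ℕ) × Ct (X.sz n)) (pp : T.Param n)
    (lab : Lab T n (X.sz n)) :
    X.play F n b m κ (tag.1, fun s w => tag.2 s (permWord σ w))
        (kc.1, kc.2.1, fun s w => kc.2.2.1 s (permWord σ w), kc.2.2.2) pp
        (lab.1, fun w => lab.2 (permWord σ w)) =
      X.play F n (!b) (m.1, m.2.1, conjPerms σ X.c m.2.1 m.2.2) κ tag kc pp lab := by
  unfold play
  congr 1
  exact viewOf_permHon σ X.c _ id (leavesOf T X.c m.1.1 m.1.2 κ lab tag kc) _ _ _ _ hσ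

/-- Only the refreshed labels are permuted. They are independent of the labels before the round and
identically distributed over the words; this fails for the real labels. -/
theorem labIdeal_map :
    (X.labIdeal n).map (fun lab => (lab.1, fun w => lab.2 (permWord σ w))) =
      X.labIdeal (T := T) n := by
  simp only [labIdeal, PMF.map_bind, PMF.pure_map]
  congr 1
  funext L₁
  exact unif_bind_of_map (unif_map_comp (R := T.G n) (permWord σ) (permWord σ).injective)
    fun L => PMF.pure (L₁, L)

/-- The refreshed tags are the last cells of the tape, and the tags before the round use only
earlier cells. Permuting the last cells alone is thus a relabelling of independent uniform values.
-/
theorem tagIdeal_map (κ : Fin (2 ^ n)) :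
    (X.tagIdeal F n κ).map (fun tag => (tag.1, fun s w => tag.2 s (permWord σ w))) =
      X.tagIdeal F n κ := by
  have hi : Function.Injective fun x : (Server × Word (X.sz n)) × Fin (X.u n + 2) =>
      ((x.1.1, if x.2 = Fin.last _ then permWord σ x.1.2 else x.1.2), x.2) := by
    rintro ⟨⟨s, w⟩, j⟩ ⟨⟨s', w'⟩, j'⟩ h
    simp only [Prod.mk.injEq] at h
    obtain ⟨⟨rfl, h⟩, rfl⟩ := h
    split_ifs at h
    · rw [(permWord σ).injective h]
    · rw [h]
  rw [tagIdeal, PMF.map_comp]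
  conv_rhs => rw [← unif_map_comp (R := Fin (2 ^ n)) _ hi, PMF.map_comp]
  congr 1
  funext z
  simp [tapeTags, Fin.castSucc_ne_last]

/-- Permuting the refreshed ciphertexts permutes plaintexts and randomizers together. The plaintexts
are invariant by hypothesis and the randomizers are independent and uniform. -/
theorem kcDist_map (S : KeySplit) (m₁ m₂ : Server → Word (X.sz n) → ℕ)
    (hm : ∀ s w, m₂ s (permWord σ w) = m₂ s w) :
    (X.kcDist n S m₁ m₂).map (fun kc =>
      (kc.1, kc.2.1, fun s w => kc.2.2.1 s (permWord σ w), kc.2.2.2)) = X.kcDist n S m₁ m₂ := by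
  have hi : Function.Injective fun x : Fin 3 × Server × Word (X.sz n) =>
      (x.1, x.2.1, if x.1 = 1 then permWord σ x.2.2 else x.2.2) := by
    rintro ⟨j, s, w⟩ ⟨j', s', w'⟩ h
    simp only [Prod.mk.injEq] at h
    obtain ⟨rfl, rfl, h⟩ := h
    split_ifs at h
    · rw [(permWord σ).injective h]
    · rw [h]
  rw [kcDist, PMF.map_bind]
  congr 1
  funext key
  rw [PMF.map_comp]
  conv_rhs => rw [← unif_map_comp (R := (ZMod key.1)ˣ) _ hi, PMF.map_comp]
  congr 1
  funext R
  simp [ctOf, hm]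

theorem exists_swap (m₂ : Server → Word (X.sz n) → ℕ)
    (hm : ∀ s, m₂ s ⟨(X.tg n).k, (X.tg n).i₀⟩ = m₂ s ⟨(X.tg n).k, (X.tg n).i₁⟩) :
    ∃ σ : ∀ k, Equiv.Perm (Fin (X.sz n k)),
      (∀ b : Bool, σ (X.tg n).k (if b then (X.tg n).i₁ else (X.tg n).i₀) =
        if !b then (X.tg n).i₁ else (X.tg n).i₀) ∧
      ∀ s w, m₂ s (permWord σ w) = m₂ s w := by
  refine ⟨Function.update 1 (X.tg n).k (Equiv.swap (X.tg n).i₀ (X.tg n).i₁), fun b => ?_, ?_⟩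
  · cases b <;> simp
  · rintro s ⟨k, i⟩
    by_cases hk : k = (X.tg n).k
    · subst hk
      simp only [permWord, Equiv.sigmaCongrRight_apply, Function.update_self]
      by_cases h₀ : i = (X.tg n).i₀
      · rw [h₀, Equiv.swap_apply_left, hm]
      by_cases h₁ : i = (X.tg n).i₁
      · rw [h₁, Equiv.swap_apply_right, hm]
      rw [Equiv.swap_apply_of_ne_of_ne h₀ h₁]
    · simp [permWord, Function.update_of_ne hk]

/-- For fixed `πc` the change of the honest permutations is composition with fixed bijections, hence
injective on a finite set. -/
theorem unif_misc_map :
    (unif (Misc T n (X.sz n))).map (fun m => (m.1, m.2.1, conjPerms σ X.c m.2.1 m.2.2)) =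
      unif (Misc T n (X.sz n)) := by
  refine unif_map_equiv (Equiv.ofBijective _ (Finite.injective_iff_bijective.1 ?_))
  rintro ⟨x, πc, πd⟩ ⟨x', πc', πd'⟩ h
  simp only [Prod.mk.injEq] at h
  obtain ⟨rfl, rfl, h⟩ := h
  congr 2
  funext s k
  have h := congrFun (congrFun h s) k
  unfold conjPerms at h
  refine Equiv.ext fun j => ?_
  have h := congrArg (fun e : Equiv.Perm _ => e j) h
  split_ifs at h <;> simpa using h

/-- If the plaintexts of both entries agree, the challenge bit is independent of the view. -/
theorem prob_game_ideal (S : KeySplit) (m₁ m₂ : Server → Word (X.sz n) → ℕ)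
    (hm : ∀ s, m₂ s ⟨(X.tg n).k, (X.tg n).i₀⟩ = m₂ s ⟨(X.tg n).k, (X.tg n).i₁⟩) :
    prob (X.game F n (fun _ => X.labIdeal n) (X.tagIdeal F n) (X.kcDist n S m₁ m₂)) = 1 / 2 := by
  obtain ⟨σ, hσ, hσm⟩ := X.exists_swap n m₂ hm
  let H : Bool → Misc T n (X.sz n) → PMF Bool := fun b m =>
    (unif (Fin (2 ^ n))).bind fun κ => (X.tagIdeal F n κ).bind fun tag =>
      (X.kcDist n S m₁ m₂).bind fun kc => (T.setup n).bind fun pp => (X.labIdeal n).bind fun lab =>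
        X.play F n b m κ tag kc pp lab
  -- The invariances of tags, ciphertexts and labels allow the refreshed entries to be permuted
  -- inside the game, where the permutation turns into a change of the honest permutations and of
  -- the bit.
  have hH : ∀ m, H true m = H false (m.1, m.2.1, conjPerms σ X.c m.2.1 m.2.2) := by
    intro m
    refine congrArg (PMF.bind _) (funext fun κ => ?_)
    refine bind_eq_bind_of_map_eq (X.tagIdeal_map F n σ κ) fun tag => ?_
    refine bind_eq_bind_of_map_eq (X.kcDist_map n σ S m₁ m₂ hσm) fun kc => ?_
    refine congrArg (PMF.bind _) (funext fun pp => ?_)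
    refine bind_eq_bind_of_map_eq (X.labIdeal_map n σ) fun lab => ?_
    exact X.play_perm F n σ hσ true m κ tag kc pp lab
  have hG : (unif (Misc T n (X.sz n))).bind (H true) = (unif _).bind (H false) :=
    (congrArg (PMF.bind _) (funext hH)).trans (unif_bind_of_map (X.unif_misc_map n σ) (H false))
  have h : X.game F n (fun _ => X.labIdeal n) (X.tagIdeal F n) (X.kcDist n S m₁ m₂) =
      (unif Bool).bind fun b => ((unif (Misc T n (X.sz n))).bind (H b)).map (· == b) := by
    simp only [game, H, PMF.map_bind]
  have ht : (fun x : Bool => x == true) = id := by funext x; cases x <;> rfl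
  have hf : (fun x : Bool => x == false) = not := by funext x; cases x <;> rfl
  -- The output has the same distribution for both bits, and it is correct for one bit exactly when
  -- it is wrong for the other.
  rw [h, prob_unif_bool_bind, ht, hf, prob_map_not, PMF.map_id, hG]
  ring

end Setting

/-! ## The view in the shuffle experiment -/

namespace Server

theorem other_other (s : Server) : s.other.other = s := by cases s <;> rfl

theorem other_ne (s : Server) : s.other ≠ s := by cases s <;> simp [other]

theorem eq_or_eq_other (c s : Server) : s = c ∨ s = c.other := by
  cases c <;> cases s <;> simp [other]

end Server

/-- An entry with its components written as strings. -/
def Entry.toTriple {T : TPF} {n : ℕ} (e : Entry T n) : Triple ℕ :=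
  ⟨T.enc n e.label, e.id, e.tag.val⟩

theorem listEntries_eq {T : TPF} {n l : ℕ} {L : Fin l → Entry T n} {L' : Fin l → Triple ℕ}
    (h : ∀ j, (L j).toTriple = L' j) : listEntries L = flatTriples L' := by
  rw [← funext h]
  rfl

section View

variable {T : TPF} (F : KeyedFun) {n N : ℕ} {sz : Kind → ℕ}

/-- The intermediate list of the share of `s`. -/
def midEntries (r : Server → ShuffleParam T n) (pre : Server → ∀ k, Fin (sz k) → Entry T n)
    (coins : Server → Server → ∀ k, Coins N (sz k)) (s : Server) (k : Kind) :
    Fin (sz k) → Entry T n :=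
  pass F N (r s.other) (coins s s.other k) (pre s k)

/-- The final list of the share of `s`. -/
def postEntries (r : Server → ShuffleParam T n) (pre : Server → ∀ k, Fin (sz k) → Entry T n)
    (coins : Server → Server → ∀ k, Coins N (sz k)) (s : Server) (k : Kind) :
    Fin (sz k) → Entry T n :=
  pass F N (r s) (coins s s k) (midEntries F r pre coins s k)

/-- What the server `c` sees of the index `k` of the share of `s`. -/
def entriesPart (c : Server) (r : Server → ShuffleParam T n)
    (pre : Server → ∀ k, Fin (sz k) → Entry T n)
    (coins : Server → Server → ∀ k, Coins N (sz k)) (s : Server) (k : Kind) : List ℕ :=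
  listEntries (pre s k) ++ listEntries (midEntries F r pre coins s k) ++
    listEntries (postEntries F r pre coins s k) ++ listCoins (coins s c k)

/-- The final position of the challenge entry. -/
def finalPos (coins : Server → Server → ∀ k, Coins N (sz k)) (tg : Target sz) (b : Bool) :
    Fin (sz tg.k) :=
  (coins tg.o tg.o tg.k).2.symm
    ((coins tg.o tg.o.other tg.k).2.symm (if b then tg.i₁ else tg.i₀))

/-- The view of the server `c`. -/
def serverView (c : Server) (pdk auth : ℕ) (r : Server → ShuffleParam T n)
    (pre : Server → ∀ k, Fin (sz k) → Entry T n)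
    (coins : Server → Server → ∀ k, Coins N (sz k)) (tg : Target sz) (b : Bool) : List ℕ :=
  [N, pdk, (r c).1.val.val, (r c).2.val, auth] ++
    entriesPart F c r pre coins .cs1 .pref ++ entriesPart F c r pre coins .cs1 .keyword ++
    entriesPart F c r pre coins .cs2 .pref ++ entriesPart F c r pre coins .cs2 .keyword ++
    (pre tg.o tg.k tg.i₀).toList ++ (pre tg.o tg.k tg.i₁).toList ++
    (postEntries F r pre coins tg.o tg.k (finalPos coins tg b)).toList ++
    [(finalPos coins tg b).val]

theorem toTriple_refresh {V : Leaves ℕ sz} {r : ShuffleParam T n} (hN : V.N = N)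
    (hrho : V.rho = r.1.val.val) (hkap : V.kap = r.2.val) (e : Entry T n) (g : (ZMod N)ˣ) :
    (refresh F N r e g).toTriple = refreshNat T F n V e.toTriple g.val.val := by
  subst hN
  simp only [Entry.toTriple, refresh, refreshNat, hrho, hkap, T.encPow_enc, prfNat_val, TPF.reEnc,
    turReEnc, turEnc, pow_zero, one_mul]

/-- In the share where `c` shuffles first, the honest server meets the entry `i` at position `πc⁻¹
i`. This is why its randomizer is taken there once the refreshed entries are listed in plaintext
order. -/
theorem serverView_eq (c : Server) (r : Server → ShuffleParam T n)
    (pre : Server → ∀ k, Fin (sz k) → Entry T n)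
    (coins : Server → Server → ∀ k, Coins N (sz k)) (tg : Target sz) (b : Bool)
    {V : Leaves ℕ sz} (hN : V.N = N) (hrho : V.rho = (r c).1.val.val)
    (hkap : V.kap = (r c).2.val) (hpre : ∀ s k i, V.pre s ⟨k, i⟩ = (pre s k i).toTriple)
    (hc : ∀ k i, V.hon c ⟨k, i⟩ =
      (refresh F N (r c.other) (pre c k i) ((coins c c.other k).1 i)).toTriple)
    (hd : ∀ k i, V.hon c.other ⟨k, i⟩ = (refresh F N (r c.other)
      (refresh F N (r c) (pre c.other k i) ((coins c.other c k).1 i))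
      ((coins c.other c.other k).1 ((coins c.other c k).2.symm i))).toTriple)
    (hcoin : ∀ s k i, V.coin s ⟨k, i⟩ = ((coins s c k).1 i).val.val) :
    serverView F c V.pdk V.auth r pre coins tg b =
      viewOf c (refreshNat T F n V) id V (fun s k => (coins s c k).2)
        (fun s k => (coins s c.other k).2) tg b := by
  have hmid : ∀ s k j, (midEntries F r pre coins s k j).toTriple =
      midList c (refreshNat T F n V) V (fun s k => (coins s c k).2)
        (fun s k => (coins s c.other k).2) s k j := by
    intro s k j
    unfold midList midEntries pass
    obtain rfl | rfl := Server.eq_or_eq_other c s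
    · rw [if_pos rfl, hc]
    · rw [if_neg c.other_ne, Server.other_other, toTriple_refresh F hN hrho hkap, hpre, hcoin]
  have hpost : ∀ s k j, (postEntries F r pre coins s k j).toTriple =
      postList c (refreshNat T F n V) V (fun s k => (coins s c k).2)
        (fun s k => (coins s c.other k).2) s k j := by
    intro s k j
    unfold postList postEntries midEntries pass
    obtain rfl | rfl := Server.eq_or_eq_other c s
    · rw [if_pos rfl, hc, toTriple_refresh F hN hrho hkap, hcoin]
    · rw [if_neg c.other_ne, Server.other_other, hd, Equiv.symm_apply_apply]
  have hpos : finalPos coins tg b = tg.pos c (fun s k => (coins s c k).2)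
      (fun s k => (coins s c.other k).2) b := by
    obtain ⟨o, k, i₀, i₁⟩ := tg
    unfold finalPos Target.pos
    obtain rfl | rfl := Server.eq_or_eq_other c o
    · rw [if_pos rfl]
    · simp only [if_neg c.other_ne, Server.other_other]
  have hpart : ∀ s k, entriesPart F c r pre coins s k =
      viewPart c (refreshNat T F n V) id V (fun s k => (coins s c k).2)
        (fun s k => (coins s c.other k).2) s k := by
    intro s k
    unfold entriesPart viewPart
    rw [listEntries_eq fun i => (hpre s k i).symm, listEntries_eq (hmid s k),
      listEntries_eq (hpost s k)]
    simp only [listCoins, hcoin, id]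
  have hl : ∀ e : Entry T n, e.toList = e.toTriple.toList := fun _ => rfl
  simp only [serverView, viewOf, hpart, hl, hpost, hpos, hpre, hN, hrho, hkap, id]

end View

/-! ## Entries after several rounds -/

section Rounds

variable {T : TPF} (F : KeyedFun) {n N : ℕ} (pp : T.Param n)

/-- An entry with label under `K` and ciphertext with randomizer `h`. -/
def stdEntry (K : T.Key n) (x m : ℕ) (h : (ZMod N)ˣ) (t : Fin (2 ^ n)) : Entry T n :=
  ⟨T.rnd pp K x, turEnc N m h, t⟩

theorem TPF.reEnc_rnd_mul (T : TPF) {n : ℕ} (pp : T.Param n) (K ρ : T.Key n) (x : ℕ) :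
    T.reEnc (T.rnd pp K x) ρ = T.rnd pp (K * ρ) x := by
  rw [← T.reEnc_rnd pp K (K * ρ) x, TPF.recKeyGen, mul_div_cancel_left]

theorem refresh_stdEntry (hN : N ≠ 0) (r : ShuffleParam T n) (K : T.Key n) (x m : ℕ)
    (h g : (ZMod N)ˣ) (t : Fin (2 ^ n)) :
    refresh F N r (stdEntry pp K x m h t) g =
      stdEntry pp (K * r.1) x m (h * g) (F n r.2 t.val) := by
  simp only [refresh, stdEntry, T.reEnc_rnd_mul, turReEnc_turEnc hN]

/-- Label keys and randomizers multiply in commutative groups, so their accumulated values ignore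
which server acts first. Tag functions do not commute, which is why `preTag` distinguishes the
shares. -/
theorem foldl_refresh (hN : N ≠ 0) (c : Server) (r : Server → ShuffleParam T n) (s : Server)
    (x m : ℕ) (l : List (Server → (ZMod N)ˣ)) (K : T.Key n) (h : (ZMod N)ˣ) (t : Fin (2 ^ n)) :
    l.foldl (fun e ρ => refresh F N (r s) (refresh F N (r s.other) e (ρ s.other)) (ρ s))
        (stdEntry pp K x m h t) =
      stdEntry pp (K * ((r c).1 * (r c.other).1) ^ l.length) x m
        (h * (l.map fun ρ => ρ .cs1 * ρ .cs2).prod)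
        (preTag c (fun y => F n (r c).2 y.val) (fun y => F n (r c.other).2 y.val) l.length s t) := by
  induction l generalizing K h t with
  | nil => simp [preTag]
  | cons ρ l ih =>
    rw [List.foldl_cons, refresh_stdEntry F pp hN, refresh_stdEntry F pp hN, ih]
    congr 1
    · rw [List.length_cons, pow_succ']
      obtain rfl | rfl := Server.eq_or_eq_other c s
      · simp only [mul_assoc, mul_left_comm, mul_comm]
      · simp only [Server.other_other, mul_assoc, mul_left_comm, mul_comm]
    · rw [List.map_cons, List.prod_cons]
      cases s <;> simp only [Server.other, mul_assoc, mul_left_comm, mul_comm]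
    · obtain rfl | rfl := Server.eq_or_eq_other c s
      · simp [preTag]
      · simp [preTag, Server.other_ne, Server.other_other]

/-- The product of all randomizers of an entry. -/
def histProd {N u : ℕ} : History N u →* (ZMod N)ˣ where
  toFun h := h.1 * (List.ofFn fun j => h.2 j .cs1 * h.2 j .cs2).prod
  map_one' := by simp
  map_mul' h h' := by
    simp only [List.prod_ofFn, Prod.fst_mul, Prod.snd_mul, Pi.mul_apply, Finset.prod_mul_distrib]
    simp only [mul_assoc, mul_left_comm]

theorem histProd_surjective {N u : ℕ} : Function.Surjective (histProd (N := N) (u := u)) :=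
  fun g => ⟨(g, 1), by simp [histProd]⟩

theorem currentEntry_eq (hN : N ≠ 0) (c : Server) (kM : T.Key n) (kT : Fin (2 ^ n))
    (r : Server → ShuffleParam T n) (s : Server) (x m : ℕ) {u : ℕ} (h : History N u) :
    currentEntry F pp N kM kT r s x m h =
      stdEntry pp (kM * ((r c).1 * (r c.other).1) ^ u) x m (histProd h)
        (preTag c (fun y => F n (r c).2 y.val) (fun y => F n (r c.other).2 y.val) u s
          (F n kT (Nat.pair s.num x))) := by
  have := foldl_refresh F pp hN c r s x m (List.ofFn h.2) kM h.1 (F n kT (Nat.pair s.num x))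
  rw [List.length_ofFn, List.map_ofFn] at this
  exact this

end Rounds

/-! ## Changing variables in the shuffle experiment -/

theorem unif_server_bind {α : Type} {γ : Type*} [Finite α] [Nonempty α] (c : Server)
    (f : (Server → α) → PMF γ) :
    (unif (Server → α)).bind f =
      (unif α).bind fun x => (unif α).bind fun y => f fun s => if s = c then x else y := by
  let e : α × α ≃ (Server → α) :=
    { toFun := fun p s => if s = c then p.1 else p.2
      invFun := fun r => (r c, r c.other)
      left_inv := fun p => by simp [c.other_ne]
      right_inv := fun r => by
        funext s
        obtain rfl | rfl := Server.eq_or_eq_other c s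
        · simp
        · simp [c.other_ne] }
  rw [← unif_bind_equiv e, unif_prod_bind]
  rfl

/-- Three translations decouple the keys: `kU` becomes `kM / kU`, then `kM` becomes `k₁ = kM * (ρ *
ρ') ^ u`, and finally `ρ'` becomes `k₂ = k₁ * ρ'`. The exponent `ρ` of the corrupted server remains
a separate variable, so revealing it costs nothing. -/
theorem unif_bind_keys {K κ : Type} {γ : Type*} [CommGroup K] [Finite K] [Finite κ] [Nonempty κ]
    (c : Server) (u : ℕ) (f : K → K → κ → κ → K → K → PMF γ) :
    ((unif K).bind fun kM => (unif K).bind fun kU => (unif (Server → K × κ)).bind fun r =>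
      f (r c).1 (kM / kU) (r c).2 (r c.other).2 (kM * ((r c).1 * (r c.other).1) ^ u)
        (kM * ((r c).1 * (r c.other).1) ^ u * (r c.other).1)) =
      (unif K).bind fun ρ => (unif K).bind fun a => (unif κ).bind fun x => (unif κ).bind fun y =>
        (unif K).bind fun k₂ => (unif K).bind fun k₁ => f ρ a x y k₁ k₂ := by
  have h₁ : ∀ kM : K, ((unif K).bind fun kU => (unif (Server → K × κ)).bind fun r =>
      f (r c).1 (kM / kU) (r c).2 (r c.other).2 (kM * ((r c).1 * (r c.other).1) ^ u)
        (kM * ((r c).1 * (r c.other).1) ^ u * (r c.other).1)) =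
      (unif K).bind fun a => (unif K).bind fun ρ => (unif κ).bind fun x => (unif K).bind fun ρ' =>
        (unif κ).bind fun y =>
          f ρ a x y (kM * (ρ * ρ') ^ u) (kM * (ρ * ρ') ^ u * ρ') := by
    intro kM
    rw [← unif_bind_equiv (Equiv.divLeft kM) fun a => (unif K).bind fun ρ => (unif κ).bind fun x =>
      (unif K).bind fun ρ' => (unif κ).bind fun y =>
        f ρ a x y (kM * (ρ * ρ') ^ u) (kM * (ρ * ρ') ^ u * ρ')]
    congr 1
    funext kU
    simp only [unif_server_bind c, unif_prod_bind, if_true, c.other_ne, if_false,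
      Equiv.divLeft_apply]
  simp only [h₁]
  rw [Setting.bind_comm₃, PMF.bind_comm]
  congr 1
  funext ρ
  congr 1
  funext a
  rw [Setting.bind_comm₃]
  congr 1
  funext x
  rw [← Setting.bind_comm₃]
  congr 1
  funext y
  -- With `ρ` and `ρ'` fixed, `kM` is translated by `(ρ * ρ') ^ u`, which removes all trace of the
  -- previous rounds from the keys.
  have h₂ : ∀ ρ' : K, ((unif K).bind fun kM =>
      f ρ a x y (kM * (ρ * ρ') ^ u) (kM * (ρ * ρ') ^ u * ρ')) =
      (unif K).bind fun k₁ => f ρ a x y k₁ (k₁ * ρ') := fun ρ' =>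
    unif_bind_equiv (Equiv.mulRight ((ρ * ρ') ^ u)) fun k₁ => f ρ a x y k₁ (k₁ * ρ')
  simp only [h₂]
  rw [PMF.bind_comm]
  conv_rhs => rw [PMF.bind_comm]
  congr 1
  funext k₁
  exact unif_bind_equiv (Equiv.mulLeft k₁) fun k₂ => f ρ a x y k₁ k₂

theorem unif_bind_vec₃ {ι G : Type} {γ : Type*} [Finite ι] [Finite G] [Nonempty G]
    (f : (Fin 3 × ι → G) → PMF γ) :
    ((unif (ι → G)).bind fun R₁ => (unif (ι → G)).bind fun R₃ => (unif (ι → G)).bind fun R₂ =>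
      f fun x => (![R₁, R₂, R₃] : Fin 3 → ι → G) x.1 x.2) = (unif (Fin 3 × ι → G)).bind f := by
  let e : (ι → G) × (ι → G) × (ι → G) ≃ (Fin 3 × ι → G) :=
    { toFun := fun p x => (![p.1, p.2.2, p.2.1] : Fin 3 → ι → G) x.1 x.2
      invFun := fun R => (fun i => R (0, i), fun i => R (2, i), fun i => R (1, i))
      left_inv := fun p => rfl
      right_inv := fun R => by
        funext ⟨j, i⟩
        fin_cases j <;> rfl }
  rw [← unif_bind_equiv e, unif_prod_bind]
  simp only [unif_prod_bind]
  rfl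

/-! ### Independence of the ciphertext randomizers -/

section Randomizers

variable {N u : ℕ} {sz : Kind → ℕ} (c : Server)

/-- The randomizers of the ciphertexts before the round, of those after the refresh by the honest
server, and of the refresh by the corrupted server. -/
def randomizers (R₁ : Server × Word sz → (ZMod N)ˣ)
    (coins : Server → Server → ∀ k, Coins N (sz k)) :
    Fin 3 × Server × Word sz → (ZMod N)ˣ := fun x =>
  (![R₁, fun y => R₁ y * (if y.1 = c then 1 else (coins y.1 c y.2.1).1 y.2.2) *
      (coins y.1 c.other y.2.1).1
        (if y.1 = c then y.2.2 else (coins y.1 c y.2.1).2.symm y.2.2),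
    fun y => (coins y.1 c y.2.1).1 y.2.2] : Fin 3 → Server × Word sz → (ZMod N)ˣ) x.1 x.2

/-- The coins of both servers. -/
def coinsEquiv : (Perms sz × Perms sz) × (Server × Word sz → (ZMod N)ˣ) ×
    (Server × Word sz → (ZMod N)ˣ) ≃ (Server → Server → ∀ k, Coins N (sz k)) where
  toFun p s t k := if t = c then (fun i => p.2.1 (s, ⟨k, i⟩), p.1.1 s k)
    else (fun i => p.2.2 (s, ⟨k, i⟩), p.1.2 s k)
  invFun w := ((fun s k => (w s c k).2, fun s k => (w s c.other k).2),
    fun x => (w x.1 c x.2.1).1 x.2.2, fun x => (w x.1 c.other x.2.1).1 x.2.2)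
  left_inv p := by simp [c.other_ne]
  right_inv w := by
    funext s t k
    obtain rfl | rfl := Server.eq_or_eq_other c t
    · simp
    · simp [c.other_ne]

/-- The accumulated randomizers before the round are uniform as a homomorphic image of the
histories. Those after the honest refresh carry an honest factor of their own for each entry, hence
are uniform given everything else, including the coins and permutations of the corrupted server. -/
theorem unif_bind_coins {γ : Type*} (f : Perms sz × Perms sz → (Fin 3 × Server × Word sz →
      (ZMod N)ˣ) → PMF γ) :
    ((unif (Server → ∀ k, Fin (sz k) → History N u)).bind fun hist =>
      (unif (Server → Server → ∀ k, Coins N (sz k))).bind fun coins =>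
        f (fun s k => (coins s c k).2, fun s k => (coins s c.other k).2)
          (randomizers c (fun x => histProd (hist x.1 x.2.1 x.2.2)) coins)) =
      (unif (Perms sz × Perms sz)).bind fun π => (unif _).bind fun R => f π R := by
  let φ : (Server → ∀ k, Fin (sz k) → History N u) →* (Server × Word sz → (ZMod N)ˣ) :=
    { toFun := fun hist x => histProd (hist x.1 x.2.1 x.2.2)
      map_one' := by funext x; simp
      map_mul' := fun h h' => by funext x; simp }
  have hφ : Function.Surjective φ := by
    intro R
    choose g hg using fun x => histProd_surjective (u := u) (R x)
    exact ⟨fun s k i => g (s, ⟨k, i⟩), funext fun x => hg x⟩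
  refine (unif_bind_of_map (unif_map_hom φ hφ) fun R₁ =>
    (unif (Server → Server → ∀ k, Coins N (sz k))).bind fun coins =>
        f (fun s k => (coins s c k).2, fun s k => (coins s c.other k).2)
          (randomizers c R₁ coins)).trans ?_
  simp only [← unif_bind_equiv (coinsEquiv (N := N) (sz := sz) c), unif_prod_bind (α := _ × _)]
  rw [PMF.bind_comm]
  congr 1
  funext π
  rw [← unif_bind_vec₃]
  congr 1
  funext R₁
  rw [unif_prod_bind]
  congr 1
  funext R₃
  -- Distinct entries use distinct honest coins, even though in one share the coins are indexed by
  -- shuffled positions.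
  have hi : Function.Injective fun y : Server × Word sz =>
      (y.1, (⟨y.2.1, if y.1 = c then y.2.2 else (π.1 y.1 y.2.1).symm y.2.2⟩ : Word sz)) := by
    rintro ⟨s, k, i⟩ ⟨s', k', i'⟩ h
    simp only [Prod.mk.injEq, Sigma.mk.injEq] at h
    obtain ⟨rfl, rfl, h⟩ := h
    have h := eq_of_heq h
    split_ifs at h with hs
    · rw [h]
    · rw [(π.1 s k).symm.injective h]
  -- The factor collected before the honest server multiplies in its own coin; translation by it
  -- preserves uniformity.
  let a : Server × Word sz → (ZMod N)ˣ := fun y => R₁ y * if y.1 = c then 1 else R₃ y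
  conv_rhs => rw [← unif_bind_equiv (Equiv.mulLeft a), ← unif_bind_of_map (unif_map_comp _ hi)]
  congr 1
  funext R₂
  congr 1
  · simp [coinsEquiv, c.other_ne]
  · funext ⟨j, y⟩
    fin_cases j <;> simp [randomizers, coinsEquiv, c.other_ne, a]

end Randomizers

/-! ### The shuffle experiment in independent variables, and the chain of hybrids -/

namespace Setting

variable {T : TPF} (F : KeyedFun) (X : Setting T) (S : KeySplit) (n : ℕ)

/-- The shuffle experiment, for plaintexts `m`. -/
noncomputable def shuffleGame (m : Server → Word (X.sz n) → ℕ) : PMF Bool :=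
  (T.setup n).bind fun pp => (unif (T.Key n)).bind fun kM => (unif (T.Key n)).bind fun kU =>
    (turSetup n).bind fun pq => (S.keyGen n pq.1 pq.2).bind fun pdk =>
    (unif (Server → ShuffleParam T n)).bind fun r => (unif (Fin (2 ^ n))).bind fun kT =>
    (unif (Server → ∀ k, Fin (X.sz n k) → History (pq.1 * pq.2) (X.u n))).bind fun hist =>
    (unif (Server → Server → ∀ k, Coins (pq.1 * pq.2) (X.sz n k))).bind fun coins =>
    (unif Bool).bind fun b =>
      ((X.A.prog n).out (env T F n pp fun _ => 0)
        (serverView F X.c (pdk X.c) (T.recKeyGen kU kM).val.val r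
          (fun s k i => currentEntry F pp (pq.1 * pq.2) kM kT r s (X.word n ⟨k, i⟩)
            (m s ⟨k, i⟩) (hist s k i)) coins (X.tg n) b)).map (· == b)

/-- Expresses the real view through the variables that become independent: two label keys whose
ratio is the exponent of the honest server, chains of tags, and products of randomizers. -/
theorem out_serverView {N : ℕ} (hN : N ≠ 0) (m : Server → Word (X.sz n) → ℕ) (pp : T.Param n)
    (kM kU : T.Key n) (pdk : ℕ) (r : Server → ShuffleParam T n) (kT : Fin (2 ^ n))
    (hist : Server → ∀ k, Fin (X.sz n k) → History N (X.u n))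
    (coins : Server → Server → ∀ k, Coins N (X.sz n k)) (b : Bool) :
    (X.A.prog n).out (env T F n pp fun _ => 0)
        (serverView F X.c pdk (T.recKeyGen kU kM).val.val r
          (fun s k i => currentEntry F pp N kM kT r s (X.word n ⟨k, i⟩)
            (m s ⟨k, i⟩) (hist s k i)) coins (X.tg n) b) =
      X.play F n b (((r X.c).1, kM / kU), (fun s k => (coins s X.c k).2),
          fun s k => (coins s X.c.other k).2) (r X.c).2
        (X.tagsOf n (fun y => F n (r X.c).2 y.val) (fun y => F n (r X.c.other).2 y.val)
          fun x => F n kT (X.tagInput n x))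
        ((N, pdk), X.ctOf n m m N
          (randomizers X.c (fun x => histProd (hist x.1 x.2.1 x.2.2)) coins)) pp
        (fun w => T.rnd pp (kM * ((r X.c).1 * (r X.c.other).1) ^ X.u n) (X.word n w),
          fun w => T.rnd pp (kM * ((r X.c).1 * (r X.c.other).1) ^ X.u n * (r X.c.other).1)
            (X.word n w)) := by
  rw [play]
  congr 1
  refine serverView_eq F X.c r _ coins (X.tg n) b
    (V := leavesOf T X.c _ _ _ _ _ ((N, pdk), X.ctOf n m m N _)) rfl rfl rfl ?_ ?_ ?_ ?_
  · intro s k i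
    rw [currentEntry_eq F pp hN X.c]
    rfl
  · intro k i
    rw [currentEntry_eq F pp hN X.c, refresh_stdEntry F pp hN]
    simp [leavesOf, Entry.toTriple, stdEntry, tagsOf, honTag, ctOf, randomizers, tagInput]
  · intro k i
    rw [currentEntry_eq F pp hN X.c, refresh_stdEntry F pp hN, refresh_stdEntry F pp hN]
    simp [leavesOf, Entry.toTriple, stdEntry, tagsOf, honTag, ctOf, randomizers, tagInput,
      X.c.other_ne, T.reEnc_rnd_mul, mul_right_comm]
  · intro s k i
    rfl

theorem bind_keyGen_comm {α β : Type*} (p : PMF α) (pq : ℕ × ℕ)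
    (f : α → (Server → ℕ) → PMF β) :
    (p.bind fun a => (S.keyGen n pq.1 pq.2).bind fun d => f a d) =
      (S.keyGen n pq.1 pq.2).bind fun d => p.bind fun a => f a d :=
  PMF.bind_comm _ _ _

/-- Both sides are brought into a form with the Paillier keys, the parameters and the bit drawn
first. Under fixed such values `unif_bind_coins` and `unif_bind_keys` identify the remaining
randomness. -/
theorem shuffleGame_eq_game (m : Server → Word (X.sz n) → ℕ) :
    X.shuffleGame F S n m =
      X.game F n (X.labReal n) (X.tagReal F n) (X.kcDist n S m m) := by
  have hR : X.game F n (X.labReal n) (X.tagReal F n) (X.kcDist n S m m) =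
      (turSetup n).bind fun pq => (S.keyGen n pq.1 pq.2).bind fun pdk => (T.setup n).bind fun pp =>
        (unif Bool).bind fun b => (unif (T.Key n)).bind fun ρ => (unif (T.Key n)).bind fun a =>
        (unif (Perms (X.sz n) × Perms (X.sz n))).bind fun π => (unif (Fin (2 ^ n))).bind fun κ =>
        (unif (Fin (2 ^ n))).bind fun κ' => (unif (Fin (2 ^ n))).bind fun kT =>
        (unif (Fin 3 × Server × Word (X.sz n) → (ZMod (pq.1 * pq.2))ˣ)).bind fun R =>
        (unif (T.Key n)).bind fun k₂ => (unif (T.Key n)).bind fun k₁ =>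
        (X.play F n b ((ρ, a), π) κ
          (X.tagsOf n (fun y => F n κ y.val) (fun y => F n κ' y.val)
            fun x => F n kT (X.tagInput n x))
          ((pq.1 * pq.2, pdk X.c), X.ctOf n m m (pq.1 * pq.2) R) pp
          (fun w => T.rnd pp k₁ (X.word n w), fun w => T.rnd pp k₂ (X.word n w))).map (· == b) := by
    simp only [game, labReal, tagReal, kcDist, keyDist, PMF.bind_bind, PMF.pure_bind,
      PMF.bind_map, Function.comp_def, unif_prod_bind (α := _ × _), unif_prod_bind (α := T.Key n)]
    simp only [PMF.bind_comm _ (unif Bool)]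
    simp only [PMF.bind_comm _ (T.setup n)]
    simp only [PMF.bind_comm _ (turSetup n)]
    simp only [bind_keyGen_comm S n]
  have hL : X.shuffleGame F S n m =
      (turSetup n).bind fun pq => (S.keyGen n pq.1 pq.2).bind fun pdk => (T.setup n).bind fun pp =>
        (unif Bool).bind fun b => (unif (T.Key n)).bind fun kM => (unif (T.Key n)).bind fun kU =>
        (unif (Server → ShuffleParam T n)).bind fun r => (unif (Fin (2 ^ n))).bind fun kT =>
        (unif (Server → ∀ k, Fin (X.sz n k) → History (pq.1 * pq.2) (X.u n))).bind fun hist =>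
        (unif (Server → Server → ∀ k, Coins (pq.1 * pq.2) (X.sz n k))).bind fun coins =>
          ((X.A.prog n).out (env T F n pp fun _ => 0)
            (serverView F X.c (pdk X.c) (T.recKeyGen kU kM).val.val r
              (fun s k i => currentEntry F pp (pq.1 * pq.2) kM kT r s (X.word n ⟨k, i⟩)
                (m s ⟨k, i⟩) (hist s k i)) coins (X.tg n) b)).map (· == b) := by
    simp only [shuffleGame]
    simp only [PMF.bind_comm _ (unif Bool)]
    simp only [PMF.bind_comm _ (T.setup n)]
    simp only [PMF.bind_comm _ (turSetup n)]
    simp only [bind_keyGen_comm S n]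
  rw [hR, hL]
  refine bind_congr_support _ fun pq hpq => congrArg (PMF.bind _) (funext fun pdk =>
    congrArg (PMF.bind _) (funext fun pp => congrArg (PMF.bind _) (funext fun b => ?_)))
  simp only [X.out_serverView F n (turSetup_range hpq).1]
  let Ψ : T.Key n → T.Key n → Fin (2 ^ n) → Fin (2 ^ n) → T.Key n → T.Key n → Fin (2 ^ n) →
      Perms (X.sz n) × Perms (X.sz n) →
      (Fin 3 × Server × Word (X.sz n) → (ZMod (pq.1 * pq.2))ˣ) → PMF Bool :=
    fun ρ a κ κ' k₁ k₂ kT π R => (X.play F n b ((ρ, a), π) κ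
      (X.tagsOf n (fun y => F n κ y.val) (fun y => F n κ' y.val) fun x => F n kT (X.tagInput n x))
      ((pq.1 * pq.2, pdk X.c), X.ctOf n m m (pq.1 * pq.2) R) pp
      (fun w => T.rnd pp k₁ (X.word n w), fun w => T.rnd pp k₂ (X.word n w))).map (· == b)
  have h₁ := fun ρ a κ κ' k₁ k₂ kT =>
    unif_bind_coins (u := X.u n) X.c (Ψ ρ a κ κ' k₁ k₂ kT)
  have h₂ := unif_bind_keys X.c (X.u n) fun ρ a κ κ' k₁ k₂ =>
    (unif (Fin (2 ^ n))).bind fun kT => (unif _).bind fun π => (unif _).bind fun R =>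
      Ψ ρ a κ κ' k₁ k₂ kT π R
  simp only [← h₁] at h₂
  refine h₂.trans ?_
  simp only [h₁]
  simp only [PMF.bind_comm _ (unif (Perms (X.sz n) × Perms (X.sz n)))]
  refine congrArg (PMF.bind _) (funext fun π => congrArg (PMF.bind _) (funext fun ρ =>
    congrArg (PMF.bind _) (funext fun a => congrArg (PMF.bind _) (funext fun κ =>
    congrArg (PMF.bind _) (funext fun κ' => ?_)))))
  exact (congrArg (PMF.bind _) (funext fun k₂ => bind_comm₃ _ _ _ _)).trans (bind_comm₃ _ _ _ _)

/-- The setting of a family of shuffle experiments. -/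
def ofIndex (T : TPF) (S : KeySplit) (I : IndexFamily) (u : ℕ → ℕ) (hu : PolyBounded u)
    (c o : Server) (k : Kind) (i₀ i₁ : ∀ n, Fin ((I.index n).size k)) (A : Adversary) :
    Setting T where
  sz n := (I.index n).size
  word n w := (I.index n).word w.1 w.2
  word_injective n := (I.index n).word_injective
  c := c
  tg n := ⟨o, k, i₀ n, i₁ n⟩
  A := A
  u := u
  u_poly := hu
  -- One width for every reduction: encoded group elements, partial decryption keys, pairs of a
  -- server number and a word (`2 * wordLen + 4` bits), `N ^ 4` (`8 * n + 24` bits), list positions,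
  -- and bitmaps read as plaintexts.
  W n := T.len n + S.len n + 2 * I.wordLen n + 8 * n + (I.index n).size .pref +
    (I.index n).size .keyword + (I.index n).objects + 24
  W_poly := ((((((T.len_poly.add S.len_poly).add
    ((polyBounded_const 2).mul I.wordLen_poly)).add ((polyBounded_const 8).mul polyBounded_id)).add
    (I.size_poly .pref)).add (I.size_poly .keyword)).add I.objects_poly).add (polyBounded_const 24)
  len_le n := by omega
  n_le n := by omega
  sz_le n k := by cases k <;> omega
  word_lt n w := (Nat.size_le.1 (I.word_size n w.1 w.2)).trans_le
    (Nat.pow_le_pow_right two_pos (by omega))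
  pair_lt n s w := by
    have h₁ := Nat.size_le.1 (I.word_size n w.1 w.2)
    have h₂ : s.num ≤ 2 := by cases s <;> simp [Server.num]
    have h₃ : max s.num ((I.index n).word w.1 w.2) + 1 ≤ 2 ^ (I.wordLen n + 2) := by
      have : 1 ≤ 2 ^ I.wordLen n := Nat.one_le_two_pow
      rw [pow_add]
      omega
    refine (Nat.pair_lt_max_add_one_sq _ _).trans_le ((Nat.pow_le_pow_left h₃ 2).trans ?_)
    rw [← pow_mul]
    exact Nat.pow_le_pow_right two_pos (by omega)

theorem shuffleExp_eq_shuffleGame (I : IndexFamily) (u : ℕ → ℕ) (hu : PolyBounded u)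
    (c o : Server) (k : Kind) (i₀ i₁ : ∀ n, Fin ((I.index n).size k)) (A : Adversary) :
    shuffleExp T F S n (I.index n) (u n) c o k (i₀ n) (i₁ n) (A.prog n) =
      (ofIndex T S I u hu c o k i₀ i₁ A).shuffleGame F S n
        fun s w => Nat.ofBits ((I.index n).bitmap s w.1 w.2) :=
  rfl

/-- In every game with ciphertexts of given plaintexts, the challenge bit is guessed with
probability close to one half. -/
theorem negligible_game_sub_half {S : KeySplit} (hT : TPFSecure T F) (hF : FSecure T F)
    (hS : TURUnlinkable T F S) (hW : ∀ n, 8 * n + 24 + S.len n ≤ X.W n)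
    (m : ∀ n, Server → Word (X.sz n) → ℕ) (hm : ∀ n s w, m n s w < 2 ^ X.W n) :
    Negligible fun n =>
      |prob (X.game F n (X.labReal n) (X.tagReal F n) (X.kcDist n S (m n) (m n))) - 1 / 2| := by
  let w₀ : ∀ n, Word (X.sz n) := fun n => ⟨(X.tg n).k, (X.tg n).i₀⟩
  let w₁ : ∀ n, Word (X.sz n) := fun n => ⟨(X.tg n).k, (X.tg n).i₁⟩
  -- The plaintext of the refreshed first entry is changed in both shares, although the challenge
  -- concerns one: the refreshed labels are common to the shares, so the exchange of the two words
  -- has to be a symmetry of both. Ciphertexts before the round keep their plaintexts.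
  let m₁ : ∀ n, Server → Word (X.sz n) → ℕ := fun n s w =>
    if (s, w) = (.cs1, w₀ n) then m n s (w₁ n) else m n s w
  let m₂ : ∀ n, Server → Word (X.sz n) → ℕ := fun n s w =>
    if (s, w) = (.cs2, w₀ n) then m₁ n s (w₁ n) else m₁ n s w
  have hm₁ : ∀ n s w, m₁ n s w < 2 ^ X.W n := by
    intro n s w
    simp only [m₁]
    split_ifs <;> exact hm _ _ _
  have hm₂ : ∀ n s w, m₂ n s w < 2 ^ X.W n := by
    intro n s w
    simp only [m₂]
    split_ifs <;> exact hm₁ _ _ _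
  have hk : ∀ m m' : ∀ n, Server → Word (X.sz n) → ℕ, ∀ n,
      ∀ kc ∈ (X.kcDist n S (m n) (m' n)).support, InRange (X.W n) kc :=
    fun m m' n => X.inRange_kcDist n (hW n) _ _
  have a₁ := X.negligible_labReal_sub_labMid hT (fun n => X.tagReal F n)
    (fun n => X.kcDist n S (m n) (m n)) (hk m m)
  have a₂ := X.negligible_labMid_sub_labIdeal hT (fun n => X.tagReal F n)
    (fun n => X.kcDist n S (m n) (m n)) (hk m m)
  have a₃ := X.negligible_tagReal_sub_tagInit hF (fun n => X.labIdeal n)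
    (fun n => X.kcDist n S (m n) (m n)) (hk m m)
  have a₄ := X.negligible_tagInit_sub_tagFun hF (fun n => X.labIdeal n)
    (fun n => X.kcDist n S (m n) (m n)) (hk m m)
  have a₅ := X.negligible_tagFun_sub_tagIdeal hF (fun n _ => X.labIdeal n)
    (fun n => X.kcDist n S (m n) (m n))
  have a₆ := X.negligible_kcDist_sub_kcDist hS hW (fun n => X.labIdeal n)
    (fun n => X.tagIdeal F n) m m m₁ hm hm hm₁ (fun n => (.cs1, w₀ n))
    fun n s w h => if_neg h
  have a₇ := X.negligible_kcDist_sub_kcDist hS hW (fun n => X.labIdeal n)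
    (fun n => X.tagIdeal F n) m m₁ m₂ hm hm₁ hm₂ (fun n => (.cs2, w₀ n))
    fun n s w h => if_neg h
  refine ((((((a₁.add a₂).add a₃).add a₄).add a₅).add a₆).add a₇).mono
    (fun _ => abs_nonneg _) fun n => ?_
  -- The last game has value exactly 1/2, so the distance to 1/2 is bounded by the sum of the seven
  -- hybrid distances.
  have h := X.prob_game_ideal F n S (m n) (m₂ n) fun s => by
    cases s <;> simp [m₂, m₁, w₀, w₁]
  rw [← h]
  refine (abs_sub_le _ _ _).trans (add_le_add ?_ le_rfl)
  refine (abs_sub_le _ _ _).trans (add_le_add ?_ le_rfl)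
  refine (abs_sub_le _ _ _).trans (add_le_add ?_ le_rfl)
  refine (abs_sub_le _ _ _).trans (add_le_add ?_ le_rfl)
  refine (abs_sub_le _ _ _).trans (add_le_add ?_ le_rfl)
  exact abs_sub_le _ _ _

end Setting

end Brasp

theorem theorem2 (T : Brasp.TPF) (F : Brasp.KeyedFun) (S : Brasp.KeySplit)
    (hT : Brasp.TPFSecure T F) (hF : Brasp.FSecure T F) (hS : Brasp.TURUnlinkable T F S) :
    Brasp.ShuffleIndistinguishable T F S := by
  intro I u hu c o k i₀ i₁ A
  let X := Brasp.Setting.ofIndex T S I u hu c o k i₀ i₁ A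
  have h := X.negligible_game_sub_half F hT hF hS
    (fun n => by simp only [X, Brasp.Setting.ofIndex]; omega)
    (fun n s w => Nat.ofBits ((I.index n).bitmap s w.1 w.2)) fun n s w =>
      (Nat.ofBits_lt_two_pow _).trans_le (Nat.pow_le_pow_right two_pos
        (by simp only [X, Brasp.Setting.ofIndex]; omega))
  -- The error is the distance of the success probability from 1/2.
  refine ⟨_, h, fun n => ?_⟩
  rw [Brasp.Setting.shuffleExp_eq_shuffleGame F S n I u hu c o k i₀ i₁ A,
    Brasp.Setting.shuffleGame_eq_game]
  exact sub_le_iff_le_add'.1 (le_abs_self _)
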